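/- **Setting.** Consider $x_{t+1}=Ax_t+Bu_t+w_t$, $y_t=Cx_t+v_t$ with $x_t\in\mathbb R^{n_x}$, $u_t\in\mathbb R^{n_u}$, $y_t\in\mathbb R^{n_y}$. The law of $x_0$ is any distribution with finite second moment, and the $v_t\sim N(0,M)$, $M\succ0$, are independent of each other, of $x_0$ and of the disturbances. With the information vector $I_t=(y_0,\dots,y_t,u_0,\dots,u_{t-1})$, a control policy $\pi$ is a sequence of measurable maps $\pi_t: I_t\mapsto u_t$, and a distribution policy $\gamma$ is a sequence of measurable maps $\gamma_t: I_t\mapsto\mathbb P_t$ into the Borel probability measures on $\mathbb R^{n_x}$; given $I_t$, the disturbance $w_t$ has law $\mathbb P_t$ and is independent of $x_t$. Write $\bar x_t=\mathbb E[x_t\mid I_t]$ for the conditional expectation in the closed loop generated by the policies in force (in particular by the distribution policy $\gamma$ actually used). Let $Q\succeq0$, $R\succ0$, $$J_\infty(\pi,\gamma)=\limsup_{T\to\infty}\frac1T\,\mathbb E_{\mathbf y}\Big[\sum_{t=0}^{T-1}\mathbb E[x_t^\top Qx_t+u_t^\top Ru_t\mid I_t,u_t]\Big].$$ The nominal disturbance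 distributions $\mathbb Q_t$ have finite second moments, and their mean $\hat w$ and covariance $\hat\Sigma$ do not depend on $t$. For $\lambda>0$ let $$J_\infty^\lambda(\pi,\gamma)=\limsup_{T\to\infty}\frac1T\,\mathbb E_{\mathbf y}\Big[\sum_{t=0}^{T-1}\big(\mathbb E[x_t^\top Qx_t+u_t^\top Ru_t\mid I_t,u_t]-\lambda\,\mathrm G(\mathbb P_t,\mathbb Q_t)^2\big)\Big],$$ where, for distributions with means $\bar w,\hat w$ and covariances $\Sigma,\hat\Sigma$, $\mathrm G(\mathbb P,\mathbb Q)^2=\|\bar w-\hat w\|^2+\mathrm{Tr}[\Sigma+\hat\Sigma-2(\hat\Sigma^{1/2}\Sigma\hat\Sigma^{1/2})^{1/2}]$. **Stationary policies.** Fix $\lambda>0$ and put $\Phi=BR^{-1}B^\top-\lambda^{-1}I$. Let $P$ be the symmetric positive semidefinite solution of $P=Q+A^\top(I+P\Phi)^{-1}PA$, and let $$\begin{aligned}S&=Q+A^\top PA-P,& r&=[I-A^\top(I+P\Phi)^{-1}]^{-1}A^\top(I+P\Phi)^{-1}P\hat w,\\ K&=-R^{-1}B^\top(I+P\Phi)^{-1}PA,&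 L&=-R^{-1}B^\top(I+P\Phi)^{-1}(P\hat w+r),\\ H&=(\lambda I-P)^{-1}P(A+BK),& G&=(\lambda I-P)^{-1}(PBL+r+\lambda\hat w).\end{aligned}$$ Let $(\bar X,\bar X^-,\Sigma^*)$ be an optimal solution of the problem of maximizing $\mathrm{Tr}[SX+(P-\lambda I)\Sigma+2\lambda(\hat\Sigma^{1/2}\Sigma\hat\Sigma^{1/2})^{1/2}]$ over positive semidefinite $X,X^-,\Sigma$ subject to $X^-=AXA^\top+\Sigma$ and $X=X^--X^-C^\top(CX^-C^\top+M)^{-1}CX^-$. The stationary controller is $\pi_{ss}(I_t)=K\bar x_t+L$, the stationary distribution policy is $\gamma_{ss}(I_t)=N(H\bar x_t+G,\Sigma^*)$, and $$\rho(\lambda):=J^\lambda_\infty(\pi_{ss},\gamma_{ss}).$$ **Assumptions.** $\lambda I\succ P$; $\Phi\succeq0$; $(A,\Phi^{1/2})$ is stabilizable and $(A,Q^{1/2})$ is observable; $(A,C)$ is detectable and $(A,(\Sigma^*)^{1/2})$ is stabilizable. **Theorem (guaranteed cost).** Let $\theta>0$, and let $\bar\Gamma_{\mathcal D}$ be any set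 of distribution policies $\gamma$ such that $W_2(\gamma_t(I_t),\mathbb Q_t)\le\theta$ for all $t$ and $I_t$ ($W_2$ is the 2-Wasserstein distance for the Euclidean norm) and $$\limsup_{T\to\infty}\frac1T\,\mathbb E_{\mathbf y}[h(I_T)\mid\pi_{ss},\gamma]=0,\qquad h(I_t)=\bar x_t^\top P\bar x_t+2r^\top\bar x_t+\mathrm{Tr}[(S+P)\bar X].$$ Then $$\sup_{\gamma\in\bar\Gamma_{\mathcal D}}J_\infty(\pi_{ss},\gamma)\le\theta^2\lambda+\rho(\lambda).$$ -/

import Mathlib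

open MeasureTheory ProbabilityTheory Filter Matrix
open scoped ENNReal MatrixOrder

noncomputable section

namespace WDRC

/-- `ℝⁿ` with the Euclidean norm. -/
abbrev Vec (n : ℕ) : Type := EuclideanSpace ℝ (Fin n)

/-! ### Linear algebra and linear systems theory -/

/-- The linear map `x ↦ A x`. -/
abbrev act {m n : ℕ} (A : Matrix (Fin m) (Fin n) ℝ) : Vec n →ₗ[ℝ] Vec m :=
  Matrix.toEuclideanLin A

/-- The quadratic form `xᵀ Q x`. -/
def quad {n : ℕ} (Q : Matrix (Fin n) (Fin n) ℝ) (x : Vec n) : ℝ :=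
  inner ℝ x (act Q x)

/-- Schur stability: all (complex) eigenvalues lie strictly inside the unit circle. -/
def IsSchurStable {n : ℕ} (A : Matrix (Fin n) (Fin n) ℝ) : Prop :=
  ∀ z ∈ spectrum ℂ (A.map (algebraMap ℝ ℂ)), ‖z‖ < 1

/-- `(A, B)` is stabilizable: some feedback gain makes `A + B F` stable. -/
def IsStabilizable {n m : ℕ} (A : Matrix (Fin n) (Fin n) ℝ) (B : Matrix (Fin n) (Fin m) ℝ) :
    Prop :=
  ∃ F : Matrix (Fin m) (Fin n) ℝ, IsSchurStable (A + B * F)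

/-- `(A, C)` is detectable: some output injection makes `A + L C` stable. -/
def IsDetectable {n m : ℕ} (A : Matrix (Fin n) (Fin n) ℝ) (C : Matrix (Fin m) (Fin n) ℝ) :
    Prop :=
  ∃ L : Matrix (Fin n) (Fin m) ℝ, IsSchurStable (A + L * C)

/-- `(A, C)` is observable: the observability matrix `[C; CA; …; CAⁿ⁻¹]` has trivial kernel. -/
def IsObservable {n m : ℕ} (A : Matrix (Fin n) (Fin n) ℝ) (C : Matrix (Fin m) (Fin n) ℝ) :
    Prop :=
  ∀ x : Fin n → ℝ, (∀ k < n, (C * A ^ k) *ᵥ x = 0) → x = 0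

/-! ### Distances between distributions -/

/-- Mean vector of a distribution. -/
def meanVec {n : ℕ} (P : Measure (Vec n)) : Vec n := ∫ w, w ∂P

/-- Covariance matrix of a distribution. -/
def covMat {n : ℕ} (P : Measure (Vec n)) : Matrix (Fin n) (Fin n) ℝ :=
  Matrix.of fun i j => ∫ w, (w i - meanVec P i) * (w j - meanVec P j) ∂P

/-- The 2-Wasserstein distance for the Euclidean norm: infimum over all transport plans. -/
def wasserstein2 {n : ℕ} (P Q : Measure (Vec n)) : ℝ≥0∞ :=
  ⨅ τ ∈ {τ : Measure (Vec n × Vec n) | τ.map Prod.fst = P ∧ τ.map Prod.snd = Q},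
    (∫⁻ z, ‖z.1 - z.2‖ₑ ^ 2 ∂τ) ^ (1 / 2 : ℝ)

/-- `B²(Σ, Σ̂) = Tr[Σ + Σ̂ - 2 (Σ̂^{1/2} Σ Σ̂^{1/2})^{1/2}]`. -/
def buresSq {n : ℕ} (S Shat : Matrix (Fin n) (Fin n) ℝ) : ℝ :=
  (S + Shat - (2 : ℝ) • CFC.sqrt (CFC.sqrt Shat * S * CFC.sqrt Shat)).trace

open Classical in
/-- The squared Gelbrich distance `G(P, Q)²`; it is infinite if one of the distributions has no
finite second moment. -/
def gelbrichSq {n : ℕ} (P Q : Measure (Vec n)) : ℝ≥0∞ :=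
  if MemLp id 2 P ∧ MemLp id 2 Q then
    ENNReal.ofReal (‖meanVec P - meanVec Q‖ ^ 2 + buresSq (covMat P) (covMat Q))
  else ⊤

/-! ### Information vectors, policies and the controlled process -/

/-- The information vector `I_t = (y_0, …, y_t, u_0, …, u_{t-1})`. -/
abbrev Info (ny nu t : ℕ) : Type := (Fin (t + 1) → Vec ny) × (Fin t → Vec nu)

/-- The update `I_{t+1} = (I_t, y_{t+1}, u_t)`. -/
def Info.extend {ny nu t : ℕ} (I : Info ny nu t) (y : Vec ny) (u : Vec nu) :
    Info ny nu (t + 1) :=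
  (Fin.snoc (α := fun _ => Vec ny) I.1 y, Fin.snoc (α := fun _ => Vec nu) I.2 u)

theorem measurable_snoc_vec {k n : ℕ} :
    Measurable fun p : (Fin k → Vec n) × Vec n => Fin.snoc (α := fun _ => Vec n) p.1 p.2 := by
  refine measurable_pi_iff.2 fun i => ?_
  refine Fin.lastCases ?_ (fun j => ?_) i
  · simpa using measurable_snd
  · simp only [Fin.snoc_castSucc]
    exact (measurable_pi_apply j).comp measurable_fst

theorem measurable_act {m n : ℕ} (A : Matrix (Fin m) (Fin n) ℝ) : Measurable (act A) :=
  (act A).continuous_of_finiteDimensional.measurable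

theorem measurable_extend {ny nu t : ℕ} :
    Measurable fun p : Info ny nu t × Vec ny × Vec nu => p.1.extend p.2.1 p.2.2 := by
  refine Measurable.prodMk ?_ ?_
  · exact measurable_snoc_vec.comp
      ((measurable_fst.comp measurable_fst).prodMk (measurable_fst.comp measurable_snd))
  · exact measurable_snoc_vec.comp
      ((measurable_snd.comp measurable_fst).prodMk (measurable_snd.comp measurable_snd))

/-- A control law at time `t`: a measurable map `I_t ↦ u_t`. -/
abbrev CtrlAt (ny nu t : ℕ) : Type := {f : Info ny nu t → Vec nu // Measurable f}

/-- A distribution law at time `t`: a measurable map `I_t ↦ P_t` into the probability measures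
on the disturbance space. -/
abbrev DistAt (nx ny nu t : ℕ) : Type :=
  {κ : Kernel (Info ny nu t) (Vec nx) // IsMarkovKernel κ}

/-- The admissible control policies. -/
abbrev CtrlPolicy (ny nu : ℕ) : Type := (t : ℕ) → CtrlAt ny nu t

/-- The admissible distribution policies (no ambiguity constraint yet). -/
abbrev DistPolicy (nx ny nu : ℕ) : Type := (t : ℕ) → DistAt nx ny nu t

/-- The data of the control problem
`x_{t+1} = A x_t + B u_t + w_t`, `y_t = C x_t + v_t`, `v_t ∼ N(0, M)`, with cost weights `Q`, `R`,
law `initLaw` of `x_0`, nominal disturbance distributions `nominal t`, and the stationary nominal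
mean `wHat` and covariance `SigHat`. -/
structure LQSystem (nx nu ny : ℕ) where
  A : Matrix (Fin nx) (Fin nx) ℝ
  B : Matrix (Fin nx) (Fin nu) ℝ
  C : Matrix (Fin ny) (Fin nx) ℝ
  M : Matrix (Fin ny) (Fin ny) ℝ
  Q : Matrix (Fin nx) (Fin nx) ℝ
  R : Matrix (Fin nu) (Fin nu) ℝ
  initLaw : ProbabilityMeasure (Vec nx)
  nominal : ℕ → ProbabilityMeasure (Vec nx)
  wHat : Vec nx
  SigHat : Matrix (Fin nx) (Fin nx) ℝ

namespace LQSystem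

variable {nx nu ny : ℕ} (S : LQSystem nx nu ny)

/-- The law `N(0, M)` of the output noise. -/
def noise : Measure (Vec ny) := multivariateGaussian 0 S.M

instance : IsProbabilityMeasure S.noise := by
  unfold noise; infer_instance

/-- `(x_0, v_0) ↦ (I_0, x_0)` with `I_0 = y_0 = C x_0 + v_0`. -/
def initMap (p : Vec nx × Vec ny) : Info ny nu 0 × Vec nx :=
  ((fun _ => act S.C p.1 + p.2, Fin.elim0), p.1)

theorem measurable_initMap : Measurable S.initMap := by
  refine Measurable.prodMk (Measurable.prodMk ?_ measurable_const) measurable_fst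
  exact measurable_pi_iff.2 fun _ =>
    ((measurable_act S.C).comp measurable_fst).add measurable_snd

/-- `((I_t, x_t), w_t, v_{t+1}) ↦ (I_{t+1}, x_{t+1})` under the control `u_t = f I_t`. -/
def stepMap {t : ℕ} (f : CtrlAt ny nu t) (p : ((Info ny nu t × Vec nx) × Vec nx) × Vec ny) :
    Info ny nu (t + 1) × Vec nx :=
  let I := p.1.1.1
  let x := p.1.1.2
  let w := p.1.2
  let v := p.2
  let u := f.1 I
  let x' := act S.A x + act S.B u + w
  (I.extend (act S.C x' + v) u, x')

theorem measurable_stepMap {t : ℕ} (f : CtrlAt ny nu t) : Measurable (S.stepMap f) := by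
  have hI : Measurable fun p : ((Info ny nu t × Vec nx) × Vec nx) × Vec ny => p.1.1.1 := by
    fun_prop
  have hx : Measurable fun p : ((Info ny nu t × Vec nx) × Vec nx) × Vec ny => p.1.1.2 := by
    fun_prop
  have hw : Measurable fun p : ((Info ny nu t × Vec nx) × Vec nx) × Vec ny => p.1.2 := by
    fun_prop
  have hu := f.2.comp hI
  have hx' := (((measurable_act S.A).comp hx).add ((measurable_act S.B).comp hu)).add hw
  exact (measurable_extend.comp
    (hI.prodMk ((((measurable_act S.C).comp hx').add measurable_snd).prodMk hu))).prodMk hx'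

/-- The joint law of `(I_0, x_0)`. -/
def law0 : ProbabilityMeasure (Info ny nu 0 × Vec nx) :=
  ⟨((S.initLaw : Measure (Vec nx)).prod S.noise).map S.initMap,
    Measure.isProbabilityMeasure_map S.measurable_initMap.aemeasurable⟩

/-- One transition of the joint law of `(I_t, x_t)`: given `(I_t, x_t)`, the disturbance `w_t` is
drawn from `κ I_t` (hence conditionally independent of `x_t` given `I_t`), the noise `v_{t+1}` is
drawn from `N(0, M)` independently of everything else, and `u_t = f I_t`. -/
def stepLaw {t : ℕ} (f : CtrlAt ny nu t) (κ : DistAt nx ny nu t)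
    (μ : ProbabilityMeasure (Info ny nu t × Vec nx)) :
    ProbabilityMeasure (Info ny nu (t + 1) × Vec nx) :=
  haveI := κ.2
  ⟨((((μ : Measure (Info ny nu t × Vec nx)) ⊗ₘ
      (Kernel.prodMkRight (Vec nx) κ.1)).prod S.noise).map (S.stepMap f)),
    Measure.isProbabilityMeasure_map (S.measurable_stepMap f).aemeasurable⟩

/-- The joint law of `(I_t, x_t)` under the policy pair `(π, γ)`. -/
def law (π : CtrlPolicy ny nu) (γ : DistPolicy nx ny nu) :
    (t : ℕ) → ProbabilityMeasure (Info ny nu t × Vec nx)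
  | 0 => S.law0
  | t + 1 => S.stepLaw (π t) (γ t) (law π γ t)

/-- The law of the information vector `I_t` (equivalently, of the measurements) when `(I_t, x_t)`
has joint law `μ`. -/
def infoLaw {t : ℕ} (μ : ProbabilityMeasure (Info ny nu t × Vec nx)) :
    Measure (Info ny nu t) :=
  (μ : Measure (Info ny nu t × Vec nx)).fst

/-- The regular conditional distribution of `x_t` given `I_t`. -/
def posterior {t : ℕ} (μ : ProbabilityMeasure (Info ny nu t × Vec nx)) :
    Kernel (Info ny nu t) (Vec nx) :=
  (μ : Measure (Info ny nu t × Vec nx)).condKernel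

/-- The conditional expectation `x̄_t = E[x_t ∣ I_t]` as a function of `I_t`. -/
def condMean {t : ℕ} (μ : ProbabilityMeasure (Info ny nu t × Vec nx)) (I : Info ny nu t) :
    Vec nx :=
  ∫ x, x ∂(posterior μ I)

theorem measurable_condMean {t : ℕ} (μ : ProbabilityMeasure (Info ny nu t × Vec nx)) :
    Measurable (condMean μ) := by
  unfold condMean posterior
  exact (StronglyMeasurable.integral_kernel (measurable_id.stronglyMeasurable)).measurable

/-! ### Cost functionals -/

/-- `E_y[ E[x_tᵀ Q x_t + u_tᵀ R u_t ∣ I_t, u_t] ]`. -/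
def stageCost (π : CtrlPolicy ny nu) (γ : DistPolicy nx ny nu) (t : ℕ) : ℝ≥0∞ :=
  ∫⁻ I, ∫⁻ x, ENNReal.ofReal (quad S.Q x + quad S.R ((π t).1 I))
    ∂(posterior (S.law π γ t) I) ∂(infoLaw (S.law π γ t))

/-- `E_y[ G(P_t, Q_t)² ]` with `P_t = γ_t(I_t)`. -/
def stageGelbrich (π : CtrlPolicy ny nu) (γ : DistPolicy nx ny nu) (t : ℕ) : ℝ≥0∞ :=
  ∫⁻ I, gelbrichSq ((γ t).1 I) (S.nominal t) ∂(infoLaw (S.law π γ t))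

/-- The average cost `J_∞(π, γ)`. -/
def avgCost (π : CtrlPolicy ny nu) (γ : DistPolicy nx ny nu) : EReal :=
  limsup (fun T : ℕ => (∑ t ∈ Finset.range T, (S.stageCost π γ t : EReal)) / (T : EReal)) atTop

/-- The penalized average cost `J_∞^λ(π, γ)`. -/
def penAvgCost (lam : ℝ) (π : CtrlPolicy ny nu) (γ : DistPolicy nx ny nu) : EReal :=
  limsup (fun T : ℕ =>
    (∑ t ∈ Finset.range T,
      ((S.stageCost π γ t : EReal) - (lam : EReal) * (S.stageGelbrich π γ t : EReal))) /
        (T : EReal)) atTop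

/-! ### The stationary controller and the stationary worst-case distribution policy -/

/-- `Φ = B R⁻¹ Bᵀ - λ⁻¹ I`. -/
def Phi (lam : ℝ) : Matrix (Fin nx) (Fin nx) ℝ := S.B * S.R⁻¹ * S.Bᵀ - lam⁻¹ • 1

/-- `P` is a symmetric positive semidefinite solution of the algebraic Riccati equation
`P = Q + Aᵀ (I + P Φ)⁻¹ P A`. -/
def IsARESolution (lam : ℝ) (P : Matrix (Fin nx) (Fin nx) ℝ) : Prop :=
  P.PosSemidef ∧ P = S.Q + S.Aᵀ * (1 + P * S.Phi lam)⁻¹ * P * S.A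

/-- `S_ss = Q + Aᵀ P A - P`. -/
def Sss (P : Matrix (Fin nx) (Fin nx) ℝ) : Matrix (Fin nx) (Fin nx) ℝ :=
  S.Q + S.Aᵀ * P * S.A - P

/-- `r_ss = [I - Aᵀ (I + P Φ)⁻¹]⁻¹ Aᵀ (I + P Φ)⁻¹ P ŵ`. -/
def rss (lam : ℝ) (P : Matrix (Fin nx) (Fin nx) ℝ) : Vec nx :=
  act ((1 - S.Aᵀ * (1 + P * S.Phi lam)⁻¹)⁻¹ * S.Aᵀ * (1 + P * S.Phi lam)⁻¹ * P) S.wHat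

/-- `K_ss = -R⁻¹ Bᵀ (I + P Φ)⁻¹ P A`. -/
def Kss (lam : ℝ) (P : Matrix (Fin nx) (Fin nx) ℝ) : Matrix (Fin nu) (Fin nx) ℝ :=
  -(S.R⁻¹ * S.Bᵀ * (1 + P * S.Phi lam)⁻¹ * P * S.A)

/-- `L_ss = -R⁻¹ Bᵀ (I + P Φ)⁻¹ (P ŵ + r_ss)`. -/
def Lss (lam : ℝ) (P : Matrix (Fin nx) (Fin nx) ℝ) : Vec nu :=
  -(act (S.R⁻¹ * S.Bᵀ * (1 + P * S.Phi lam)⁻¹) (act P S.wHat + S.rss lam P))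

/-- `H_ss = (λ I - P)⁻¹ P (A + B K_ss)`. -/
def Hss (lam : ℝ) (P : Matrix (Fin nx) (Fin nx) ℝ) : Matrix (Fin nx) (Fin nx) ℝ :=
  (lam • 1 - P)⁻¹ * P * (S.A + S.B * S.Kss lam P)

/-- `G_ss = (λ I - P)⁻¹ (P B L_ss + r_ss + λ ŵ)`. -/
def Gss (lam : ℝ) (P : Matrix (Fin nx) (Fin nx) ℝ) : Vec nx :=
  act ((lam • 1 - P)⁻¹) (act (P * S.B) (S.Lss lam P) + S.rss lam P + lam • S.wHat)

/-- Feasibility in the stationary covariance problem: positive semidefinite `X, X⁻, Σ` with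
`X⁻ = A X Aᵀ + Σ` and `X = X⁻ - X⁻ Cᵀ (C X⁻ Cᵀ + M)⁻¹ C X⁻`. -/
structure IsCovFeasible (X Xm Sig : Matrix (Fin nx) (Fin nx) ℝ) : Prop where
  posX : X.PosSemidef
  posXm : Xm.PosSemidef
  posSig : Sig.PosSemidef
  pred : Xm = S.A * X * S.Aᵀ + Sig
  upd : X = Xm - Xm * S.Cᵀ * (S.C * Xm * S.Cᵀ + S.M)⁻¹ * S.C * Xm

/-- The objective `Tr[S_ss X + (P - λ I) Σ + 2 λ (Σ̂^{1/2} Σ Σ̂^{1/2})^{1/2}]`. -/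
def covObjective (lam : ℝ) (P X Sig : Matrix (Fin nx) (Fin nx) ℝ) : ℝ :=
  (S.Sss P * X + (P - lam • 1) * Sig +
    (2 * lam) • CFC.sqrt (CFC.sqrt S.SigHat * Sig * CFC.sqrt S.SigHat)).trace

/-- `(X, X⁻, Σ)` is an optimal solution of the stationary covariance problem. -/
def IsCovOptimal (lam : ℝ) (P X Xm Sig : Matrix (Fin nx) (Fin nx) ℝ) : Prop :=
  S.IsCovFeasible X Xm Sig ∧
    ∀ X' Xm' Sig' : Matrix (Fin nx) (Fin nx) ℝ, S.IsCovFeasible X' Xm' Sig' →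
      S.covObjective lam P X' Sig' ≤ S.covObjective lam P X Sig

/-- The stationary control law `u_t = K_ss x̄_t + L_ss`, where `x̄_t = E[x_t ∣ I_t]` is computed
from the joint law `μ` of `(I_t, x_t)`. -/
def ssCtrlAt (lam : ℝ) (P : Matrix (Fin nx) (Fin nx) ℝ) {t : ℕ}
    (μ : ProbabilityMeasure (Info ny nu t × Vec nx)) : CtrlAt ny nu t :=
  ⟨fun I => act (S.Kss lam P) (condMean μ I) + S.Lss lam P,
    ((measurable_act _).comp (measurable_condMean μ)).add_const _⟩

/-- The stationary distribution law `I_t ↦ N(H_ss x̄_t + G_ss, Σ)`, i.e. the law of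
`H_ss x̄_t + G_ss + ε` with `ε ∼ N(0, Σ)`. -/
def ssDistAt (lam : ℝ) (P Sig : Matrix (Fin nx) (Fin nx) ℝ) {t : ℕ}
    (μ : ProbabilityMeasure (Info ny nu t × Vec nx)) : DistAt nx ny nu t :=
  ⟨((Kernel.deterministic (fun I => act (S.Hss lam P) (condMean μ I) + S.Gss lam P)
      (((measurable_act _).comp (measurable_condMean μ)).add_const _)) ×ₖ
      (Kernel.const (Info ny nu t) (multivariateGaussian (0 : Vec nx) Sig))).map
        (fun p : Vec nx × Vec nx => p.1 + p.2),
    Kernel.IsMarkovKernel.map _ (measurable_fst.add measurable_snd)⟩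

/-- The joint law of `(I_t, x_t)` when the controller uses `u_t = K_ss x̄_t + L_ss` against the
distribution policy `γ`. -/
def ssLaw (lam : ℝ) (P : Matrix (Fin nx) (Fin nx) ℝ) (γ : DistPolicy nx ny nu) :
    (t : ℕ) → ProbabilityMeasure (Info ny nu t × Vec nx)
  | 0 => S.law0
  | t + 1 => S.stepLaw (S.ssCtrlAt lam P (ssLaw lam P γ t)) (γ t) (ssLaw lam P γ t)

/-- The stationary control policy `π_ss`, i.e. `I_t ↦ K_ss x̄_t + L_ss` with
`x̄_t = E[x_t ∣ I_t]` the conditional mean in the closed loop with `γ`. -/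
def ssPolicy (lam : ℝ) (P : Matrix (Fin nx) (Fin nx) ℝ) (γ : DistPolicy nx ny nu) :
    CtrlPolicy ny nu :=
  fun t => S.ssCtrlAt lam P (S.ssLaw lam P γ t)

theorem law_ssPolicy (lam : ℝ) (P : Matrix (Fin nx) (Fin nx) ℝ) (γ : DistPolicy nx ny nu)
    (t : ℕ) : S.law (S.ssPolicy lam P γ) γ t = S.ssLaw lam P γ t := by
  induction t with
  | zero => rfl
  | succ t ih => simp only [law, ssLaw, ih, ssPolicy]

/-- `π_ss(I_t) = K_ss x̄_t + L_ss` with `x̄_t` the conditional mean of the closed loop. -/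
theorem ssPolicy_apply (lam : ℝ) (P : Matrix (Fin nx) (Fin nx) ℝ) (γ : DistPolicy nx ny nu)
    (t : ℕ) (I : Info ny nu t) :
    (S.ssPolicy lam P γ t).1 I =
      act (S.Kss lam P) (condMean (S.law (S.ssPolicy lam P γ) γ t) I) + S.Lss lam P := by
  rw [law_ssPolicy]; rfl

/-- The joint law of `(I_t, x_t)` when both players use their stationary policies. -/
def ssPairLaw (lam : ℝ) (P Sig : Matrix (Fin nx) (Fin nx) ℝ) :
    (t : ℕ) → ProbabilityMeasure (Info ny nu t × Vec nx)
  | 0 => S.law0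
  | t + 1 => S.stepLaw (S.ssCtrlAt lam P (ssPairLaw lam P Sig t))
      (S.ssDistAt lam P Sig (ssPairLaw lam P Sig t)) (ssPairLaw lam P Sig t)

/-- The stationary distribution policy `γ_ss`, i.e. `I_t ↦ N(H_ss x̄_t + G_ss, Σ)`. -/
def ssDist (lam : ℝ) (P Sig : Matrix (Fin nx) (Fin nx) ℝ) : DistPolicy nx ny nu :=
  fun t => S.ssDistAt lam P Sig (S.ssPairLaw lam P Sig t)

theorem law_ssPair (lam : ℝ) (P Sig : Matrix (Fin nx) (Fin nx) ℝ) (t : ℕ) :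
    S.law (S.ssPolicy lam P (S.ssDist lam P Sig)) (S.ssDist lam P Sig) t =
      S.ssPairLaw lam P Sig t := by
  rw [law_ssPolicy]
  induction t with
  | zero => rfl
  | succ t ih => simp only [ssLaw, ssPairLaw, ih, ssDist]

/-- `γ_ss(I_t) = N(H_ss x̄_t + G_ss, Σ)` with `x̄_t` the conditional mean in the closed loop
with `π_ss`. -/
theorem ssDist_apply (lam : ℝ) (P Sig : Matrix (Fin nx) (Fin nx) ℝ) (t : ℕ)
    (I : Info ny nu t) :
    (S.ssDist lam P Sig t).1 I =
      (multivariateGaussian (0 : Vec nx) Sig).map (fun e =>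
        act (S.Hss lam P) (condMean (S.law (S.ssPolicy lam P (S.ssDist lam P Sig))
          (S.ssDist lam P Sig) t) I) + S.Gss lam P + e) := by
  rw [law_ssPair]
  have hm : Measurable fun p : Vec nx × Vec nx => p.1 + p.2 := measurable_fst.add measurable_snd
  change Kernel.map _ _ I = _
  rw [Kernel.map_apply _ hm, Kernel.prod_apply, Kernel.deterministic_apply, Kernel.const_apply,
    Measure.dirac_prod, Measure.map_map hm (by fun_prop)]
  rfl

/-- The steady-state average cost `ρ(λ) = J_∞^λ(π_ss, γ_ss)`. -/
def rho (lam : ℝ) (P Sig : Matrix (Fin nx) (Fin nx) ℝ) : EReal :=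
  S.penAvgCost lam (S.ssPolicy lam P (S.ssDist lam P Sig)) (S.ssDist lam P Sig)

/-- The bias `h(I_t) = x̄_tᵀ P x̄_t + 2 r_ssᵀ x̄_t + Tr[(S_ss + P) X̄_ss]`. -/
def bias (lam : ℝ) (P X : Matrix (Fin nx) (Fin nx) ℝ) {t : ℕ}
    (μ : ProbabilityMeasure (Info ny nu t × Vec nx)) (I : Info ny nu t) : ℝ :=
  quad P (condMean μ I) + 2 * inner ℝ (S.rss lam P) (condMean μ I) +
    ((S.Sss P + P) * X).trace

/-- `limsup_T (1/T) E_y[h(I_T) ∣ π_ss, γ] = 0`. -/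
def BiasVanishes (lam : ℝ) (P X : Matrix (Fin nx) (Fin nx) ℝ) (γ : DistPolicy nx ny nu) :
    Prop :=
  limsup (fun T : ℕ =>
    (((∫ I, S.bias lam P X (S.law (S.ssPolicy lam P γ) γ T) I
      ∂(infoLaw (S.law (S.ssPolicy lam P γ) γ T))) / T : ℝ) : EReal)) atTop = 0

/-- The distribution policies with `γ_t(I_t)` in the Wasserstein ball of radius `θ` centered at
the nominal distribution, for all `t` and `I_t`. -/
def ambiguityPolicies (θ : ℝ) : Set (DistPolicy nx ny nu) :=
  {γ | ∀ t I, wasserstein2 ((γ t).1 I) (S.nominal t) ≤ ENNReal.ofReal θ}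

end LQSystem

end WDRC

end

/-! Both sides are compared with one explicit number, `ssValue`. Against every policy in the
Wasserstein ball the stationary controller pays at most `θ² λ + ssValue` (`avgCost_ssPolicy_le`),
and the stationary pair has penalized cost at least `ssValue` (`ssValue_le_rho`).

The link is a Bellman identity in expectation (`bellman_identity`), valid for every
square-integrable disturbance policy played against the stationary controller. Let V_t = E[xᵀPx +
2rᵀx], let X_t and D_t be the expected conditional covariances of x_t and w_t given I_t, and let w̄
be the conditional mean of w_t. Completing squares in the game for the conditional means
(`saddle_identity`) shows that stage cost + V_{t+1} - V_t - λ E‖w̄ - ŵ‖² equals a constant, minus a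
nonnegative quadratic in the deviation of w̄ from the worst-case mean, plus Tr[S X_t] + Tr[P D_t].
The rest of the argument is about the pair of matrix sequences X_t, D_t.

Upper bound. The conditional mean is at least as good as any linear correction of the prediction, so
X_{t+1} is at most the Kalman update of A X_t Aᵀ + D_t, without any Gaussianity
(`errCov_stepLaw_le`). The ball constraint enters through dual certificates indexed by a positive
definite Z and linear in D_t (`integral_ball_bound`), so it survives averaging over time.
Detectability bounds X_t, and time averages have limit points (X, D). Since the Kalman update is a
minimum of affine maps, X is a subsolution of the stationary Riccati equation with forcing D; it
lies below a genuine solution, to which the optimality of Σ* applies. A Z that is nearly optimal for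
D turns the certificate back into the trace of the matrix square root (`exists_posDef_fidelity_le`).
The telescoped V is bounded below because P is positive definite. All this is
`eventually_average_le`.

Lower bound. Against the stationary disturbance policy the deviation term vanishes and D_t = Σ*. As
x_0 need not be Gaussian, X_t need not be a Riccati iterate. But x_t contains an independent
Gaussian component, invisible to I_t, whose covariance is the Riccati iterate started at 0
(`HasGaussianPart.stepLaw`), and this bounds X_t from below (`HasGaussianPart.le_errCov`). The
iterates tend to the optimal covariance by stabilizability (`tendsto_riccati_zero`), S is positive
semidefinite, and V_t is bounded above because the closed loop is stable. -/

namespace WDRC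

/-! ### Positive semidefinite real matrices, traces and quadratic forms. -/

section PosSemidef

theorem _root_.Matrix.PosSemidef.transpose_eq {n : Type*} {X : Matrix n n ℝ}
    (hX : X.PosSemidef) : Xᵀ = X := by
  simpa [conjTranspose_eq_transpose_of_trivial] using hX.1.eq

variable {m n : Type*} [Fintype m] [Fintype n]

theorem _root_.Matrix.PosSemidef.conj {X : Matrix n n ℝ} (hX : X.PosSemidef) (A : Matrix m n ℝ) :
    (A * X * Aᵀ).PosSemidef := by
  simpa [conjTranspose_eq_transpose_of_trivial] using hX.mul_mul_conjTranspose_same A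

theorem _root_.Matrix.PosSemidef.conj' {X : Matrix n n ℝ} (hX : X.PosSemidef) (A : Matrix n m ℝ) :
    (Aᵀ * X * A).PosSemidef := by
  simpa [conjTranspose_eq_transpose_of_trivial] using hX.conjTranspose_mul_mul_same A

theorem conj_le_conj {X Y : Matrix n n ℝ} (h : X ≤ Y) (A : Matrix m n ℝ) :
    A * X * Aᵀ ≤ A * Y * Aᵀ := by
  rw [Matrix.le_iff] at h ⊢
  simpa [Matrix.mul_sub, Matrix.sub_mul] using PosSemidef.conj h A

theorem posSemidef_transpose_mul_self (Y : Matrix m n ℝ) : (Yᵀ * Y).PosSemidef := by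
  simpa [conjTranspose_eq_transpose_of_trivial] using posSemidef_conjTranspose_mul_self Y

theorem trace_transpose_mul_self_nonneg (Y : Matrix m n ℝ) : 0 ≤ (Yᵀ * Y).trace :=
  (posSemidef_transpose_mul_self Y).trace_nonneg

theorem _root_.Matrix.PosSemidef.sqrt_mul_self [DecidableEq n] {X : Matrix n n ℝ} (hX : X.PosSemidef) :
    CFC.sqrt X * CFC.sqrt X = X :=
  CFC.sqrt_mul_sqrt_self X hX.nonneg

theorem posSemidef_sqrt [DecidableEq n] (X : Matrix n n ℝ) : (CFC.sqrt X).PosSemidef :=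
  nonneg_iff_posSemidef.1 (CFC.sqrt_nonneg X)

theorem sqrt_transpose [DecidableEq n] (X : Matrix n n ℝ) : (CFC.sqrt X)ᵀ = CFC.sqrt X :=
  PosSemidef.transpose_eq (posSemidef_sqrt X)

/-- Cyclicity of the trace moves one factor `CFC.sqrt X` to the other side of `Y`, leaving the trace
of a congruence. -/
theorem _root_.Matrix.PosSemidef.trace_mul_nonneg {X Y : Matrix n n ℝ} (hX : X.PosSemidef)
    (hY : Y.PosSemidef) : 0 ≤ (X * Y).trace := by
  classical
  have h : (X * Y).trace = (CFC.sqrt X * Y * (CFC.sqrt X)ᵀ).trace := by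
    rw [sqrt_transpose, Matrix.mul_assoc, Matrix.trace_mul_comm (CFC.sqrt X), Matrix.mul_assoc,
      hX.sqrt_mul_self, Matrix.trace_mul_comm]
  rw [h]
  exact (PosSemidef.conj hY _).trace_nonneg

theorem _root_.Matrix.PosSemidef.trace_mul_le {S X Y : Matrix n n ℝ} (hS : S.PosSemidef) (h : X ≤ Y) :
    (S * X).trace ≤ (S * Y).trace := by
  have := PosSemidef.trace_mul_nonneg hS (Matrix.le_iff.1 h)
  rw [Matrix.mul_sub, trace_sub] at this
  linarith

/-- Quadratic forms of a positive semidefinite matrix detect its kernel. -/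
theorem _root_.Matrix.PosSemidef.mulVec_eq_zero {X : Matrix n n ℝ} (hX : X.PosSemidef) {x : n → ℝ}
    (h : x ⬝ᵥ X *ᵥ x = 0) : X *ᵥ x = 0 :=
  (hX.dotProduct_mulVec_zero_iff x).1 (by simpa using h)

theorem _root_.Matrix.PosSemidef.dotProduct_nonneg {X : Matrix n n ℝ} (hX : X.PosSemidef) (x : n → ℝ) :
    0 ≤ x ⬝ᵥ X *ᵥ x := by
  simpa using hX.dotProduct_mulVec_nonneg x

theorem _root_.Matrix.PosSemidef.dotProduct_mulVec_comm {X : Matrix n n ℝ} (hX : X.PosSemidef) (x y : n → ℝ) :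
    x ⬝ᵥ X *ᵥ y = y ⬝ᵥ X *ᵥ x := by
  rw [dotProduct_mulVec, ← mulVec_transpose, hX.transpose_eq, _root_.dotProduct_comm]

theorem le_of_dotProduct_le {X Y : Matrix n n ℝ} (hX : Xᵀ = X) (hY : Yᵀ = Y)
    (h : ∀ x, x ⬝ᵥ X *ᵥ x ≤ x ⬝ᵥ Y *ᵥ x) : X ≤ Y := by
  refine Matrix.le_iff.2 (PosSemidef.of_dotProduct_mulVec_nonneg ?_ fun x => ?_)
  · simp [IsHermitian, conjTranspose_eq_transpose_of_trivial, hX, hY]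
  · have := h x
    simp only [star_trivial, sub_mulVec, dotProduct_sub]
    linarith

theorem dotProduct_le_of_le {X Y : Matrix n n ℝ} (h : X ≤ Y) (x : n → ℝ) :
    x ⬝ᵥ X *ᵥ x ≤ x ⬝ᵥ Y *ᵥ x := by
  have := PosSemidef.dotProduct_nonneg (Matrix.le_iff.1 h) x
  simp only [sub_mulVec, dotProduct_sub] at this
  linarith

end PosSemidef

/-! ### The Kalman measurement update as a minimum over gains. -/

section Filtering

variable {m n k : Type*} [Fintype m] [Fintype n] [DecidableEq m]

/-- The measurement update `X ↦ X - X Cᵀ (C X Cᵀ + M)⁻¹ C X` of the Kalman filter. -/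
noncomputable def measUpd (C : Matrix m n ℝ) (M : Matrix m m ℝ) (X : Matrix n n ℝ) :
    Matrix n n ℝ :=
  X - X * Cᵀ * (C * X * Cᵀ + M)⁻¹ * C * X

omit [DecidableEq m] in
theorem posDef_innovation {C : Matrix m n ℝ} {M : Matrix m m ℝ} {X : Matrix n n ℝ}
    (hM : M.PosDef) (hX : X.PosSemidef) : (C * X * Cᵀ + M).PosDef :=
  PosDef.posSemidef_add (hX.conj C) hM

/-- Completion of squares for the error covariance of a linear estimator. -/
theorem measUpd_completion {C : Matrix m n ℝ} {M : Matrix m m ℝ} {X : Matrix n n ℝ}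
    (hM : M.PosDef) (hX : X.PosSemidef) (A : Matrix k n ℝ) (L : Matrix k m ℝ) :
    (A + L * C) * X * (A + L * C)ᵀ + L * M * Lᵀ =
      A * measUpd C M X * Aᵀ + (L + A * X * Cᵀ * (C * X * Cᵀ + M)⁻¹) * (C * X * Cᵀ + M) *
        (L + A * X * Cᵀ * (C * X * Cᵀ + M)⁻¹)ᵀ := by
  have hN : (C * X * Cᵀ + M).PosDef := posDef_innovation hM hX
  have hNt := PosSemidef.transpose_eq hN.posSemidef
  have hXt := PosSemidef.transpose_eq hX
  have hM' : M = (C * X * Cᵀ + M) - C * X * Cᵀ := by abel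
  unfold measUpd
  generalize C * X * Cᵀ + M = N at *
  have hu : IsUnit N.det := (Matrix.isUnit_iff_isUnit_det N).1 hN.isUnit
  rw [hM']
  simp only [transpose_add, transpose_mul, transpose_nonsing_inv, hNt, hXt, transpose_transpose,
    Matrix.mul_add, Matrix.add_mul, Matrix.mul_sub, Matrix.sub_mul, Matrix.mul_assoc,
    Matrix.mul_nonsing_inv_cancel_left _ _ hu, Matrix.nonsing_inv_mul_cancel_left _ _ hu]
  abel

theorem measUpd_le [Fintype k] {C : Matrix m n ℝ} {M : Matrix m m ℝ} {X : Matrix n n ℝ}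
    (hM : M.PosDef) (hX : X.PosSemidef) (A : Matrix k n ℝ) (L : Matrix k m ℝ) :
    A * measUpd C M X * Aᵀ ≤ (A + L * C) * X * (A + L * C)ᵀ + L * M * Lᵀ := by
  rw [measUpd_completion hM hX, Matrix.le_iff, add_sub_cancel_left]
  exact (posDef_innovation hM hX).posSemidef.conj _

theorem exists_gain_measUpd {C : Matrix m n ℝ} {M : Matrix m m ℝ} {X : Matrix n n ℝ}
    (hM : M.PosDef) (hX : X.PosSemidef) (A : Matrix k n ℝ) :
    ∃ L : Matrix k m ℝ,
      (A + L * C) * X * (A + L * C)ᵀ + L * M * Lᵀ = A * measUpd C M X * Aᵀ := by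
  refine ⟨-(A * X * Cᵀ * (C * X * Cᵀ + M)⁻¹), ?_⟩
  rw [measUpd_completion hM hX]
  simp

/-- Together with `exists_gain_eq_measUpd` this exhibits the update as an attained minimum over
gains `K` of maps that are affine and monotone in `X`. Monotonicity, and later the passage to time
averages, come from this form. -/
theorem measUpd_le_gain [DecidableEq n] {C : Matrix m n ℝ} {M : Matrix m m ℝ}
    {X : Matrix n n ℝ} (hM : M.PosDef) (hX : X.PosSemidef) (K : Matrix n m ℝ) :
    measUpd C M X ≤ (1 - K * C) * X * (1 - K * C)ᵀ + K * M * Kᵀ := by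
  have := measUpd_le (C := C) hM hX 1 (-K)
  simpa [← sub_eq_add_neg] using this

theorem exists_gain_eq_measUpd [DecidableEq n] {C : Matrix m n ℝ} {M : Matrix m m ℝ}
    {X : Matrix n n ℝ} (hM : M.PosDef) (hX : X.PosSemidef) :
    ∃ K : Matrix n m ℝ,
      (1 - K * C) * X * (1 - K * C)ᵀ + K * M * Kᵀ = measUpd C M X := by
  obtain ⟨L, hL⟩ := exists_gain_measUpd (C := C) hM hX (1 : Matrix n n ℝ)
  refine ⟨-L, ?_⟩
  simpa using hL

theorem measUpd_posSemidef {C : Matrix m n ℝ} {M : Matrix m m ℝ} {X : Matrix n n ℝ}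
    (hM : M.PosDef) (hX : X.PosSemidef) : (measUpd C M X).PosSemidef := by
  classical
  obtain ⟨K, hK⟩ := exists_gain_eq_measUpd (C := C) hM hX
  rw [← hK]
  exact (hX.conj _).add (hM.posSemidef.conj _)

theorem measUpd_le_self {C : Matrix m n ℝ} {M : Matrix m m ℝ} {X : Matrix n n ℝ}
    (hM : M.PosDef) (hX : X.PosSemidef) : measUpd C M X ≤ X := by
  classical
  simpa using measUpd_le_gain (C := C) hM hX 0

/-- The gain that is optimal for `Y` is merely admissible for `X`; with this gain fixed both sides
are monotone congruences. -/
theorem measUpd_mono {C : Matrix m n ℝ} {M : Matrix m m ℝ} {X Y : Matrix n n ℝ}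
    (hM : M.PosDef) (hX : X.PosSemidef) (h : X ≤ Y) : measUpd C M X ≤ measUpd C M Y := by
  classical
  have hY : Y.PosSemidef := nonneg_iff_posSemidef.1 (hX.nonneg.trans h)
  obtain ⟨K, hK⟩ := exists_gain_eq_measUpd (C := C) hM hY
  rw [← hK]
  refine (measUpd_le_gain hM hX K).trans ?_
  gcongr
  exact conj_le_conj h _

/-- An upper bound valid for all linear estimators is an upper bound by the update. -/
theorem le_measUpd_of_forall_gain [DecidableEq n] {C : Matrix m n ℝ} {M : Matrix m m ℝ}
    {X Y : Matrix n n ℝ} (hM : M.PosDef) (hX : X.PosSemidef)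
    (h : ∀ K : Matrix n m ℝ, Y ≤ (1 - K * C) * X * (1 - K * C)ᵀ + K * M * Kᵀ) :
    Y ≤ measUpd C M X := by
  obtain ⟨K, hK⟩ := exists_gain_eq_measUpd (C := C) hM hX
  exact hK ▸ h K

theorem continuousAt_measUpd {C : Matrix m n ℝ} {M : Matrix m m ℝ} {X : Matrix n n ℝ}
    (hM : M.PosDef) (hX : X.PosSemidef) : ContinuousAt (measUpd C M) X := by
  have hu : IsUnit (C * X * Cᵀ + M) := (posDef_innovation hM hX).isUnit
  have hinv : ContinuousAt (fun X : Matrix n n ℝ => (C * X * Cᵀ + M)⁻¹) X := by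
    have h1 : ContinuousAt (fun X : Matrix n n ℝ => C * X * Cᵀ + M) X := by fun_prop
    have h2 : ContinuousAt (fun N : Matrix m m ℝ => N⁻¹) (C * X * Cᵀ + M) := by
      have hd : ContinuousAt (fun N : Matrix m m ℝ => Ring.inverse N.det) (C * X * Cᵀ + M) := by
        rw [Ring.inverse_eq_inv']
        exact ContinuousAt.inv₀ (continuous_id (X := Matrix m m ℝ)).matrix_det.continuousAt
          ((Matrix.isUnit_iff_isUnit_det _).1 hu).ne_zero
      have ha : ContinuousAt (fun N : Matrix m m ℝ => N.adjugate) (C * X * Cᵀ + M) :=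
        (continuous_id (X := Matrix m m ℝ)).matrix_adjugate.continuousAt
      simp only [Matrix.inv_def]
      exact hd.smul ha
    exact ContinuousAt.comp (f := fun X : Matrix n n ℝ => C * X * Cᵀ + M) h2 h1
  unfold measUpd
  fun_prop

end Filtering

/-! ### Schur stability: decay of powers and Lyapunov functions. -/

section Schur

variable {n : ℕ}

theorem mem_spectrum_matrix_iff (M : Matrix (Fin n) (Fin n) ℂ) (z : ℂ) :
    z ∈ spectrum ℂ M ↔ ∃ v : Fin n → ℂ, v ≠ 0 ∧ M *ᵥ v = z • v := by
  rw [spectrum.mem_iff, Matrix.isUnit_iff_isUnit_det, isUnit_iff_ne_zero, not_not,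
    ← Matrix.exists_mulVec_eq_zero_iff]
  refine exists_congr fun v => and_congr_right fun _ => ?_
  rw [sub_mulVec, sub_eq_zero, Algebra.algebraMap_eq_smul_one, smul_mulVec, one_mulVec, eq_comm]

theorem isSchurStable_iff (A : Matrix (Fin n) (Fin n) ℝ) :
    IsSchurStable A ↔ ∀ (z : ℂ) (v : Fin n → ℂ), v ≠ 0 →
      A.map (algebraMap ℝ ℂ) *ᵥ v = z • v → ‖z‖ < 1 := by
  simp only [IsSchurStable, mem_spectrum_matrix_iff, forall_exists_index, and_imp]

theorem isSchurStable_transpose_iff (A : Matrix (Fin n) (Fin n) ℝ) :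
    IsSchurStable Aᵀ ↔ IsSchurStable A := by
  have h : spectrum ℂ (Aᵀ.map (algebraMap ℝ ℂ)) = spectrum ℂ (A.map (algebraMap ℝ ℂ)) := by
    ext z
    rw [spectrum.mem_iff, spectrum.mem_iff, Matrix.isUnit_iff_isUnit_det,
      Matrix.isUnit_iff_isUnit_det, ← Matrix.det_transpose]
    simp [Algebra.algebraMap_eq_smul_one, transpose_sub, transpose_map]
  simp only [IsSchurStable, h]

section Pow

attribute [local instance] Matrix.linftyOpNormedRing Matrix.linftyOpNormedAlgebra

theorem norm_entry_le_linftyOpNorm (M : Matrix (Fin n) (Fin n) ℂ) (i j : Fin n) :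
    ‖M i j‖ ≤ ‖M‖ := by
  have h := Matrix.linfty_opNorm_mulVec M (Pi.single j 1)
  have h1 : ‖(Pi.single j (1 : ℂ) : Fin n → ℂ)‖ ≤ 1 := by
    refine (pi_norm_le_iff_of_nonneg zero_le_one).2 fun k => ?_
    rcases eq_or_ne k j with rfl | hk <;> simp [*]
  rw [mulVec_single_one] at h
  exact (norm_le_pi_norm (M.col j) i).trans (h.trans (mul_le_of_le_one_right (norm_nonneg _) h1))

/-- Gelfand's formula: for any `q` strictly between the spectral radius and 1, the norm of the
`k`-th power is eventually at most `q ^ k`. -/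
theorem tendsto_linftyOpNorm_pow_of_spectrum_lt (M : Matrix (Fin n) (Fin n) ℂ)
    (h : ∀ z ∈ spectrum ℂ M, ‖z‖ < 1) :
    Tendsto (fun k : ℕ => ‖M ^ k‖) atTop (nhds 0) := by
  rcases Nat.eq_zero_or_pos n with rfl | hn
  · have : ∀ k : ℕ, M ^ k = 0 := fun k => Subsingleton.elim _ _
    simp [this]
  have : Nonempty (Fin n) := ⟨⟨0, hn⟩⟩
  have hr : spectralRadius ℂ M < (1 : NNReal) :=
    spectrum.spectralRadius_lt_of_forall_lt M fun z hz => by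
      have := h z hz
      exact_mod_cast this
  obtain ⟨q, hq1, hq2⟩ := ENNReal.lt_iff_exists_nnreal_btwn.1 hr
  have hq2' : q < 1 := by exact_mod_cast hq2
  have hev := (spectrum.pow_nnnorm_pow_one_div_tendsto_nhds_spectralRadius M).eventually_lt_const hq1
  have hle : ∀ᶠ k : ℕ in atTop, ‖M ^ k‖ ≤ (q : ℝ) ^ k := by
    filter_upwards [hev, eventually_gt_atTop 0] with k hk hk0
    have hk0' : (0 : ℝ) < k := by exact_mod_cast hk0
    have h1 : (‖M ^ k‖₊ : ℝ≥0∞) ≤ (q : ℝ≥0∞) ^ (k : ℝ) := by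
      have := ENNReal.rpow_le_rpow hk.le hk0'.le
      rwa [← ENNReal.rpow_mul, one_div, inv_mul_cancel₀ hk0'.ne', ENNReal.rpow_one] at this
    rw [ENNReal.rpow_natCast] at h1
    exact_mod_cast h1
  exact squeeze_zero' (Eventually.of_forall fun _ => norm_nonneg _) hle
    (tendsto_pow_atTop_nhds_zero_of_lt_one q.2 (by exact_mod_cast hq2'))

theorem IsSchurStable.tendsto_pow_entry {A : Matrix (Fin n) (Fin n) ℝ} (hA : IsSchurStable A)
    (i j : Fin n) : Tendsto (fun k : ℕ => (A ^ k) i j) atTop (nhds 0) := by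
  refine squeeze_zero_norm (fun k => ?_) (tendsto_linftyOpNorm_pow_of_spectrum_lt _ hA)
  refine le_trans (le_of_eq ?_) (norm_entry_le_linftyOpNorm _ i j)
  have : (A.map (algebraMap ℝ ℂ)) ^ k = (A ^ k).map (algebraMap ℝ ℂ) :=
    (map_pow (algebraMap ℝ ℂ).mapMatrix A k).symm
  rw [this, map_apply, norm_algebraMap']

end Pow

theorem IsSchurStable.tendsto_pow {A : Matrix (Fin n) (Fin n) ℝ} (hA : IsSchurStable A) :
    Tendsto (fun k : ℕ => A ^ k) atTop (nhds 0) :=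
  tendsto_pi_nhds.2 fun i => tendsto_pi_nhds.2 fun j => hA.tendsto_pow_entry i j

/-- A symmetric matrix is bounded by the sum of its absolute entries. -/
theorem le_sum_abs_smul_one {W : Matrix (Fin n) (Fin n) ℝ} (hW : Wᵀ = W) :
    W ≤ (∑ i, ∑ j, |W i j|) • (1 : Matrix (Fin n) (Fin n) ℝ) := by
  refine le_of_dotProduct_le hW (by simp) fun x => ?_
  have hx : x ⬝ᵥ W *ᵥ x = ∑ i, ∑ j, W i j * (x i * x j) := by
    simp only [dotProduct, mulVec, Finset.mul_sum]
    exact Finset.sum_congr rfl fun i _ => Finset.sum_congr rfl fun j _ => by ring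
  have hb : ∀ i j, |x i * x j| ≤ x ⬝ᵥ x := fun i j => by
    have hi : ∀ i, x i * x i ≤ x ⬝ᵥ x := fun i =>
      Finset.single_le_sum (f := fun i => x i * x i) (fun k _ => mul_self_nonneg _)
        (Finset.mem_univ i)
    have := hi i
    have := hi j
    rw [abs_le]
    constructor <;> nlinarith [mul_self_nonneg (x i + x j), mul_self_nonneg (x i - x j)]
  rw [hx, smul_mulVec, one_mulVec, dotProduct_smul, smul_eq_mul, Finset.sum_mul]
  refine Finset.sum_le_sum fun i _ => ?_
  rw [Finset.sum_mul]
  refine Finset.sum_le_sum fun j _ => ?_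
  calc W i j * (x i * x j) ≤ |W i j * (x i * x j)| := le_abs_self _
    _ = |W i j| * |x i * x j| := abs_mul _ _
    _ ≤ |W i j| * (x ⬝ᵥ x) := by gcongr; exact hb i j

/-- A Schur stable matrix contracts a quadratic Lyapunov function. -/
theorem IsSchurStable.exists_lyapunov {A : Matrix (Fin n) (Fin n) ℝ} (hA : IsSchurStable A) :
    ∃ (W : Matrix (Fin n) (Fin n) ℝ) (c : ℝ), W.PosDef ∧ 1 ≤ W ∧ 0 < c ∧ c < 1 ∧
      Aᵀ * W * A ≤ c • W := by
  have hlim : Tendsto (fun k : ℕ => ∑ i, ∑ j, |((A ^ k)ᵀ * A ^ k) i j|) atTop (nhds 0) := by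
    have : Tendsto (fun k : ℕ => (A ^ k)ᵀ * A ^ k) atTop (nhds 0) := by
      have h := hA.tendsto_pow
      have hc : Continuous fun M : Matrix (Fin n) (Fin n) ℝ => Mᵀ * M := by fun_prop
      simpa only [Function.comp_def, transpose_zero, mul_zero] using (hc.tendsto 0).comp h
    have hc : Continuous fun M : Matrix (Fin n) (Fin n) ℝ => ∑ i, ∑ j, |M i j| := by fun_prop
    simpa only [Function.comp_def, Matrix.zero_apply, abs_zero, Finset.sum_const_zero] using
      (hc.tendsto 0).comp this
  obtain ⟨k, hk, hk0⟩ := ((hlim.eventually_lt_const (show (0 : ℝ) < 1 / 2 by norm_num)).and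
    (eventually_gt_atTop 0)).exists
  have hsm : (A ^ k)ᵀ * A ^ k ≤ (1 / 2 : ℝ) • (1 : Matrix (Fin n) (Fin n) ℝ) := by
    refine (le_sum_abs_smul_one (by simp)).trans ?_
    rw [Matrix.le_iff, ← sub_smul]
    exact PosSemidef.one.smul (by linarith)
  -- A truncated Lyapunov sum, cut where the power `k` satisfies (A^k)ᵀA^k ≤ 1/2. Telescoping gives
  -- AᵀWA = W - 1 + (A^k)ᵀA^k ≤ W - 1/2, and W ≤ (C + 1)·1 converts the loss of 1/2 into the factor
  -- 1 - 1/(2(C + 1)). Using C + 1 instead of C keeps the denominator positive.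
  let W : Matrix (Fin n) (Fin n) ℝ := ∑ j ∈ Finset.range k, (A ^ j)ᵀ * A ^ j
  have hW1 : (1 : Matrix (Fin n) (Fin n) ℝ) ≤ W := by
    have h := Finset.single_le_sum (f := fun j : ℕ => (A ^ j)ᵀ * A ^ j)
      (fun j _ => (posSemidef_transpose_mul_self (A ^ j)).nonneg) (Finset.mem_range.2 hk0)
    simpa [W] using h
  have hWpd : W.PosDef := by
    have := PosDef.one.add_posSemidef (Matrix.le_iff.1 hW1)
    rwa [add_sub_cancel] at this
  have hAW : Aᵀ * W * A = W - 1 + (A ^ k)ᵀ * A ^ k := by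
    have h1 : Aᵀ * W * A = ∑ j ∈ Finset.range k, (A ^ (j + 1))ᵀ * A ^ (j + 1) := by
      simp only [W, Finset.mul_sum, Finset.sum_mul]
      refine Finset.sum_congr rfl fun j _ => ?_
      rw [pow_succ A j, transpose_mul]
      simp only [Matrix.mul_assoc]
    have h2 := Finset.sum_range_succ (fun j => (A ^ j)ᵀ * A ^ j) k
    rw [Finset.sum_range_succ'] at h2
    rw [h1, eq_sub_of_add_eq h2]
    simp only [pow_zero, transpose_one, mul_one, W]
    abel
  set C : ℝ := ∑ i, ∑ j, |W i j| with hC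
  have hWC := le_sum_abs_smul_one hWpd.posSemidef.transpose_eq
  rw [← hC] at hWC
  have hC0 : 0 ≤ C := by positivity
  refine ⟨W, 1 - 1 / (2 * (C + 1)), hWpd, hW1, ?_, ?_, ?_⟩
  · have : 1 / (2 * (C + 1)) ≤ 1 / 2 := by
      apply one_div_le_one_div_of_le <;> linarith
    linarith
  · have : 0 < 1 / (2 * (C + 1)) := by positivity
    linarith
  · have h3 : (1 / (2 * (C + 1))) • W ≤ (1 / 2 : ℝ) • (1 : Matrix (Fin n) (Fin n) ℝ) := by
      have h4 : W ≤ (C + 1) • (1 : Matrix (Fin n) (Fin n) ℝ) := by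
        refine hWC.trans ?_
        rw [Matrix.le_iff, ← sub_smul]
        exact PosSemidef.one.smul (by linarith)
      have h5 := smul_le_smul_of_nonneg_left h4 (show 0 ≤ 1 / (2 * (C + 1)) by positivity)
      rw [smul_smul] at h5
      convert h5 using 2
      field_simp
    rw [hAW, sub_smul, one_smul]
    calc W - 1 + (A ^ k)ᵀ * A ^ k ≤ W - 1 + (1 / 2 : ℝ) • (1 : Matrix (Fin n) (Fin n) ℝ) := by
          gcongr
      _ = W - (1 / 2 : ℝ) • (1 : Matrix (Fin n) (Fin n) ℝ) := by module
      _ ≤ _ := by gcongr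

end Schur

/-! ### Complex eigenvectors as real invariant planes, and Stein equations. -/

section RealEigen

variable {n : ℕ}

/-- Schur stability in terms of the real invariant planes of the matrix. -/
theorem isSchurStable_iff_real (A : Matrix (Fin n) (Fin n) ℝ) :
    IsSchurStable A ↔ ∀ (s t : ℝ) (a b : Fin n → ℝ), A *ᵥ a = s • a - t • b →
      A *ᵥ b = t • a + s • b → 1 ≤ s ^ 2 + t ^ 2 → a = 0 ∧ b = 0 := by
  have hnorm : ∀ z : ℂ, ‖z‖ < 1 ↔ z.re ^ 2 + z.im ^ 2 < 1 := fun z => by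
    rw [← sq_lt_one_iff₀ (norm_nonneg z), ← Complex.normSq_eq_norm_sq, Complex.normSq_apply,
      sq, sq]
  -- Real and imaginary parts of an eigenvector a + ib with eigenvalue s + it.
  have key : ∀ (a b : Fin n → ℝ) (z : ℂ),
      A.map (algebraMap ℝ ℂ) *ᵥ (fun i => (⟨a i, b i⟩ : ℂ)) = z • (fun i => (⟨a i, b i⟩ : ℂ)) ↔
        A *ᵥ a = z.re • a - z.im • b ∧ A *ᵥ b = z.im • a + z.re • b := by
    intro a b z
    simp only [funext_iff, ← forall_and]
    refine forall_congr' fun i => ?_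
    rw [Complex.ext_iff]
    refine and_congr ?_ ?_
    · simp [mulVec, dotProduct, Complex.re_sum]
    · simp [mulVec, dotProduct, Complex.im_sum, add_comm]
  rw [isSchurStable_iff]
  constructor
  · intro h s t a b ha hb hst
    by_contra hab
    have hv : (fun i => (⟨a i, b i⟩ : ℂ)) ≠ 0 := by
      intro hv
      refine hab ⟨funext fun i => ?_, funext fun i => ?_⟩
      · exact congrArg Complex.re (congrFun hv i)
      · exact congrArg Complex.im (congrFun hv i)
    have := (hnorm ⟨s, t⟩).1 (h ⟨s, t⟩ _ hv ((key a b ⟨s, t⟩).2 ⟨ha, hb⟩))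
    simp only at this
    linarith
  · intro h z v hv hz
    rw [hnorm]
    by_contra hcon
    have := (key (fun i => (v i).re) (fun i => (v i).im) z).1 hz
    obtain ⟨ha, hb⟩ := h _ _ _ _ this.1 this.2 (not_lt.1 hcon)
    exact hv (funext fun i => Complex.ext (congrFun ha i) (congrFun hb i))

/-- In a Stein equation, unstable left invariant planes lie in the kernel of the forcing term. -/
theorem stein_kernel {A X G : Matrix (Fin n) (Fin n) ℝ} (hX : X.PosSemidef) (hG : G.PosSemidef)
    (h : X = A * X * Aᵀ + G) {s t : ℝ} {a b : Fin n → ℝ} (ha : Aᵀ *ᵥ a = s • a - t • b)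
    (hb : Aᵀ *ᵥ b = t • a + s • b) (hst : 1 ≤ s ^ 2 + t ^ 2) : G *ᵥ a = 0 ∧ G *ᵥ b = 0 := by
  have hq : ∀ x, x ⬝ᵥ X *ᵥ x = (Aᵀ *ᵥ x) ⬝ᵥ X *ᵥ (Aᵀ *ᵥ x) + x ⬝ᵥ G *ᵥ x := by
    intro x
    conv_lhs => rw [h]
    rw [add_mulVec, dotProduct_add, ← mulVec_mulVec, ← mulVec_mulVec, dotProduct_mulVec,
      ← mulVec_transpose]
  have h1 := hq a
  have h2 := hq b
  rw [ha] at h1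
  rw [hb] at h2
  have hc := hX.dotProduct_mulVec_comm a b
  simp only [mulVec_sub, mulVec_add, mulVec_smul, dotProduct_sub, dotProduct_add, sub_dotProduct,
    add_dotProduct, dotProduct_smul, smul_dotProduct, smul_eq_mul] at h1 h2
  have ga := hG.dotProduct_nonneg a
  have gb := hG.dotProduct_nonneg b
  have xa := hX.dotProduct_nonneg a
  have xb := hX.dotProduct_nonneg b
  -- The plane is rotated and scaled by s² + t², so in the sum of the two forms the cross terms aᵀXb
  -- cancel. The left side is then nonpositive and the right side nonnegative.
  have hsum : (1 - (s ^ 2 + t ^ 2)) * (a ⬝ᵥ X *ᵥ a + b ⬝ᵥ X *ᵥ b) =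
      a ⬝ᵥ G *ᵥ a + b ⬝ᵥ G *ᵥ b := by
    rw [hc] at h1 h2
    linear_combination h1 + h2
  have hle : (1 - (s ^ 2 + t ^ 2)) * (a ⬝ᵥ X *ᵥ a + b ⬝ᵥ X *ᵥ b) ≤ 0 :=
    mul_nonpos_of_nonpos_of_nonneg (by linarith) (by linarith)
  exact ⟨hG.mulVec_eq_zero (by linarith), hG.mulVec_eq_zero (by linarith)⟩

end RealEigen

/-! ### Limits in the Loewner order. -/

section Limits

variable {n : ℕ}

theorem le_of_tendsto_matrix {ι : Type*} {l : Filter ι} [l.NeBot]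
    {f g : ι → Matrix (Fin n) (Fin n) ℝ} {X Y : Matrix (Fin n) (Fin n) ℝ}
    (hf : Tendsto f l (nhds X)) (hg : Tendsto g l (nhds Y)) (h : ∀ᶠ k in l, f k ≤ g k) :
    X ≤ Y := by
  have hd : Tendsto (fun k => g k - f k) l (nhds (Y - X)) := hg.sub hf
  refine Matrix.le_iff.2 (PosSemidef.of_dotProduct_mulVec_nonneg ?_ fun x => ?_)
  · have ht : Tendsto (fun k => (g k - f k)ᵀ) l (nhds (Y - X)ᵀ) :=
      (continuous_id.matrix_transpose.tendsto _).comp hd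
    have : (Y - X)ᵀ = Y - X := tendsto_nhds_unique_of_eventuallyEq ht hd
      (h.mono fun k hk => (Matrix.le_iff.1 hk).transpose_eq)
    simpa [IsHermitian, conjTranspose_eq_transpose_of_trivial] using this
  · have hc : Continuous fun Z : Matrix (Fin n) (Fin n) ℝ => star x ⬝ᵥ Z *ᵥ x := by fun_prop
    exact ge_of_tendsto ((hc.tendsto _).comp hd)
      (h.mono fun k hk => (Matrix.le_iff.1 hk).dotProduct_mulVec_nonneg x)

theorem posSemidef_of_tendsto {ι : Type*} {l : Filter ι} [l.NeBot]
    {f : ι → Matrix (Fin n) (Fin n) ℝ} {X : Matrix (Fin n) (Fin n) ℝ}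
    (hf : Tendsto f l (nhds X)) (h : ∀ k, (f k).PosSemidef) : X.PosSemidef :=
  nonneg_iff_posSemidef.1
    (le_of_tendsto_matrix tendsto_const_nhds hf (Eventually.of_forall fun k => (h k).nonneg))

/-- Nonnegativity of the quadratic form at e_i ± e_j bounds an off-diagonal entry by the mean of two
diagonal ones. -/
theorem _root_.Matrix.PosSemidef.abs_entry_le_trace {X : Matrix (Fin n) (Fin n) ℝ}
    (hX : X.PosSemidef) (i j : Fin n) : |X i j| ≤ X.trace := by
  have hd : ∀ i, X i i ≤ X.trace := fun i =>
    Finset.single_le_sum (f := fun i => X i i) (fun k _ => hX.diag_nonneg) (Finset.mem_univ i)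
  have hs : X j i = X i j := congrFun (congrFun hX.transpose_eq i) j
  have h1 := hX.dotProduct_nonneg (Pi.single i 1 + Pi.single j 1)
  have h2 := hX.dotProduct_nonneg (Pi.single i 1 - Pi.single j 1)
  simp [mulVec_add, mulVec_sub] at h1 h2
  have := hd i
  have := hd j
  rw [abs_le]
  constructor <;> linarith

/-- A monotone sequence of positive semidefinite matrices with bounded traces converges. -/
theorem exists_tendsto_of_monotone {X : ℕ → Matrix (Fin n) (Fin n) ℝ} (hmono : Monotone X)
    (hX : ∀ k, (X k).PosSemidef) {c : ℝ} (hc : ∀ k, (X k).trace ≤ c) :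
    ∃ Y, Tendsto X atTop (nhds Y) ∧ ∀ k, X k ≤ Y := by
  have hq : ∀ x : Fin n → ℝ, ∃ q, Tendsto (fun k => x ⬝ᵥ X k *ᵥ x) atTop (nhds q) := by
    intro x
    refine ⟨_, tendsto_atTop_ciSup (fun k l hkl => dotProduct_le_of_le (hmono hkl) x) ?_⟩
    refine ⟨∑ i, ∑ j, |x i| * (c * |x j|), ?_⟩
    rintro _ ⟨k, rfl⟩
    simp only [dotProduct, mulVec, Finset.mul_sum]
    refine Finset.sum_le_sum fun i _ => Finset.sum_le_sum fun j _ => ?_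
    refine (le_abs_self _).trans ?_
    rw [abs_mul, abs_mul]
    gcongr
    exact ((hX k).abs_entry_le_trace i j).trans (hc k)
  choose q hq using hq
  -- Polarization recovers the entries from the quadratic forms, each of which converges as a
  -- bounded monotone real sequence.
  have hent : ∀ i j, Tendsto (fun k => X k i j) atTop
      (nhds ((q (Pi.single i 1 + Pi.single j 1) - q (Pi.single i 1) - q (Pi.single j 1)) / 2)) := by
    intro i j
    have h := (((hq (Pi.single i 1 + Pi.single j 1)).sub (hq (Pi.single i 1))).sub
      (hq (Pi.single j 1))).div_const 2
    refine h.congr fun k => ?_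
    have hs : X k j i = X k i j := congrFun (congrFun (hX k).transpose_eq i) j
    simp [mulVec_add]
    linarith
  refine ⟨Matrix.of fun i j =>
    (q (Pi.single i 1 + Pi.single j 1) - q (Pi.single i 1) - q (Pi.single j 1)) / 2, ?_, ?_⟩
  · exact tendsto_pi_nhds.2 fun i => tendsto_pi_nhds.2 fun j => hent i j
  · intro k
    refine le_of_tendsto_matrix tendsto_const_nhds
      (tendsto_pi_nhds.2 fun i => tendsto_pi_nhds.2 fun j => hent i j) ?_
    filter_upwards [eventually_ge_atTop k] with l hl using hmono hl

end Limits

/-! ### The filtering Riccati recursion: uniqueness, boundedness, convergence. -/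

section Riccati

variable {n m : ℕ} {A Sig : Matrix (Fin n) (Fin n) ℝ} {C : Matrix (Fin m) (Fin n) ℝ}
  {M : Matrix (Fin m) (Fin m) ℝ}

/-- One step of the filtering Riccati recursion. -/
noncomputable def riccatiStep (A : Matrix (Fin n) (Fin n) ℝ) (C : Matrix (Fin m) (Fin n) ℝ)
    (M : Matrix (Fin m) (Fin m) ℝ) (Sig X : Matrix (Fin n) (Fin n) ℝ) :
    Matrix (Fin n) (Fin n) ℝ :=
  measUpd C M (A * X * Aᵀ + Sig)

theorem riccatiStep_posSemidef (hM : M.PosDef) (hSig : Sig.PosSemidef)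
    {X : Matrix (Fin n) (Fin n) ℝ} (hX : X.PosSemidef) : (riccatiStep A C M Sig X).PosSemidef :=
  measUpd_posSemidef hM ((hX.conj A).add hSig)

theorem riccatiStep_mono (hM : M.PosDef) (hSig : Sig.PosSemidef)
    {X Y : Matrix (Fin n) (Fin n) ℝ} (hX : X.PosSemidef) (h : X ≤ Y) :
    riccatiStep A C M Sig X ≤ riccatiStep A C M Sig Y := by
  refine measUpd_mono hM ((hX.conj A).add hSig) ?_
  gcongr
  exact conj_le_conj h A

/-- Comparable fixed points of the Riccati recursion coincide under stabilizability. -/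
theorem riccati_fixedPoint_unique (hM : M.PosDef) (hSig : Sig.PosSemidef)
    (hstab : IsStabilizable A (CFC.sqrt Sig)) {X Y : Matrix (Fin n) (Fin n) ℝ}
    (hX : X.PosSemidef) (hXf : riccatiStep A C M Sig X = X)
    (hYf : riccatiStep A C M Sig Y = Y) (hXY : X ≤ Y) : X = Y := by
  have hY : Y.PosSemidef := nonneg_iff_posSemidef.1 (hX.nonneg.trans hXY)
  set Xm := A * X * Aᵀ + Sig with hXm
  set Ym := A * Y * Aᵀ + Sig with hYm
  have hXmp : Xm.PosSemidef := (hX.conj A).add hSig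
  have hYmp : Ym.PosSemidef := (hY.conj A).add hSig
  have hXe : measUpd C M Xm = X := hXf
  have hYe : measUpd C M Ym = Y := hYf
  -- The predictor gain optimal for the smaller solution. For `Y` it is only suboptimal, which gives
  -- an inequality with the same closed-loop matrix `A1`.
  obtain ⟨L, hL⟩ := exists_gain_measUpd (C := C) hM hXmp A
  rw [hXe] at hL
  have hLY := measUpd_le (C := C) hM hYmp A L
  rw [hYe] at hLY
  set A1 := A + L * C with hA1
  have hstein : Xm = A1 * Xm * A1ᵀ + (L * M * Lᵀ + Sig) := by
    rw [← add_assoc, hL, ← hXm]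
  have hLM : (L * M * Lᵀ).PosSemidef := hM.posSemidef.conj L
  have hker : ∀ a : Fin n → ℝ, (L * M * Lᵀ + Sig) *ᵥ a = 0 → Lᵀ *ᵥ a = 0 ∧ CFC.sqrt Sig *ᵥ a = 0 := by
    intro a ha
    have h0 : a ⬝ᵥ (L * M * Lᵀ) *ᵥ a + a ⬝ᵥ Sig *ᵥ a = 0 := by
      rw [← dotProduct_add, ← add_mulVec, ha, dotProduct_zero]
    have h1 := hLM.dotProduct_nonneg a
    have h2 := hSig.dotProduct_nonneg a
    have h3 : a ⬝ᵥ (L * M * Lᵀ) *ᵥ a = (Lᵀ *ᵥ a) ⬝ᵥ M *ᵥ (Lᵀ *ᵥ a) := by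
      rw [← mulVec_mulVec, ← mulVec_mulVec, dotProduct_mulVec, ← mulVec_transpose]
    have h4 : a ⬝ᵥ Sig *ᵥ a = (CFC.sqrt Sig *ᵥ a) ⬝ᵥ (CFC.sqrt Sig *ᵥ a) := by
      conv_lhs => rw [← hSig.sqrt_mul_self]
      rw [← mulVec_mulVec, dotProduct_mulVec, ← mulVec_transpose, sqrt_transpose]
    constructor
    · by_contra hne
      have := hM.dotProduct_mulVec_pos hne
      simp only [star_trivial] at this
      linarith
    · exact dotProduct_self_eq_zero.1 (by linarith)
  -- On an unstable left invariant plane of `A1`, `stein_kernel` makes Lᵀ and the square root of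
  -- `Sig` vanish. There A1ᵀ agrees with the transpose of any A + √Sig·F, so a stabilizing F
  -- excludes the plane.
  have hschur : IsSchurStable A1 := by
    obtain ⟨F, hF⟩ := hstab
    rw [← isSchurStable_transpose_iff, isSchurStable_iff_real] at hF ⊢
    intro s t a b ha hb hst
    obtain ⟨ga, gb⟩ := stein_kernel hXmp (hLM.add hSig) hstein ha hb hst
    have hk : ∀ a : Fin n → ℝ, (L * M * Lᵀ + Sig) *ᵥ a = 0 →
        (A + CFC.sqrt Sig * F)ᵀ *ᵥ a = A1ᵀ *ᵥ a := by
      intro a ha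
      obtain ⟨h1, h2⟩ := hker a ha
      rw [hA1, transpose_add, transpose_add, transpose_mul, transpose_mul, sqrt_transpose,
        add_mulVec, add_mulVec, ← mulVec_mulVec, ← mulVec_mulVec, h1, h2, mulVec_zero, mulVec_zero]
    exact hF s t a b ((hk a ga).trans ha) ((hk b gb).trans hb) hst
  -- Inequality for `Ym` minus equality for `Xm`. Iterating the result forces the difference below a
  -- limit that is zero.
  have hDle : Ym - Xm ≤ A1 * (Ym - Xm) * A1ᵀ := by
    have h1 : Ym ≤ A1 * Ym * A1ᵀ + L * M * Lᵀ + Sig := by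
      conv_lhs => rw [hYm]
      gcongr
    rw [Matrix.le_iff] at h1 ⊢
    convert h1 using 1
    conv_lhs => rw [Matrix.mul_sub, Matrix.sub_mul, eq_sub_of_add_eq hstein.symm]
    abel
  have hDk : ∀ k : ℕ, Ym - Xm ≤ A1 ^ k * (Ym - Xm) * (A1 ^ k)ᵀ := by
    intro k
    induction k with
    | zero => simp
    | succ k ih =>
      refine ih.trans ((conj_le_conj hDle (A1 ^ k)).trans (le_of_eq ?_))
      rw [pow_succ, transpose_mul]
      simp only [Matrix.mul_assoc]
  have hlim : Tendsto (fun k : ℕ => A1 ^ k * (Ym - Xm) * (A1 ^ k)ᵀ) atTop (nhds 0) := by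
    have hc : Continuous fun Z : Matrix (Fin n) (Fin n) ℝ => Z * (Ym - Xm) * Zᵀ := by fun_prop
    simpa only [Function.comp_def, zero_mul] using (hc.tendsto 0).comp hschur.tendsto_pow
  have hle : Ym - Xm ≤ 0 :=
    le_of_tendsto_matrix tendsto_const_nhds hlim (Eventually.of_forall hDk)
  have hge : Xm ≤ Ym := by
    rw [hXm, hYm]
    gcongr
    exact conj_le_conj hXY A
  have : Xm = Ym := le_antisymm hge (sub_nonpos.1 hle)
  rw [← hXe, ← hYe, this]

/-- The error covariances of a filter for a detectable pair remain bounded. -/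
theorem exists_trace_bound_of_detectable (hdet : IsDetectable A C) (hM : M.PosDef)
    {X Sg : ℕ → Matrix (Fin n) (Fin n) ℝ} (hX : ∀ k, (X k).PosSemidef)
    (hSg : ∀ k, (Sg k).PosSemidef) {c : ℝ} (hc : ∀ k, (Sg k).trace ≤ c)
    (h : ∀ k, X (k + 1) ≤ measUpd C M (A * X k * Aᵀ + Sg k)) :
    ∃ b, ∀ k, (X k).trace ≤ b := by
  obtain ⟨L, hL⟩ := hdet
  obtain ⟨W, q, hW, hW1, hq0, hq1, hWq⟩ := hL.exists_lyapunov
  set A1 := A + L * C with hA1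
  let Xm : ℕ → Matrix (Fin n) (Fin n) ℝ := fun k => A * X k * Aᵀ + Sg k
  have hXm : ∀ k, (Xm k).PosSemidef := fun k => ((hX k).conj A).add (hSg k)
  have hWC := le_sum_abs_smul_one hW.posSemidef.transpose_eq
  set w : ℝ := ∑ i, ∑ j, |W i j| with hw
  have hw0 : 0 ≤ w := by positivity
  have htr : ∀ Z : Matrix (Fin n) (Fin n) ℝ, Z.PosSemidef →
      Z.trace ≤ (W * Z).trace ∧ (W * Z).trace ≤ w * Z.trace := by
    intro Z hZ
    have h1 := hZ.trace_mul_le hW1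
    have h2 := hZ.trace_mul_le hWC
    rw [mul_one, Matrix.trace_mul_comm] at h1
    rw [mul_smul_comm, mul_one, trace_smul, smul_eq_mul, Matrix.trace_mul_comm] at h2
    exact ⟨h1, h2⟩
  set d : ℝ := (W * (L * M * Lᵀ)).trace + w * c with hd
  -- The injection that stabilizes A + LC is used as a suboptimal filter gain. With the Lyapunov
  -- weight `W`, the trace of the prediction covariance contracts by `q` up to the constant `d`.
  have hstep : ∀ k, (W * Xm (k + 1)).trace ≤ q * (W * Xm k).trace + d := by
    intro k
    have h1 : Xm (k + 1) ≤ A1 * Xm k * A1ᵀ + L * M * Lᵀ + Sg (k + 1) := by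
      have h2 := (conj_le_conj (h k) A).trans (measUpd_le hM (hXm k) A L)
      show A * X (k + 1) * Aᵀ + Sg (k + 1) ≤ _
      gcongr
    have h2 := hW.posSemidef.trace_mul_le h1
    have h6 : (W * (A1 * Xm k * A1ᵀ + L * M * Lᵀ + Sg (k + 1))).trace =
        (W * (A1 * Xm k * A1ᵀ)).trace + (W * (L * M * Lᵀ)).trace + (W * Sg (k + 1)).trace := by
      simp only [Matrix.mul_add, trace_add]
    have h3 : (W * (A1 * Xm k * A1ᵀ)).trace ≤ q * (W * Xm k).trace := by
      have h4 := (hXm k).trace_mul_le hWq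
      rw [mul_smul_comm, trace_smul, smul_eq_mul, Matrix.trace_mul_comm _ W] at h4
      refine le_trans (le_of_eq ?_) h4
      rw [Matrix.trace_mul_comm (Xm k), ← Matrix.mul_assoc, Matrix.trace_mul_comm _ A1ᵀ]
      simp only [Matrix.mul_assoc]
    have h5 := (htr _ (hSg (k + 1))).2.trans (mul_le_mul_of_nonneg_left (hc (k + 1)) hw0)
    linarith
  have hbd : ∀ k, (W * Xm k).trace ≤ (W * Xm 0).trace + |d| / (1 - q) := by
    have hq' : 0 < 1 - q := by linarith
    have hd' : |d| = (1 - q) * (|d| / (1 - q)) := by field_simp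
    have hτ0 : 0 ≤ (W * Xm 0).trace := hW.posSemidef.trace_mul_nonneg (hXm 0)
    have hdd : 0 ≤ |d| / (1 - q) := by positivity
    intro k
    induction k with
    | zero => linarith
    | succ k ih =>
      have h1 := hstep k
      have h2 := mul_le_mul_of_nonneg_left ih hq0.le
      have h3 := le_abs_self d
      nlinarith
  refine ⟨(X 0).trace + ((W * Xm 0).trace + |d| / (1 - q)), fun k => ?_⟩
  rcases k with _ | k
  · have := hbd 0
    have h0 := hW.posSemidef.trace_mul_nonneg (hXm 0)
    linarith
  · have h1 := (Matrix.le_iff.1 ((h k).trans (measUpd_le_self hM (hXm k)))).trace_nonneg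
    rw [trace_sub] at h1
    have h2 := (htr _ (hXm k)).1
    have h3 := hbd k
    have h4 := (hX 0).trace_nonneg
    linarith

theorem riccati_iterate_posSemidef (hM : M.PosDef) (hSig : Sig.PosSemidef)
    {X : Matrix (Fin n) (Fin n) ℝ} (hX : X.PosSemidef) (k : ℕ) :
    ((riccatiStep A C M Sig)^[k] X).PosSemidef := by
  induction k with
  | zero => simpa
  | succ k ih =>
    rw [Function.iterate_succ_apply']
    exact riccatiStep_posSemidef hM hSig ih

/-- An increasing bounded orbit of the Riccati recursion converges to a fixed point. -/
theorem exists_riccati_limit (hM : M.PosDef) (hSig : Sig.PosSemidef)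
    {X : Matrix (Fin n) (Fin n) ℝ} (hX : X.PosSemidef) (hXle : X ≤ riccatiStep A C M Sig X)
    {c : ℝ} (hc : ∀ k, ((riccatiStep A C M Sig)^[k] X).trace ≤ c) :
    ∃ Y, Tendsto (fun k => (riccatiStep A C M Sig)^[k] X) atTop (nhds Y) ∧
      riccatiStep A C M Sig Y = Y ∧ Y.PosSemidef ∧ X ≤ Y := by
  have hpsd := riccati_iterate_posSemidef (A := A) (C := C) hM hSig hX
  have hmono : Monotone fun k => (riccatiStep A C M Sig)^[k] X := by
    refine monotone_nat_of_le_succ fun k => ?_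
    induction k with
    | zero => simpa
    | succ k ih =>
      rw [Function.iterate_succ_apply', Function.iterate_succ_apply' _ (k + 1)]
      exact riccatiStep_mono hM hSig (hpsd k) ih
  obtain ⟨Y, hY, hle⟩ := exists_tendsto_of_monotone hmono hpsd hc
  have hYp : Y.PosSemidef := posSemidef_of_tendsto hY hpsd
  refine ⟨Y, hY, ?_, hYp, by simpa using hle 0⟩
  have hcont : ContinuousAt (riccatiStep A C M Sig) Y := by
    have h1 : ContinuousAt (fun Z : Matrix (Fin n) (Fin n) ℝ => A * Z * Aᵀ + Sig) Y := by fun_prop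
    exact ContinuousAt.comp (f := fun Z : Matrix (Fin n) (Fin n) ℝ => A * Z * Aᵀ + Sig)
      (continuousAt_measUpd hM ((hYp.conj A).add hSig)) h1
  have h2 := hcont.tendsto.comp hY
  have h3 := (tendsto_add_atTop_iff_nat 1).2 hY
  refine tendsto_nhds_unique (h2.congr fun k => ?_) h3
  exact (Function.iterate_succ_apply' _ _ _).symm

/-- A subsolution of the Riccati equation is dominated by a solution. -/
theorem exists_riccati_fixedPoint_ge (hdet : IsDetectable A C) (hM : M.PosDef)
    (hSig : Sig.PosSemidef) {X : Matrix (Fin n) (Fin n) ℝ} (hX : X.PosSemidef)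
    (hXle : X ≤ riccatiStep A C M Sig X) :
    ∃ Y, Y.PosSemidef ∧ riccatiStep A C M Sig Y = Y ∧ X ≤ Y := by
  obtain ⟨b, hb⟩ := exists_trace_bound_of_detectable hdet hM (Sg := fun _ => Sig)
    (riccati_iterate_posSemidef (A := A) (C := C) hM hSig hX) (fun _ => hSig) (fun _ => le_rfl)
    (fun k => by rw [Function.iterate_succ_apply']; exact le_rfl)
  obtain ⟨Y, -, h1, h2, h3⟩ := exists_riccati_limit hM hSig hX hXle hb
  exact ⟨Y, h2, h1, h3⟩

/-- The Riccati recursion started at zero converges to any fixed point under stabilizability. -/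
theorem tendsto_riccati_zero (hM : M.PosDef) (hSig : Sig.PosSemidef)
    (hstab : IsStabilizable A (CFC.sqrt Sig)) {Y : Matrix (Fin n) (Fin n) ℝ}
    (hY : Y.PosSemidef) (hYf : riccatiStep A C M Sig Y = Y) :
    Tendsto (fun k => (riccatiStep A C M Sig)^[k] 0) atTop (nhds Y) := by
  have hpsd := riccati_iterate_posSemidef (A := A) (C := C) hM hSig PosSemidef.zero
  have hle : ∀ k, (riccatiStep A C M Sig)^[k] 0 ≤ Y := by
    intro k
    induction k with
    | zero => simpa using hY.nonneg
    | succ k ih =>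
      rw [Function.iterate_succ_apply', ← hYf]
      exact riccatiStep_mono hM hSig (hpsd k) ih
  obtain ⟨Z, hZ, hZf, hZp, -⟩ := exists_riccati_limit hM hSig PosSemidef.zero
    (riccatiStep_posSemidef hM hSig PosSemidef.zero).nonneg (c := Y.trace) fun k => by
      have := (Matrix.le_iff.1 (hle k)).trace_nonneg
      rw [trace_sub] at this
      linarith
  -- The limit from zero stays below `Y`, hence is comparable with it, as the uniqueness lemma
  -- requires.
  have hZY : Z ≤ Y := le_of_tendsto_matrix hZ tendsto_const_nhds (Eventually.of_forall hle)
  rwa [riccati_fixedPoint_unique hM hSig hstab hZp hZf hYf hZY] at hZ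

end Riccati

/-! ### The Bures distance and duality for the trace of the square root. -/

section Fidelity

variable {n : ℕ}

theorem le_inv_conj {N : Matrix (Fin n) (Fin n) ℝ} {X : Matrix (Fin n) (Fin n) ℝ} (hN : N.PosDef)
    (h : X ≤ N * N) : N⁻¹ * X * N⁻¹ ≤ 1 := by
  have hu : IsUnit N.det := (Matrix.isUnit_iff_isUnit_det N).1 hN.isUnit
  have h1 := conj_le_conj h N⁻¹
  rw [transpose_nonsing_inv, hN.posSemidef.transpose_eq, ← Matrix.mul_assoc, nonsing_inv_mul _ hu,
    Matrix.one_mul, mul_nonsing_inv _ hu] at h1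
  exact h1

theorem posDef_add_smul_one {N : Matrix (Fin n) (Fin n) ℝ} (hN : N.PosSemidef) {η : ℝ}
    (hη : 0 < η) : (N + η • (1 : Matrix (Fin n) (Fin n) ℝ)).PosDef :=
  PosDef.posSemidef_add hN (PosDef.one.smul hη)

theorem sq_le_sq_add_smul_one {N : Matrix (Fin n) (Fin n) ℝ} (hN : N.PosSemidef) {η : ℝ}
    (hη : 0 < η) : N * N ≤ (N + η • (1 : Matrix (Fin n) (Fin n) ℝ)) *
      (N + η • (1 : Matrix (Fin n) (Fin n) ℝ)) := by
  have h : (N + η • (1 : Matrix (Fin n) (Fin n) ℝ)) * (N + η • (1 : Matrix (Fin n) (Fin n) ℝ)) -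
      N * N = (2 * η) • N + (η * η) • 1 := by
    simp only [add_mul, mul_add, smul_mul_assoc, mul_smul_comm, one_mul, mul_one]
    module
  rw [Matrix.le_iff, h]
  exact (hN.smul (by positivity)).add (PosSemidef.one.smul (by positivity))

/-- From N² = (N - η)(N + η) + η²: a quantitative replacement of N² N⁻¹ = N for possibly singular N.
-/
theorem sq_mul_inv_add_smul_one {N : Matrix (Fin n) (Fin n) ℝ} (hN : N.PosSemidef) {η : ℝ}
    (hη : 0 < η) :
    N * N * (N + η • (1 : Matrix (Fin n) (Fin n) ℝ))⁻¹ = N - η • 1 +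
      (η * η) • (N + η • (1 : Matrix (Fin n) (Fin n) ℝ))⁻¹ := by
  have hpd := posDef_add_smul_one hN hη
  have hu := (Matrix.isUnit_iff_isUnit_det _).1 hpd.isUnit
  have h : N * N = (N - η • (1 : Matrix (Fin n) (Fin n) ℝ)) * (N + η • 1) + (η * η) • 1 := by
    simp only [sub_mul, mul_add, smul_mul_assoc, mul_smul_comm, one_mul, mul_one]
    module
  rw [h, add_mul, Matrix.mul_assoc, mul_nonsing_inv _ hu, mul_one, smul_mul_assoc, one_mul]

variable {S Shat : Matrix (Fin n) (Fin n) ℝ}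

theorem posSemidef_sqrt_conj (hS : S.PosSemidef) :
    (CFC.sqrt Shat * S * CFC.sqrt Shat).PosSemidef := by
  simpa only [sqrt_transpose] using hS.conj (CFC.sqrt Shat)

/-- The squared Bures distance is nonnegative. -/
theorem buresSq_nonneg (hS : S.PosSemidef) (hShat : Shat.PosSemidef) : 0 ≤ buresSq S Shat := by
  set D := CFC.sqrt Shat with hD
  have hDt : Dᵀ = D := sqrt_transpose _
  have hDD : D * D = Shat := hShat.sqrt_mul_self
  set N := CFC.sqrt (D * S * D) with hN
  have hNp : N.PosSemidef := posSemidef_sqrt _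
  have hNN : N * N = D * S * D := (posSemidef_sqrt_conj hS).sqrt_mul_self
  have key : ∀ η : ℝ, 0 < η → 2 * N.trace - 2 * η * n ≤ S.trace + Shat.trace := by
    intro η hη
    have hpd := posDef_add_smul_one hNp hη
    have hJ := sq_mul_inv_add_smul_one hNp hη
    have hle := le_inv_conj hpd (sq_le_sq_add_smul_one hNp hη)
    have hJp := hpd.inv.posSemidef
    set J := (N + η • (1 : Matrix (Fin n) (Fin n) ℝ))⁻¹
    have hJt := hJp.transpose_eq
    have hss := hS.sqrt_mul_self
    have hst := sqrt_transpose S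
    set s := CFC.sqrt S
    -- For invertible N the matrix D N⁻¹ D is the optimal linear transport map from S to Ŝ, and this
    -- square has trace Tr S - 2 Tr N + Tr Ŝ. Since N may be singular, N + η replaces it and η tends
    -- to 0 at the end.
    have h0 := trace_transpose_mul_self_nonneg (s - s * D * J * D)
    have h1 : (s - s * D * J * D)ᵀ * (s - s * D * J * D) =
        S - S * (D * J * D) - D * J * D * S + D * (J * (N * N) * J) * D := by
      rw [hNN, ← hss]
      simp only [transpose_sub, transpose_mul, hst, hJt, hDt, Matrix.mul_sub, Matrix.sub_mul,
        Matrix.mul_assoc]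
      abel
    have h2 : (S * (D * J * D)).trace = (N * N * J).trace := by
      rw [hNN, ← Matrix.mul_assoc, Matrix.trace_mul_comm _ D]
      simp only [Matrix.mul_assoc]
    have h3 : (D * J * D * S).trace = (N * N * J).trace := by
      rw [Matrix.trace_mul_comm, h2]
    have h4 : (D * (J * (N * N) * J) * D).trace ≤ Shat.trace := by
      have h5 := (Matrix.le_iff.1 (conj_le_conj hle D)).trace_nonneg
      rw [hDt, mul_one, hDD, trace_sub] at h5
      linarith
    have h6 : (N * N * J).trace = N.trace - η * n + η * η * J.trace := by
      rw [hJ]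
      simp [trace_add, trace_sub, trace_smul]
    have h7 : 0 ≤ η * η * J.trace := mul_nonneg (by positivity) hJp.trace_nonneg
    rw [h1, trace_add, trace_sub, trace_sub, h2, h3] at h0
    linarith
  have hfin : 2 * N.trace ≤ S.trace + Shat.trace := by
    have hc : Continuous fun η : ℝ => 2 * N.trace - 2 * η * n := by fun_prop
    have hl := (hc.tendsto 0).mono_left (nhdsWithin_le_nhds (s := Set.Ioi 0))
    have := le_of_tendsto hl (eventually_nhdsWithin_of_forall fun η hη => key η hη)
    simpa using this
  unfold buresSq
  rw [trace_sub, trace_add, trace_smul, smul_eq_mul]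
  linarith

/-- Dual attainment for the fidelity, up to an arbitrarily small error. -/
theorem exists_posDef_fidelity_le (hS : S.PosSemidef) (hShat : Shat.PosSemidef) {ε : ℝ}
    (hε : 0 < ε) :
    ∃ Z : Matrix (Fin n) (Fin n) ℝ, Z.PosDef ∧ (S * Z).trace + (Shat * Z⁻¹).trace ≤
      2 * (CFC.sqrt (CFC.sqrt Shat * S * CFC.sqrt Shat)).trace + ε := by
  have hDp : (CFC.sqrt Shat).PosSemidef := posSemidef_sqrt _
  have hDD : CFC.sqrt Shat * CFC.sqrt Shat = Shat := hShat.sqrt_mul_self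
  have hNN := (posSemidef_sqrt_conj (Shat := Shat) hS).sqrt_mul_self
  set D := CFC.sqrt Shat with hD
  set N := CFC.sqrt (D * S * D) with hN
  have hNp : N.PosSemidef := posSemidef_sqrt _
  -- Half of `ε` pays for Tr(N + η) - Tr N = η n; dividing by n + 1 also covers n = 0.
  obtain ⟨η, hη, hηε⟩ : ∃ η : ℝ, 0 < η ∧ η * n ≤ ε / 2 := by
    refine ⟨ε / 2 / (n + 1), by positivity, ?_⟩
    rw [div_mul_eq_mul_div, div_le_iff₀ (by positivity)]
    nlinarith
  have hpd := posDef_add_smul_one hNp hη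
  have hJ := sq_mul_inv_add_smul_one hNp hη
  have hJp := hpd.inv
  have hJu := (Matrix.isUnit_iff_isUnit_det _).1 hpd.isUnit
  set Nη := N + η • (1 : Matrix (Fin n) (Fin n) ℝ) with hNη
  have hNJ : (N * N * Nη⁻¹).trace ≤ N.trace := by
    have h1 : N * N * Nη⁻¹ = N - η • (N * Nη⁻¹) := by
      have h2 : N = Nη - η • 1 := by rw [hNη]; abel
      have h3 : N * Nη⁻¹ = 1 - η • Nη⁻¹ := by
        conv_lhs => rw [h2]
        rw [sub_mul, mul_nonsing_inv _ hJu, smul_mul_assoc, one_mul]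
      rw [hJ, h3]
      module
    have h2 := hNp.trace_mul_nonneg hJp.posSemidef
    rw [h1, trace_sub, trace_smul, smul_eq_mul]
    nlinarith
  -- The ideal weight D N⁻¹ D fails when D or N is singular, so both are shifted: Z = Dt Nη⁻¹ Dt. At
  -- t = 0 the trace of S Z is at most Tr N, so by continuity some small t > 0 costs at most the
  -- other half of `ε`. The term in Z⁻¹ is controlled by Dt⁻¹ D² Dt⁻¹ ≤ 1 for every t > 0.
  have hcont : Continuous fun t : ℝ =>
      ((D + t • (1 : Matrix (Fin n) (Fin n) ℝ)) * S * (D + t • 1) * Nη⁻¹).trace := by fun_prop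
  have hlim := (hcont.tendsto 0).mono_left (nhdsWithin_le_nhds (s := Set.Ioi 0))
  have hev := hlim.eventually_lt_const (u := N.trace + ε / 2) (by
    simp only [zero_smul, add_zero]
    rw [← hNN]
    linarith)
  obtain ⟨t, ht, ht0⟩ := (hev.and self_mem_nhdsWithin).exists
  have ht0' : 0 < t := ht0
  have hDt := posDef_add_smul_one hDp ht0'
  have hle := le_inv_conj hDt (sq_le_sq_add_smul_one hDp ht0')
  set Dt := D + t • (1 : Matrix (Fin n) (Fin n) ℝ) with hDtdef
  have hDtT := hDt.posSemidef.transpose_eq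
  have hDtu := (Matrix.isUnit_iff_isUnit_det _).1 hDt.isUnit
  refine ⟨Dt * Nη⁻¹ * Dt, ?_, ?_⟩
  · have h1 : (Dt * Nη⁻¹ * Dt).PosSemidef := by simpa only [hDtT] using hJp.posSemidef.conj Dt
    exact h1.posDef_iff_isUnit.2 ((hDt.isUnit.mul hJp.isUnit).mul hDt.isUnit)
  · have h1 : (S * (Dt * Nη⁻¹ * Dt)).trace = (Dt * S * Dt * Nη⁻¹).trace := by
      rw [← Matrix.mul_assoc, Matrix.trace_mul_comm _ Dt]
      simp only [Matrix.mul_assoc]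
    have h2 : (Shat * (Dt * Nη⁻¹ * Dt)⁻¹).trace = (Nη * (Dt⁻¹ * (D * D) * Dt⁻¹)).trace := by
      rw [Matrix.mul_inv_rev, Matrix.mul_inv_rev, nonsing_inv_nonsing_inv _ hJu, hDD,
        Matrix.trace_mul_comm Nη, ← Matrix.mul_assoc, Matrix.trace_mul_comm _ (Nη * Dt⁻¹),
        Matrix.trace_mul_comm _ Nη]
      simp only [Matrix.mul_assoc]
    have h3 := hpd.posSemidef.trace_mul_le hle
    have h4 : Nη.trace = N.trace + η * n := by
      simp [hNη, trace_add, trace_smul]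
    rw [mul_one, h4] at h3
    rw [h1, h2]
    linarith

end Fidelity

/-! ### Invertibility of 1 + PF and symmetric forms of (1 + PF)⁻¹P. -/

section Indefinite

variable {n : ℕ} {P F : Matrix (Fin n) (Fin n) ℝ}

/-- If x = -PFx, then xᵀFx = -(Fx)ᵀP(Fx). Both signs force zero, so Fx = 0 and then x = 0. -/
theorem isUnit_one_add_mul (hP : P.PosSemidef) (hF : F.PosSemidef) : IsUnit (1 + P * F) := by
  rw [Matrix.isUnit_iff_isUnit_det, isUnit_iff_ne_zero, Ne, ← Matrix.exists_mulVec_eq_zero_iff]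
  rintro ⟨x, hx0, hx⟩
  rw [add_mulVec, one_mulVec, ← mulVec_mulVec] at hx
  have h1 : x = -(P *ᵥ F *ᵥ x) := eq_neg_of_add_eq_zero_left hx
  have h2 : x ⬝ᵥ F *ᵥ x = -((F *ᵥ x) ⬝ᵥ P *ᵥ (F *ᵥ x)) := by
    calc x ⬝ᵥ F *ᵥ x = (F *ᵥ x) ⬝ᵥ x := _root_.dotProduct_comm _ _
      _ = (F *ᵥ x) ⬝ᵥ (-(P *ᵥ F *ᵥ x)) := congrArg (fun y => (F *ᵥ x) ⬝ᵥ y) h1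
      _ = _ := dotProduct_neg _ _
  have h3 := hF.dotProduct_nonneg x
  have h4 := hP.dotProduct_nonneg (F *ᵥ x)
  have h5 : F *ᵥ x = 0 := hF.mulVec_eq_zero (by linarith)
  rw [h5, mulVec_zero, neg_zero] at h1
  exact hx0 h1

theorem transpose_inv_one_add_mul (hP : P.PosSemidef) (hF : F.PosSemidef) :
    ((1 + P * F)⁻¹)ᵀ = (1 + F * P)⁻¹ := by
  rw [transpose_nonsing_inv, transpose_add, transpose_mul, hP.transpose_eq, hF.transpose_eq,
    transpose_one]

theorem inv_one_add_mul_mul (hP : P.PosSemidef) (hF : F.PosSemidef) :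
    (1 + P * F)⁻¹ * P = P * ((1 + P * F)⁻¹)ᵀ := by
  have h1 := (Matrix.isUnit_iff_isUnit_det _).1 (isUnit_one_add_mul hP hF)
  have h2 := (Matrix.isUnit_iff_isUnit_det _).1 (isUnit_one_add_mul hF hP)
  rw [transpose_inv_one_add_mul hP hF]
  calc (1 + P * F)⁻¹ * P = (1 + P * F)⁻¹ * (P * (1 + F * P) * (1 + F * P)⁻¹) := by
        rw [Matrix.mul_assoc P, mul_nonsing_inv _ h2, mul_one]
    _ = (1 + P * F)⁻¹ * ((1 + P * F) * P * (1 + F * P)⁻¹) := by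
        simp only [mul_add, add_mul, mul_one, one_mul, Matrix.mul_assoc]
    _ = P * (1 + F * P)⁻¹ := by
        rw [Matrix.mul_assoc (1 + P * F), ← Matrix.mul_assoc, nonsing_inv_mul _ h1, one_mul]

/-- Written as a congruence of P + PFP, the product becomes visibly symmetric and positive
semidefinite. -/
theorem inv_one_add_mul_mul_eq (hP : P.PosSemidef) (hF : F.PosSemidef) :
    (1 + P * F)⁻¹ * P = (1 + P * F)⁻¹ * (P + P * F * P) * ((1 + P * F)⁻¹)ᵀ := by
  have h2 := (Matrix.isUnit_iff_isUnit_det _).1 (isUnit_one_add_mul hF hP)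
  have h : P + P * F * P = P * (1 + F * P) := by rw [mul_add, mul_one, Matrix.mul_assoc]
  rw [h, transpose_inv_one_add_mul hP hF, Matrix.mul_assoc, Matrix.mul_assoc P,
    mul_nonsing_inv _ h2, mul_one]

theorem posSemidef_add_conj (hP : P.PosSemidef) (hF : F.PosSemidef) :
    (P + P * F * P).PosSemidef := by
  refine hP.add ?_
  simpa only [hP.transpose_eq] using hF.conj P

theorem posSemidef_inv_one_add_mul_mul (hP : P.PosSemidef) (hF : F.PosSemidef) :
    ((1 + P * F)⁻¹ * P).PosSemidef := by
  rw [inv_one_add_mul_mul_eq hP hF]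
  exact (posSemidef_add_conj hP hF).conj _

theorem one_add_mul_mul_inv (hP : P.PosSemidef) (hF : F.PosSemidef) :
    (1 + P * F) * ((1 + P * F)⁻¹ * P) = P := by
  have h1 := (Matrix.isUnit_iff_isUnit_det _).1 (isUnit_one_add_mul hP hF)
  rw [← Matrix.mul_assoc, mul_nonsing_inv _ h1, one_mul]

/-- With Y = (1 + PF)⁻¹P, symmetric, one has P - Y = PFY = YFY + YFPFY, a sum of congruences. -/
theorem inv_one_add_mul_mul_le (hP : P.PosSemidef) (hF : F.PosSemidef) :
    (1 + P * F)⁻¹ * P ≤ P := by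
  have hY := (posSemidef_inv_one_add_mul_mul hP hF).transpose_eq
  have hYY := one_add_mul_mul_inv hP hF
  generalize (1 + P * F)⁻¹ * P = Y at *
  have hYY' : Y * (1 + F * P) = P := by
    have := congrArg transpose hYY
    rwa [transpose_mul, hY, transpose_add, transpose_mul, transpose_one, hP.transpose_eq,
      hF.transpose_eq] at this
  have h : P - Y = Y * F * Yᵀ + Y * F * P * (Y * F)ᵀ := by
    have h1 : P - Y = P * F * Y := by
      conv_lhs => rw [← hYY]
      rw [add_mul, one_mul, add_sub_cancel_left]
    rw [h1, transpose_mul, hY, hF.transpose_eq]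
    conv_lhs => rw [← hYY']
    simp only [mul_add, add_mul, mul_one, Matrix.mul_assoc]
  rw [Matrix.le_iff, h]
  exact (hF.conj Y).add (hP.conj _)

end Indefinite

/-! ### Matrices acting on Euclidean vectors. -/

section Act

variable {k m n : ℕ}

theorem act_apply (A : Matrix (Fin m) (Fin n) ℝ) (x : Vec n) (i : Fin m) :
    act A x i = ∑ j, A i j * x j := by
  simp [act, Matrix.toLpLin_apply, mulVec, dotProduct]

theorem act_mul (A : Matrix (Fin k) (Fin m) ℝ) (B : Matrix (Fin m) (Fin n) ℝ) (x : Vec n) :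
    act (A * B) x = act A (act B x) := by
  simp [act, Matrix.toLpLin_apply, mulVec_mulVec]

theorem act_one (x : Vec n) : act (1 : Matrix (Fin n) (Fin n) ℝ) x = x := by
  simp [act]

theorem act_add (A B : Matrix (Fin m) (Fin n) ℝ) (x : Vec n) :
    act (A + B) x = act A x + act B x := by
  simp [act, map_add]

theorem act_sub (A B : Matrix (Fin m) (Fin n) ℝ) (x : Vec n) :
    act (A - B) x = act A x - act B x := by
  simp [act, map_sub]

theorem act_neg (A : Matrix (Fin m) (Fin n) ℝ) (x : Vec n) : act (-A) x = -act A x := by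
  simp [act, map_neg]

theorem act_smul (c : ℝ) (A : Matrix (Fin m) (Fin n) ℝ) (x : Vec n) :
    act (c • A) x = c • act A x := by
  simp [act, map_smul]

theorem inner_act (A : Matrix (Fin m) (Fin n) ℝ) (x : Vec m) (y : Vec n) :
    inner ℝ x (act A y) = inner ℝ (act Aᵀ x) y := by
  simp only [PiLp.inner_apply, act_apply, RCLike.inner_apply, conj_trivial, Finset.sum_mul,
    Finset.mul_sum, transpose_apply]
  rw [Finset.sum_comm]
  exact Finset.sum_congr rfl fun i _ => Finset.sum_congr rfl fun j _ => by ring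

theorem quad_add {Q : Matrix (Fin n) (Fin n) ℝ} (hQ : Qᵀ = Q) (x y : Vec n) :
    quad Q (x + y) = quad Q x + 2 * inner ℝ y (act Q x) + quad Q y := by
  have h : inner ℝ x (act Q y) = inner ℝ y (act Q x) := by
    rw [inner_act, hQ, real_inner_comm]
  simp only [quad, map_add, inner_add_left, inner_add_right, h]
  ring

theorem quad_eq_dotProduct (Q : Matrix (Fin n) (Fin n) ℝ) (x : Vec n) :
    quad Q x = x.ofLp ⬝ᵥ Q *ᵥ x.ofLp := by
  simp only [quad, PiLp.inner_apply, act_apply, RCLike.inner_apply, conj_trivial, dotProduct,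
    mulVec]
  exact Finset.sum_congr rfl fun i _ => mul_comm _ _

theorem quad_nonneg {Q : Matrix (Fin n) (Fin n) ℝ} (hQ : Q.PosSemidef) (x : Vec n) :
    0 ≤ quad Q x := by
  rw [quad_eq_dotProduct]
  exact hQ.dotProduct_nonneg _

end Act

/-! ### The algebraic Riccati equation and the saddle point of the mean game. -/

namespace LQSystem

variable {nx nu ny : ℕ} (S : LQSystem nx nu ny) (lam : ℝ) (P : Matrix (Fin nx) (Fin nx) ℝ)

/-- `(I + P Φ)⁻¹`. -/
noncomputable def resE : Matrix (Fin nx) (Fin nx) ℝ := (1 + P * S.Phi lam)⁻¹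

/-- The closed-loop matrix `(I + Φ P)⁻¹ A` of the stationary pair of policies. -/
noncomputable def closedA : Matrix (Fin nx) (Fin nx) ℝ := (S.resE lam P)ᵀ * S.A

/-- The constant part of the stationary value. -/
noncomputable def meanValue : ℝ :=
  quad (S.resE lam P * P) S.wHat + 2 * inner ℝ S.wHat (act (S.resE lam P) (S.rss lam P)) -
    inner ℝ (S.rss lam P) (act (S.Phi lam * S.resE lam P) (S.rss lam P))

variable {lam P}

section Riccati

variable (hQ : S.Q.PosSemidef) (hP : S.IsARESolution lam P) (hPhi : (S.Phi lam).PosSemidef)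

include hP in
theorem are_eq : P = S.Q + S.Aᵀ * (S.resE lam P * P) * S.A := by
  simpa only [Matrix.mul_assoc, resE] using hP.2

include hP hPhi in
-- The Riccati equation read as a Stein equation for the closed loop, with forcing at least `Q`;
-- this form feeds `stein_kernel`.
theorem are_eq_closedA :
    P = (S.closedA lam P)ᵀ * P * S.closedA lam P +
      (S.Q + (S.closedA lam P)ᵀ * (P * S.Phi lam * P) * S.closedA lam P) := by
  conv_lhs => rw [S.are_eq hP]
  rw [resE, inv_one_add_mul_mul_eq hP.1 hPhi]
  simp only [closedA, resE, transpose_mul, transpose_transpose, Matrix.mul_add, Matrix.add_mul,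
    Matrix.mul_assoc]
  abel

include hP hPhi in
theorem one_add_mul_closedA : (1 + S.Phi lam * P) * S.closedA lam P = S.A := by
  have h2 := (Matrix.isUnit_iff_isUnit_det _).1 (isUnit_one_add_mul hPhi hP.1)
  rw [closedA, resE, transpose_inv_one_add_mul hP.1 hPhi, ← Matrix.mul_assoc,
    mul_nonsing_inv _ h2, one_mul]

include hQ hP hPhi in
/-- The closed loop of the stationary pair of policies is stable. -/
theorem isSchurStable_closedA (hobs : IsObservable S.A (CFC.sqrt S.Q)) :
    IsSchurStable (S.closedA lam P) := by
  have hPFP : (P * S.Phi lam * P).PosSemidef := by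
    simpa only [hP.1.transpose_eq] using hPhi.conj P
  have hG := hPFP.conj' (S.closedA lam P)
  rw [isSchurStable_iff_real]
  intro s t a b ha hb hst
  -- On an unstable invariant plane both parts of the forcing vanish: the plane lies in the kernel
  -- of √Q, and ΦP annihilates the closed-loop image, so the closed loop acts there as A. The plane
  -- is thus A-invariant and unobserved, and observability makes it zero.
  obtain ⟨ga, gb⟩ := stein_kernel (A := (S.closedA lam P)ᵀ) hP.1 (hQ.add hG)
    (by rw [transpose_transpose]; exact S.are_eq_closedA hP hPhi)
    (by rw [transpose_transpose]; exact ha) (by rw [transpose_transpose]; exact hb) hst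
  have hker : ∀ x, (S.Q + (S.closedA lam P)ᵀ * (P * S.Phi lam * P) * S.closedA lam P) *ᵥ x = 0 →
      CFC.sqrt S.Q *ᵥ x = 0 ∧ S.A *ᵥ x = S.closedA lam P *ᵥ x := by
    intro x hx
    have h0 : x ⬝ᵥ S.Q *ᵥ x +
        x ⬝ᵥ ((S.closedA lam P)ᵀ * (P * S.Phi lam * P) * S.closedA lam P) *ᵥ x = 0 := by
      rw [← dotProduct_add, ← add_mulVec, hx, dotProduct_zero]
    have h1 := hQ.dotProduct_nonneg x
    have h2 := hG.dotProduct_nonneg x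
    have h3 : x ⬝ᵥ S.Q *ᵥ x = (CFC.sqrt S.Q *ᵥ x) ⬝ᵥ (CFC.sqrt S.Q *ᵥ x) := by
      conv_lhs => rw [← hQ.sqrt_mul_self]
      rw [← mulVec_mulVec, dotProduct_mulVec, ← mulVec_transpose, sqrt_transpose]
    refine ⟨dotProduct_self_eq_zero.1 (by linarith), ?_⟩
    have h4 : x ⬝ᵥ ((S.closedA lam P)ᵀ * (P * S.Phi lam * P) * S.closedA lam P) *ᵥ x =
        (P *ᵥ S.closedA lam P *ᵥ x) ⬝ᵥ S.Phi lam *ᵥ (P *ᵥ S.closedA lam P *ᵥ x) := by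
      rw [← mulVec_mulVec, ← mulVec_mulVec, dotProduct_mulVec, ← mulVec_transpose,
        transpose_transpose, Matrix.mul_assoc, ← mulVec_mulVec, dotProduct_mulVec,
        ← mulVec_transpose, hP.1.transpose_eq, ← mulVec_mulVec]
    have h5 := hPhi.mulVec_eq_zero (x := P *ᵥ S.closedA lam P *ᵥ x) (by linarith)
    conv_lhs => rw [← S.one_add_mul_closedA hP hPhi]
    rw [add_mul, one_mul, add_mulVec, Matrix.mul_assoc, ← mulVec_mulVec, ← mulVec_mulVec, h5,
      add_zero]
  obtain ⟨qa, hA⟩ := hker a ga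
  obtain ⟨qb, hB⟩ := hker b gb
  rw [ha] at hA
  rw [hb] at hB
  have hpow : ∀ k : ℕ, ∃ s' t' : ℝ, S.A ^ k *ᵥ a = s' • a - t' • b ∧
      S.A ^ k *ᵥ b = t' • a + s' • b := by
    intro k
    induction k with
    | zero => exact ⟨1, 0, by simp, by simp⟩
    | succ k ih =>
      obtain ⟨s', t', h1, h2⟩ := ih
      refine ⟨s' * s - t' * t, s' * t + t' * s, ?_, ?_⟩
      · rw [pow_succ', ← mulVec_mulVec, h1, mulVec_sub, mulVec_smul, mulVec_smul, hA, hB]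
        module
      · rw [pow_succ', ← mulVec_mulVec, h2, mulVec_add, mulVec_smul, mulVec_smul, hA, hB]
        module
  constructor
  · refine hobs a fun k _ => ?_
    obtain ⟨s', t', h1, -⟩ := hpow k
    rw [← mulVec_mulVec, h1, mulVec_sub, mulVec_smul, mulVec_smul, qa, qb]
    simp
  · refine hobs b fun k _ => ?_
    obtain ⟨s', t', -, h2⟩ := hpow k
    rw [← mulVec_mulVec, h2, mulVec_add, mulVec_smul, mulVec_smul, qa, qb]
    simp

include hQ hP hPhi in
/-- Observability makes the Riccati solution positive definite. -/
theorem posDef_of_isARESolution (hobs : IsObservable S.A (CFC.sqrt S.Q)) : P.PosDef := by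
  have hY := posSemidef_inv_one_add_mul_mul hP.1 hPhi
  -- The kernel of P is A-invariant and inside the kernel of √Q, so it is unobservable.
  have hker : ∀ x, P *ᵥ x = 0 → CFC.sqrt S.Q *ᵥ x = 0 ∧ P *ᵥ S.A *ᵥ x = 0 := by
    intro x hx
    have h0 : x ⬝ᵥ P *ᵥ x = 0 := by rw [hx, dotProduct_zero]
    rw [S.are_eq hP, add_mulVec, dotProduct_add, ← mulVec_mulVec, ← mulVec_mulVec,
      dotProduct_mulVec x S.Aᵀ, ← mulVec_transpose, transpose_transpose] at h0
    have h1 := hQ.dotProduct_nonneg x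
    have h2 := hY.dotProduct_nonneg (S.A *ᵥ x)
    simp only [resE] at h0
    have h3 : x ⬝ᵥ S.Q *ᵥ x = (CFC.sqrt S.Q *ᵥ x) ⬝ᵥ (CFC.sqrt S.Q *ᵥ x) := by
      conv_lhs => rw [← hQ.sqrt_mul_self]
      rw [← mulVec_mulVec, dotProduct_mulVec, ← mulVec_transpose, sqrt_transpose]
    refine ⟨dotProduct_self_eq_zero.1 (by linarith), ?_⟩
    have h4 := hY.mulVec_eq_zero (x := S.A *ᵥ x) (by linarith)
    rw [← one_add_mul_mul_inv hP.1 hPhi, ← mulVec_mulVec, h4, mulVec_zero]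
  refine PosDef.of_dotProduct_mulVec_pos hP.1.isHermitian fun {x} hx => ?_
  refine lt_of_le_of_ne (hP.1.dotProduct_mulVec_nonneg x) fun h0 => hx ?_
  have hPx : P *ᵥ x = 0 := hP.1.mulVec_eq_zero (by simpa using h0.symm)
  have hpow : ∀ k : ℕ, P *ᵥ S.A ^ k *ᵥ x = 0 := by
    intro k
    induction k with
    | zero => simpa
    | succ k ih =>
      rw [pow_succ', ← mulVec_mulVec]
      exact (hker _ ih).2
  refine hobs x fun k _ => ?_
  rw [← mulVec_mulVec]
  exact (hker _ (hpow k)).1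

include hP hPhi in
-- The Riccati equation rewrites S as Aᵀ(P - (1 + PΦ)⁻¹P)A. The sign matters because error
-- covariances are later replaced by larger or smaller ones under the trace against S.
theorem posSemidef_Sss : (S.Sss P).PosSemidef := by
  have h : S.Sss P = S.Aᵀ * (P - S.resE lam P * P) * S.A := by
    have := S.are_eq hP
    rw [Sss, Matrix.mul_sub, Matrix.sub_mul]
    conv_lhs => rw [add_comm]
    rw [add_sub_assoc]
    conv_lhs =>
      enter [2, 2]
      rw [this]
    abel
  rw [h]
  exact PosSemidef.conj' (Matrix.le_iff.1 (inv_one_add_mul_mul_le hP.1 hPhi)) S.A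

include hQ hP hPhi in
-- The inverse in the definition of `rss` is genuine, not a default value: 1 is no eigenvalue of
-- Aᵀ(1 + PΦ)⁻¹, the transpose of the stable closed loop.
theorem rss_eq (hobs : IsObservable S.A (CFC.sqrt S.Q)) :
    S.rss lam P = act (S.Aᵀ * S.resE lam P) (act P S.wHat + S.rss lam P) := by
  have hs := (isSchurStable_transpose_iff _).2 (S.isSchurStable_closedA hQ hP hPhi hobs)
  rw [isSchurStable_iff_real, closedA, transpose_mul, transpose_transpose] at hs
  have hu : IsUnit (1 - S.Aᵀ * S.resE lam P).det := by
    rw [isUnit_iff_ne_zero, Ne, ← Matrix.exists_mulVec_eq_zero_iff]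
    rintro ⟨x, hx0, hx⟩
    rw [sub_mulVec, one_mulVec, sub_eq_zero] at hx
    exact hx0 (hs 1 0 x 0 (by simpa using hx.symm) (by simp) (by norm_num)).1
  have h : act (1 - S.Aᵀ * S.resE lam P) (S.rss lam P) =
      act (S.Aᵀ * S.resE lam P * P) S.wHat := by
    rw [rss, ← act_mul]
    simp only [resE, Matrix.mul_assoc] at hu ⊢
    rw [Matrix.mul_nonsing_inv_cancel_left _ _ hu]
  rw [act_sub, act_one, act_mul _ P] at h
  rw [map_add, ← h]
  abel

end Riccati

section Saddle

variable (hQ : S.Q.PosSemidef) (hR : S.R.PosDef) (hlam : 0 < lam) (hP : S.IsARESolution lam P)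
  (hlamP : (lam • (1 : Matrix (Fin nx) (Fin nx) ℝ) - P).PosDef) (hPhi : (S.Phi lam).PosSemidef)

variable (lam P) in
/-- The costate `(I + P Φ)⁻¹ (P (A m + ŵ) + r)`. -/
noncomputable def costate (m : Vec nx) : Vec nx :=
  act (S.resE lam P) (act P (act S.A m + S.wHat) + S.rss lam P)

variable (lam P) in
/-- The stationary control at the conditional mean `m`. -/
noncomputable def ctrlAt (m : Vec nx) : Vec nu := act (S.Kss lam P) m + S.Lss lam P

variable (lam P) in
/-- The stationary worst-case disturbance mean at the conditional mean `m`. -/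
noncomputable def distMeanAt (m : Vec nx) : Vec nx := act (S.Hss lam P) m + S.Gss lam P

theorem ctrlAt_eq (m : Vec nx) :
    S.ctrlAt lam P m = -act (S.R⁻¹ * S.Bᵀ) (S.costate lam P m) := by
  simp only [ctrlAt, Kss, Lss, costate, act_neg, act_mul, map_add, resE]
  abel

/-- The two summands of Φ are the two players: BR⁻¹Bᵀ produces the control, -λ⁻¹I the shift of the
disturbance mean. -/
theorem phi_costate (m : Vec nx) :
    act S.A m + S.wHat - act (S.Phi lam) (S.costate lam P m) =
      act S.A m + act S.B (S.ctrlAt lam P m) + (S.wHat + lam⁻¹ • S.costate lam P m) := by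
  rw [ctrlAt_eq, map_neg, ← act_mul, Phi, act_sub, act_smul, act_one, Matrix.mul_assoc]
  abel

include hP hPhi in
theorem phi_mul_resE : S.Phi lam * (S.resE lam P * P) + (S.resE lam P)ᵀ = 1 := by
  have h2 := (Matrix.isUnit_iff_isUnit_det _).1 (isUnit_one_add_mul hPhi hP.1)
  rw [resE, inv_one_add_mul_mul hP.1 hPhi, transpose_inv_one_add_mul hP.1 hPhi,
    ← Matrix.mul_assoc, add_comm]
  conv_lhs => enter [1]; rw [← one_mul ((1 + S.Phi lam * P)⁻¹)]
  rw [← add_mul, mul_nonsing_inv _ h2]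

include hP hPhi in
-- The costate is half the gradient of xᵀPx + 2rᵀx at the next mean under saddle-point play.
theorem costate_eq (m : Vec nx) :
    act P (act S.A m + S.wHat - act (S.Phi lam) (S.costate lam P m)) + S.rss lam P =
      S.costate lam P m := by
  have h1 := (Matrix.isUnit_iff_isUnit_det _).1 (isUnit_one_add_mul hP.1 hPhi)
  have h : act (1 + P * S.Phi lam) (S.costate lam P m) =
      act P (act S.A m + S.wHat) + S.rss lam P := by
    rw [costate, resE, ← act_mul, mul_nonsing_inv _ h1, act_one]
  rw [act_add, act_one, act_mul] at h
  rw [map_sub, sub_add_eq_add_sub, ← h, add_sub_cancel_right]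

include hlamP hP hPhi hlam in
-- First-order condition of the maximizing player: λ(w - ŵ) equals the costate. Invertibility of λI
-- - P identifies its solution with the explicit gains.
theorem distMeanAt_eq (m : Vec nx) :
    S.distMeanAt lam P m = S.wHat + lam⁻¹ • S.costate lam P m := by
  have hu := (Matrix.isUnit_iff_isUnit_det _).1 hlamP.isUnit
  have h1 : S.distMeanAt lam P m = act (lam • 1 - P)⁻¹
      (act P (act S.A m + act S.B (S.ctrlAt lam P m)) + S.rss lam P + lam • S.wHat) := by
    rw [distMeanAt, ctrlAt, Hss, Gss, act_mul, act_mul, act_add, act_mul, act_mul]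
    simp only [map_add]
    abel
  have h2 := S.costate_eq hP hPhi m
  rw [phi_costate, map_add] at h2
  have h3 : act P (act S.A m + act S.B (S.ctrlAt lam P m)) + S.rss lam P + lam • S.wHat =
      act (lam • 1 - P) (S.wHat + lam⁻¹ • S.costate lam P m) := by
    rw [act_sub, act_smul, act_one, smul_add, smul_inv_smul₀ hlam.ne']
    have h4 : act P (act S.A m + act S.B (S.ctrlAt lam P m)) + S.rss lam P =
        S.costate lam P m - act P (S.wHat + lam⁻¹ • S.costate lam P m) :=
      eq_sub_of_add_eq (by rw [add_right_comm]; exact h2)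
    rw [h4]
    abel
  rw [h1, h3, ← act_mul, nonsing_inv_mul _ hu, act_one]

/-- The next predicted mean under the stationary policies is affine with matrix `closedA`. -/
theorem exists_closed_loop (hlam : 0 < lam) (hP : S.IsARESolution lam P)
    (hlamP : (lam • (1 : Matrix (Fin nx) (Fin nx) ℝ) - P).PosDef)
    (hPhi : (S.Phi lam).PosSemidef) :
    ∃ g : Vec nx, ∀ m, act S.A m + act S.B (S.ctrlAt lam P m) + S.distMeanAt lam P m =
      act (S.closedA lam P) m + g := by
  have hE := S.phi_mul_resE hP hPhi
  refine ⟨act (S.resE lam P)ᵀ S.wHat - act (S.Phi lam * S.resE lam P) (S.rss lam P), fun m => ?_⟩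
  rw [S.distMeanAt_eq hlam hP hlamP hPhi, ← phi_costate, closedA, costate, act_mul, act_mul,
    map_add (act (S.resE lam P)), map_add (act (S.Phi lam)), ← act_mul (S.resE lam P) P,
    ← act_mul (S.Phi lam) (S.resE lam P * P)]
  have h := congrArg (fun Z => act Z (act S.A m + S.wHat)) hE
  simp only [act_add, act_one] at h
  conv_lhs => enter [1]; rw [← h]
  rw [map_add (act (S.resE lam P)ᵀ)]
  abel

include hQ hR hlam hP hlamP hPhi in
/-- The saddle-point identity of the stationary game in the conditional means. -/
theorem saddle_identity (hobs : IsObservable S.A (CFC.sqrt S.Q)) (m w : Vec nx) :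
    quad S.Q m + quad S.R (S.ctrlAt lam P m) +
      (quad P (act S.A m + act S.B (S.ctrlAt lam P m) + w) +
        2 * inner ℝ (S.rss lam P) (act S.A m + act S.B (S.ctrlAt lam P m) + w)) -
      (quad P m + 2 * inner ℝ (S.rss lam P) m) - lam * ‖w - S.wHat‖ ^ 2 =
    S.meanValue lam P - quad (lam • 1 - P) (w - S.distMeanAt lam P m) := by
  set p := S.costate lam P m with hp
  set u := S.ctrlAt lam P m with hu
  set z := act S.A m + S.wHat with hz
  set r := S.rss lam P with hr
  set d := w - S.distMeanAt lam P m with hd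
  set E := S.resE lam P with hE
  have hYt : (E * P)ᵀ = E * P := (posSemidef_inv_one_add_mul_mul hP.1 hPhi).transpose_eq
  have hcl : act S.A m + act S.B u + (S.wHat + lam⁻¹ • p) = z - act (S.Phi lam) p :=
    (S.phi_costate m).symm
  -- Expansion around the saddle point. The terms linear in the deviation `d` cancel: the value and
  -- the penalty each contribute 2⟨p, d⟩. What remains in `d` is -dᵀ(λI - P)d.
  have hw : w = S.wHat + lam⁻¹ • p + d := by
    rw [hd, S.distMeanAt_eq hlam hP hlamP hPhi]
    abel
  have hx : act S.A m + act S.B u + w = (z - act (S.Phi lam) p) + d := by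
    rw [hw, ← hcl]
    abel
  have hco : act P (z - act (S.Phi lam) p) = p - r :=
    eq_sub_of_add_eq (S.costate_eq hP hPhi m)
  have hRu : quad S.R u = inner ℝ p (act (S.Phi lam) p) + lam⁻¹ * ‖p‖ ^ 2 := by
    have hRdet := (Matrix.isUnit_iff_isUnit_det _).1 hR.isUnit
    have h1 : act S.R u = -act S.Bᵀ p := by
      rw [hu, ctrlAt_eq, map_neg, ← act_mul, Matrix.mul_nonsing_inv_cancel_left _ _ hRdet]
    have h2 : act S.B u = -act (S.Phi lam) p - lam⁻¹ • p := by
      have h3 : act S.B u = (act S.A m + act S.B u + (S.wHat + lam⁻¹ • p)) - z - lam⁻¹ • p := by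
        rw [hz]
        abel
      rw [h3, hcl]
      abel
    rw [quad, h1, inner_neg_right, inner_act, transpose_transpose, h2, inner_sub_left,
      inner_neg_left, real_inner_smul_left, real_inner_self_eq_norm_sq, real_inner_comm]
    ring
  have hq : quad (lam • 1 - P) d = lam * ‖d‖ ^ 2 - quad P d := by
    rw [quad, act_sub, act_smul, act_one, inner_sub_right, real_inner_smul_right,
      real_inner_self_eq_norm_sq, quad]
  have hn : lam * ‖w - S.wHat‖ ^ 2 = lam⁻¹ * ‖p‖ ^ 2 + 2 * inner ℝ p d + lam * ‖d‖ ^ 2 := by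
    have h1 : w - S.wHat = lam⁻¹ • p + d := by rw [hw]; abel
    rw [h1, norm_add_sq_real, norm_smul, real_inner_smul_left, Real.norm_eq_abs, mul_pow, sq_abs]
    field_simp
  have hpe : p = act (E * P) z + act E r := by
    rw [hp, costate, map_add, act_mul]
  have hYz : quad (E * P) z = quad P m - quad S.Q m + 2 * inner ℝ (act S.A m) (act (E * P) S.wHat) +
      quad (E * P) S.wHat := by
    have h1 : quad (E * P) (act S.A m) = quad P m - quad S.Q m := by
      have h2 : quad P m = quad (S.Q + S.Aᵀ * (E * P) * S.A) m := by rw [← S.are_eq hP]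
      rw [h2, quad, quad, quad, act_add, inner_add_right, act_mul (S.Aᵀ * (E * P)) S.A,
        act_mul S.Aᵀ (E * P), inner_act S.Aᵀ m, transpose_transpose]
      ring
    rw [hz, quad_add hYt, h1, inner_act, hYt, real_inner_comm]
  -- The equation for `r` is what cancels the terms linear in `m`; the quadratic ones are cancelled
  -- by the Riccati equation inside `hYz`.
  have hlin : inner ℝ (act S.A m) (act (E * P) S.wHat) + inner ℝ (act S.A m) (act E r) =
      inner ℝ r m := by
    have h1 := S.rss_eq hQ hP hPhi hobs
    rw [← hr, ← hE, act_mul, map_add] at h1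
    rw [← inner_add_right, act_mul, real_inner_comm m]
    nth_rewrite 2 [h1]
    rw [inner_act _ m, transpose_transpose]
  have hre : inner ℝ r z - inner ℝ r (act (S.Phi lam) p) =
      inner ℝ z (act E r) - inner ℝ r (act (S.Phi lam * E) r) := by
    have h1 := congrArg (fun Z => act Z z) (S.phi_mul_resE hP hPhi)
    simp only [act_add, act_one] at h1
    have h2 : act (S.Phi lam) p = z - act Eᵀ z + act (S.Phi lam * E) r := by
      rw [hpe, map_add, ← act_mul, ← act_mul, hE]
      rw [← eq_sub_of_add_eq h1]
    clear_value z
    rw [h2, inner_add_right, inner_sub_right, inner_act Eᵀ r, transpose_transpose,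
      real_inner_comm z (act E r)]
    ring
  have hzp : inner ℝ z p = quad (E * P) z + inner ℝ z (act E r) := by
    rw [hpe, inner_add_right, quad]
  have hzE : inner ℝ z (act E r) = inner ℝ (act S.A m) (act E r) + inner ℝ S.wHat (act E r) := by
    rw [hz, inner_add_left]
  have hquad : quad P (z - act (S.Phi lam) p + d) = inner ℝ z p - inner ℝ p (act (S.Phi lam) p) -
      (inner ℝ r z - inner ℝ r (act (S.Phi lam) p)) + 2 * (inner ℝ p d - inner ℝ r d) +
      quad P d := by
    rw [quad_add hP.1.transpose_eq, quad, hco, inner_sub_right, inner_sub_left, inner_sub_left,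
      inner_sub_right, real_inner_comm p (act _ p), real_inner_comm r z,
      real_inner_comm r (act _ p), real_inner_comm p d, real_inner_comm r d]
  rw [hx]
  clear_value z
  rw [hquad, hRu, hn, hq, inner_add_right r, inner_sub_right r z, meanValue]
  simp only [← hE, ← hr]
  linear_combination hre + hzp + hYz + 2 * hlin + 2 * hzE

end Saddle

end LQSystem

/-! ### Matrices of mixed second moments. -/

section CrossMoment

variable {Ω Ω' : Type*} [MeasurableSpace Ω] [MeasurableSpace Ω'] {ν : Measure Ω} {k m n : ℕ}

/-- The matrix `E[f gᵀ]` of mixed second moments. -/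
noncomputable def crossMoment (ν : Measure Ω) (f : Ω → Vec m) (g : Ω → Vec n) :
    Matrix (Fin m) (Fin n) ℝ :=
  Matrix.of fun i j => ∫ ω, f ω i * g ω j ∂ν

theorem memLp_coord {p : ℝ≥0∞} {f : Ω → Vec n} (hf : MemLp f p ν) (i : Fin n) :
    MemLp (fun ω => f ω i) p ν :=
  (EuclideanSpace.proj (𝕜 := ℝ) i).comp_memLp' hf

theorem memLp_act {p : ℝ≥0∞} {f : Ω → Vec n} (hf : MemLp f p ν) (A : Matrix (Fin m) (Fin n) ℝ) :
    MemLp (fun ω => act A (f ω)) p ν :=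
  (LinearMap.toContinuousLinearMap (act A)).comp_memLp' hf

theorem integrable_mul_coord {f : Ω → Vec m} {g : Ω → Vec n} (hf : MemLp f 2 ν)
    (hg : MemLp g 2 ν) (i : Fin m) (j : Fin n) : Integrable (fun ω => f ω i * g ω j) ν :=
  (memLp_coord hf i).integrable_mul (memLp_coord hg j)

theorem crossMoment_transpose (f : Ω → Vec m) (g : Ω → Vec n) :
    (crossMoment ν f g)ᵀ = crossMoment ν g f := by
  ext i j
  simp only [crossMoment, transpose_apply, of_apply, mul_comm]

theorem crossMoment_add_left {f f' : Ω → Vec m} {g : Ω → Vec n} (hf : MemLp f 2 ν)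
    (hf' : MemLp f' 2 ν) (hg : MemLp g 2 ν) :
    crossMoment ν (fun ω => f ω + f' ω) g = crossMoment ν f g + crossMoment ν f' g := by
  ext i j
  simp only [crossMoment, of_apply, Matrix.add_apply, PiLp.add_apply, add_mul]
  exact integral_add (integrable_mul_coord hf hg i j) (integrable_mul_coord hf' hg i j)

theorem crossMoment_add_right {f : Ω → Vec m} {g g' : Ω → Vec n} (hf : MemLp f 2 ν)
    (hg : MemLp g 2 ν) (hg' : MemLp g' 2 ν) :
    crossMoment ν f (fun ω => g ω + g' ω) = crossMoment ν f g + crossMoment ν f g' := by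
  rw [← crossMoment_transpose, crossMoment_add_left hg hg' hf, transpose_add,
    crossMoment_transpose, crossMoment_transpose]

theorem crossMoment_act_left {f : Ω → Vec m} {g : Ω → Vec n} (hf : MemLp f 2 ν)
    (hg : MemLp g 2 ν) (A : Matrix (Fin k) (Fin m) ℝ) :
    crossMoment ν (fun ω => act A (f ω)) g = A * crossMoment ν f g := by
  ext i j
  simp only [crossMoment, of_apply, Matrix.mul_apply, act_apply, Finset.sum_mul, mul_assoc]
  rw [integral_finsetSum _ fun l _ => (integrable_mul_coord hf hg l j).const_mul _]
  simp only [integral_const_mul]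

theorem crossMoment_act_right {f : Ω → Vec m} {g : Ω → Vec n} (hf : MemLp f 2 ν)
    (hg : MemLp g 2 ν) (A : Matrix (Fin k) (Fin n) ℝ) :
    crossMoment ν f (fun ω => act A (g ω)) = crossMoment ν f g * Aᵀ := by
  rw [← crossMoment_transpose, crossMoment_act_left hg hf, transpose_mul, crossMoment_transpose]

theorem crossMoment_act_self {f : Ω → Vec m} (hf : MemLp f 2 ν) (A : Matrix (Fin k) (Fin m) ℝ) :
    crossMoment ν (fun ω => act A (f ω)) (fun ω => act A (f ω)) =
      A * crossMoment ν f f * Aᵀ := by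
  rw [crossMoment_act_left hf (memLp_act hf A), crossMoment_act_right hf hf, Matrix.mul_assoc]

theorem crossMoment_add_self {f g : Ω → Vec m} (hf : MemLp f 2 ν) (hg : MemLp g 2 ν)
    (h : crossMoment ν f g = 0) :
    crossMoment ν (fun ω => f ω + g ω) (fun ω => f ω + g ω) =
      crossMoment ν f f + crossMoment ν g g := by
  have h' : crossMoment ν g f = 0 := by rw [← crossMoment_transpose, h, transpose_zero]
  have hfg : MemLp (fun ω => f ω + g ω) 2 ν := hf.add hg
  rw [crossMoment_add_left hf hg hfg, crossMoment_add_right hf hf hg,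
    crossMoment_add_right hg hf hg, h, h', add_zero, zero_add]

theorem crossMoment_map {T : Ω → Ω'} (hT : Measurable T) {f : Ω' → Vec m} {g : Ω' → Vec n}
    (hf : AEStronglyMeasurable f (ν.map T)) (hg : AEStronglyMeasurable g (ν.map T)) :
    crossMoment (ν.map T) f g = crossMoment ν (fun ω => f (T ω)) (fun ω => g (T ω)) := by
  ext i j
  simp only [crossMoment, of_apply]
  refine integral_map hT.aemeasurable ?_
  exact ((EuclideanSpace.proj (𝕜 := ℝ) i).continuous.comp_aestronglyMeasurable hf).mul
    ((EuclideanSpace.proj (𝕜 := ℝ) j).continuous.comp_aestronglyMeasurable hg)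

theorem integrable_inner_act {f : Ω → Vec m} {g : Ω → Vec n} (hf : MemLp f 2 ν)
    (hg : MemLp g 2 ν) (Q : Matrix (Fin m) (Fin n) ℝ) :
    Integrable (fun ω => inner ℝ (f ω) (act Q (g ω))) ν := by
  have h1 : ∀ ω, inner ℝ (f ω) (act Q (g ω)) = ∑ i, act Q (g ω) i * f ω i := fun ω => by
    simp [PiLp.inner_apply]
  simp only [h1]
  exact integrable_finsetSum _ fun i _ => integrable_mul_coord (memLp_act hg Q) hf i i

theorem integral_inner_act {f : Ω → Vec m} {g : Ω → Vec n} (hf : MemLp f 2 ν)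
    (hg : MemLp g 2 ν) (Q : Matrix (Fin m) (Fin n) ℝ) :
    ∫ ω, inner ℝ (f ω) (act Q (g ω)) ∂ν = (Q * crossMoment ν g f).trace := by
  have h1 : ∀ ω, inner ℝ (f ω) (act Q (g ω)) = ∑ i, act Q (g ω) i * f ω i := fun ω => by
    simp [PiLp.inner_apply]
  rw [← crossMoment_act_left hg hf]
  simp only [h1, trace, diag_apply, crossMoment, of_apply]
  exact integral_finsetSum _ fun i _ => integrable_mul_coord (memLp_act hg Q) hf i i

theorem integrable_quad {f : Ω → Vec m} (hf : MemLp f 2 ν) (Q : Matrix (Fin m) (Fin m) ℝ) :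
    Integrable (fun ω => quad Q (f ω)) ν :=
  integrable_inner_act hf hf Q

theorem integral_quad {f : Ω → Vec m} (hf : MemLp f 2 ν) (Q : Matrix (Fin m) (Fin m) ℝ) :
    ∫ ω, quad Q (f ω) ∂ν = (Q * crossMoment ν f f).trace :=
  integral_inner_act hf hf Q

theorem quad_one (x : Vec n) : quad 1 x = ‖x‖ ^ 2 := by
  rw [quad, act_one, real_inner_self_eq_norm_sq]

theorem quad_vecMulVec (a : Fin n → ℝ) (x : Vec n) :
    quad (vecMulVec a a) x = (a ⬝ᵥ x.ofLp) ^ 2 := by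
  rw [quad_eq_dotProduct, vecMulVec_mulVec]
  simp [dotProduct_smul, dotProduct_comm, sq]

/-- The quadratic form at x is E[(x·f)²], obtained from `integral_quad` with a rank-one weight. -/
theorem crossMoment_self_posSemidef {f : Ω → Vec m} (hf : MemLp f 2 ν) :
    (crossMoment ν f f).PosSemidef := by
  refine PosSemidef.of_dotProduct_mulVec_nonneg ?_ fun x => ?_
  · simp [IsHermitian, conjTranspose_eq_transpose_of_trivial, crossMoment_transpose]
  · have h := integral_quad hf (vecMulVec x x)
    have h0 : 0 ≤ ∫ ω, quad (vecMulVec x x) (f ω) ∂ν :=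
      integral_nonneg fun ω => by rw [quad_vecMulVec]; positivity
    rw [h, vecMulVec_mul, trace_vecMulVec] at h0
    rw [star_trivial, dotProduct_mulVec, dotProduct_comm]
    exact h0

end CrossMoment

/-! ### Kernel means and centred kernels. -/

section Center

variable {α : Type*} [MeasurableSpace α] {k n : ℕ}

/-- The mean of a kernel. -/
noncomputable def kernelMean (κ : Kernel α (Vec n)) (a : α) : Vec n := ∫ w, w ∂(κ a)

theorem measurable_kernelMean (κ : Kernel α (Vec n)) [IsSFiniteKernel κ] :
    Measurable (kernelMean κ) :=
  (StronglyMeasurable.integral_kernel (measurable_id.stronglyMeasurable)).measurable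

variable {ν : Measure α} [IsProbabilityMeasure ν] {κ : Kernel α (Vec n)} [IsMarkovKernel κ]

theorem memLp_fst_compProd {E : Type*} [NormedAddCommGroup E] {φ : α → E} {p : ℝ≥0∞}
    (hφ : MemLp φ p ν) : MemLp (fun q : α × Vec n => φ q.1) p (ν ⊗ₘ κ) := by
  have h : (ν ⊗ₘ κ).map Prod.fst = ν := Measure.fst_compProd ν κ
  rw [← h] at hφ
  exact hφ.comp_of_map measurable_fst.aemeasurable

/-- Jensen on each fibre: the squared mean is at most the second moment of `κ a`, and these
integrate to the second moment of the joint law. -/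
theorem memLp_kernelMean (hκ : MemLp (fun q : α × Vec n => q.2) 2 (ν ⊗ₘ κ)) :
    MemLp (kernelMean κ) 2 ν := by
  refine ⟨(measurable_kernelMean κ).aestronglyMeasurable, ?_⟩
  have h2 := hκ.2
  rw [eLpNorm_lt_top_iff_lintegral_rpow_enorm_lt_top two_ne_zero ENNReal.ofNat_ne_top] at h2 ⊢
  rw [ENNReal.toReal_ofNat] at h2 ⊢
  rw [Measure.lintegral_compProd (by fun_prop)] at h2
  refine lt_of_le_of_lt (lintegral_mono fun a => ?_) h2
  have h3 : ‖kernelMean κ a‖ₑ ≤ eLpNorm (fun w : Vec n => w) 2 (κ a) := by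
    calc ‖kernelMean κ a‖ₑ ≤ ∫⁻ w, ‖w‖ₑ ∂(κ a) := enorm_integral_le_lintegral_enorm _
      _ = eLpNorm (fun w : Vec n => w) 1 (κ a) := eLpNorm_one_eq_lintegral_enorm.symm
      _ ≤ _ := eLpNorm_le_eLpNorm_of_exponent_le one_le_two (by fun_prop)
  calc ‖kernelMean κ a‖ₑ ^ (2 : ℝ) ≤ (eLpNorm (fun w : Vec n => w) 2 (κ a)) ^ (2 : ℝ) := by
        gcongr
    _ = _ := by
        rw [eLpNorm_eq_lintegral_rpow_enorm_toReal two_ne_zero ENNReal.ofNat_ne_top]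
        rw [ENNReal.toReal_ofNat, ← ENNReal.rpow_mul]
        simp

theorem memLp_sub_kernelMean (hκ : MemLp (fun q : α × Vec n => q.2) 2 (ν ⊗ₘ κ)) :
    MemLp (fun q : α × Vec n => q.2 - kernelMean κ q.1) 2 (ν ⊗ₘ κ) :=
  hκ.sub (memLp_fst_compProd (memLp_kernelMean hκ))

theorem ae_integral_sub_kernelMean (hκ : MemLp (fun q : α × Vec n => q.2) 2 (ν ⊗ₘ κ)) :
    ∀ᵐ a ∂ν, ∀ j, ∫ w, (w j - kernelMean κ a j) ∂(κ a) = 0 := by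
  have hi := (Measure.integrable_compProd_iff hκ.1).1 (hκ.integrable one_le_two)
  filter_upwards [hi.1] with a ha j
  have hj : Integrable (fun w : Vec n => w j) (κ a) :=
    (EuclideanSpace.proj (𝕜 := ℝ) j).integrable_comp ha
  have h : ∫ w, w j ∂(κ a) = kernelMean κ a j :=
    (EuclideanSpace.proj (𝕜 := ℝ) j).integral_comp_comm ha
  rw [integral_sub hj (integrable_const _), integral_const]
  simp [h]

/-- The centred output of a kernel is uncorrelated with any function of its input. -/
theorem crossMoment_center (hκ : MemLp (fun q : α × Vec n => q.2) 2 (ν ⊗ₘ κ)) {φ : α → Vec k}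
    (hφ : MemLp φ 2 ν) :
    crossMoment (ν ⊗ₘ κ) (fun q => φ q.1) (fun q => q.2 - kernelMean κ q.1) = 0 := by
  ext i j
  have hint := integrable_mul_coord (memLp_fst_compProd (κ := κ) hφ) (memLp_sub_kernelMean hκ) i j
  simp only [crossMoment, of_apply, Matrix.zero_apply]
  rw [Measure.integral_compProd hint]
  refine integral_eq_zero_of_ae ?_
  filter_upwards [ae_integral_sub_kernelMean hκ] with a ha
  simp only [PiLp.sub_apply, Pi.zero_apply]
  rw [integral_const_mul, ha j, mul_zero]

theorem integral_inner_center (hκ : MemLp (fun q : α × Vec n => q.2) 2 (ν ⊗ₘ κ)) (r : Vec n) :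
    ∫ q, inner ℝ r (q.2 - kernelMean κ q.1) ∂(ν ⊗ₘ κ) = 0 := by
  have h := crossMoment_center hκ (memLp_const (μ := ν) r)
  have h2 := integral_inner_act (memLp_const (μ := ν ⊗ₘ κ) r) (memLp_sub_kernelMean hκ) 1
  simp only [act_one] at h2
  rw [h2, ← crossMoment_transpose, h]
  simp

end Center

theorem integrable_inner_const_left {Ω : Type*} [MeasurableSpace Ω] {ν : Measure Ω}
    [IsFiniteMeasure ν] {n : ℕ} {f : Ω → Vec n} (hf : MemLp f 2 ν) (r : Vec n) :
    Integrable (fun ω => inner ℝ r (f ω)) ν :=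
  (hf.integrable one_le_two).const_inner r

/-! ### Conditional means and expected conditional covariances. -/

namespace LQSystem

variable {nx nu ny t : ℕ}

section Conditional

variable (μ : ProbabilityMeasure (Info ny nu t × Vec nx))

/-- The expected conditional covariance of the state given the information vector. -/
noncomputable def errCov : Matrix (Fin nx) (Fin nx) ℝ :=
  crossMoment (μ : Measure (Info ny nu t × Vec nx)) (fun p => p.2 - condMean μ p.1)
    (fun p => p.2 - condMean μ p.1)

theorem infoLaw_compProd_posterior :
    infoLaw μ ⊗ₘ posterior μ = (μ : Measure (Info ny nu t × Vec nx)) :=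
  (μ : Measure (Info ny nu t × Vec nx)).disintegrate
    (μ : Measure (Info ny nu t × Vec nx)).condKernel

instance : IsProbabilityMeasure (infoLaw μ) := by
  unfold infoLaw; infer_instance

instance : IsMarkovKernel (posterior μ) := by
  unfold posterior; infer_instance

variable {μ}

theorem memLp_infoLaw {n : ℕ} {φ : Info ny nu t → Vec n} (hφm : Measurable φ)
    (hφ : MemLp (fun p => φ p.1) 2 (μ : Measure (Info ny nu t × Vec nx))) :
    MemLp φ 2 (infoLaw μ) :=
  (memLp_map_measure_iff hφm.aestronglyMeasurable measurable_fst.aemeasurable).2 hφ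

variable (hx : MemLp (fun p => p.2) 2 (μ : Measure (Info ny nu t × Vec nx)))

include hx

theorem memLp_snd_compProd :
    MemLp (fun p => p.2) 2 (infoLaw μ ⊗ₘ posterior μ) := by
  rwa [infoLaw_compProd_posterior]

theorem memLp_condMean :
    MemLp (fun p => condMean μ p.1) 2 (μ : Measure (Info ny nu t × Vec nx)) := by
  rw [← infoLaw_compProd_posterior μ]
  exact memLp_fst_compProd (memLp_kernelMean (memLp_snd_compProd hx))

theorem memLp_err :
    MemLp (fun p => p.2 - condMean μ p.1) 2 (μ : Measure (Info ny nu t × Vec nx)) :=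
  hx.sub (memLp_condMean hx)

theorem errCov_posSemidef : (errCov μ).PosSemidef :=
  crossMoment_self_posSemidef (memLp_err hx)

theorem crossMoment_err {n : ℕ} {φ : Info ny nu t → Vec n} (hφm : Measurable φ)
    (hφ : MemLp (fun p => φ p.1) 2 (μ : Measure (Info ny nu t × Vec nx))) :
    crossMoment (μ : Measure (Info ny nu t × Vec nx)) (fun p => φ p.1)
      (fun p => p.2 - condMean μ p.1) = 0 := by
  have h := crossMoment_center (memLp_snd_compProd hx) (memLp_infoLaw hφm hφ)
  rwa [infoLaw_compProd_posterior] at h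

/-- The estimation error is uncorrelated with the conditional mean, so second moments add. -/
theorem integral_quad_state (Q : Matrix (Fin nx) (Fin nx) ℝ) :
    ∫ p, quad Q p.2 ∂(μ : Measure (Info ny nu t × Vec nx)) =
      ∫ p, quad Q (condMean μ p.1) ∂(μ : Measure (Info ny nu t × Vec nx)) +
        (Q * errCov μ).trace := by
  have h := crossMoment_add_self (memLp_condMean hx) (memLp_err hx)
    (crossMoment_err hx (measurable_condMean μ) (memLp_condMean hx))
  simp only [add_sub_cancel] at h
  rw [integral_quad hx, integral_quad (memLp_condMean hx), h, Matrix.mul_add, trace_add, errCov]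

theorem integral_inner_state (r : Vec nx) :
    ∫ p, inner ℝ r p.2 ∂(μ : Measure (Info ny nu t × Vec nx)) =
      ∫ p, inner ℝ r (condMean μ p.1) ∂(μ : Measure (Info ny nu t × Vec nx)) := by
  have h := integral_inner_center (memLp_snd_compProd hx) r
  rw [infoLaw_compProd_posterior] at h
  simp only [inner_sub_right] at h
  change ∫ p, inner ℝ r p.2 - inner ℝ r (condMean μ p.1)
    ∂(μ : Measure (Info ny nu t × Vec nx)) = 0 at h
  rw [integral_sub (integrable_inner_const_left hx r)
    (integrable_inner_const_left (memLp_condMean hx) r)] at h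
  linarith

/-- The conditional mean is the best estimator in mean square. -/
theorem errCov_le {g : Info ny nu t → Vec nx} (hgm : Measurable g)
    (hg : MemLp (fun p => g p.1) 2 (μ : Measure (Info ny nu t × Vec nx))) :
    errCov μ ≤ crossMoment (μ : Measure (Info ny nu t × Vec nx)) (fun p => p.2 - g p.1)
      (fun p => p.2 - g p.1) := by
  have hd : MemLp (fun p => condMean μ p.1 - g p.1) 2 (μ : Measure (Info ny nu t × Vec nx)) :=
    (memLp_condMean hx).sub hg
  have h := crossMoment_add_self hd (memLp_err hx)
    (crossMoment_err hx ((measurable_condMean μ).sub hgm) hd)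
  have he : ∀ p : Info ny nu t × Vec nx,
      condMean μ p.1 - g p.1 + (p.2 - condMean μ p.1) = p.2 - g p.1 := fun p => by abel
  simp only [he] at h
  rw [h, ← errCov]
  exact le_add_of_nonneg_left (crossMoment_self_posSemidef hd).nonneg

end Conditional

/-! ### One transition: prediction, measurement, Kalman inequality. -/

section Step

variable (S : LQSystem nx nu ny) (f : CtrlAt ny nu t) (κ : DistAt nx ny nu t)
  (μ : ProbabilityMeasure (Info ny nu t × Vec nx))

instance : IsMarkovKernel κ.1 := κ.2

/-- The joint law of `((I_t, x_t), w_t)`. -/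
noncomputable def distLaw : Measure ((Info ny nu t × Vec nx) × Vec nx) :=
  (μ : Measure (Info ny nu t × Vec nx)) ⊗ₘ (Kernel.prodMkRight (Vec nx) κ.1)

instance : IsProbabilityMeasure (distLaw κ μ) := by
  unfold distLaw; infer_instance

/-- The expected conditional covariance of the disturbance given the information vector. -/
noncomputable def distCov : Matrix (Fin nx) (Fin nx) ℝ :=
  crossMoment (distLaw κ μ) (fun q => q.2 - kernelMean κ.1 q.1.1)
    (fun q => q.2 - kernelMean κ.1 q.1.1)

/-- The conditional mean of `x_{t+1}` given `I_t`. -/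
noncomputable def predMean (I : Info ny nu t) : Vec nx :=
  act S.A (condMean μ I) + act S.B (f.1 I) + kernelMean κ.1 I

theorem measurable_predMean : Measurable (S.predMean f κ μ) :=
  ((((measurable_act S.A).comp (measurable_condMean μ))).add
    ((measurable_act S.B).comp f.2)).add (measurable_kernelMean κ.1)

/-- The prediction error `A e_t + δ_t`. -/
noncomputable def predErr (q : (Info ny nu t × Vec nx) × Vec nx) : Vec nx :=
  act S.A (q.1.2 - condMean μ q.1.1) + (q.2 - kernelMean κ.1 q.1.1)

theorem stepMap_snd (q : ((Info ny nu t × Vec nx) × Vec nx) × Vec ny) :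
    (S.stepMap f q).2 = S.predMean f κ μ q.1.1.1 + S.predErr κ μ q.1 := by
  simp only [stepMap, predMean, predErr, map_sub]
  abel

theorem stepLaw_eq_map : (S.stepLaw f κ μ : Measure (Info ny nu (t + 1) × Vec nx)) =
    ((distLaw κ μ).prod S.noise).map (S.stepMap f) := rfl

variable {κ μ f} (hx : MemLp (fun p => p.2) 2 (μ : Measure (Info ny nu t × Vec nx)))
  (hw : MemLp (fun q => q.2) 2 (distLaw κ μ))
  (hu : MemLp (fun p => f.1 p.1) 2 (μ : Measure (Info ny nu t × Vec nx)))

theorem memLp_distLaw_fst {E : Type*} [NormedAddCommGroup E] {p : ℝ≥0∞}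
    {φ : Info ny nu t × Vec nx → E}
    (hφ : MemLp φ p (μ : Measure (Info ny nu t × Vec nx))) :
    MemLp (fun q => φ q.1) p (distLaw κ μ) :=
  memLp_fst_compProd hφ

include hw in
theorem memLp_distMean :
    MemLp (fun p => kernelMean κ.1 p.1) 2 (μ : Measure (Info ny nu t × Vec nx)) :=
  memLp_kernelMean (κ := Kernel.prodMkRight (Vec nx) κ.1) hw

include hw in
theorem memLp_distErr : MemLp (fun q => q.2 - kernelMean κ.1 q.1.1) 2 (distLaw κ μ) :=
  memLp_sub_kernelMean (κ := Kernel.prodMkRight (Vec nx) κ.1) hw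

include hw in
theorem distCov_posSemidef : (distCov κ μ).PosSemidef :=
  crossMoment_self_posSemidef (memLp_distErr hw)

include hw in
theorem crossMoment_distErr {n : ℕ} {φ : Info ny nu t × Vec nx → Vec n}
    (hφ : MemLp φ 2 (μ : Measure (Info ny nu t × Vec nx))) :
    crossMoment (distLaw κ μ) (fun q => φ q.1) (fun q => q.2 - kernelMean κ.1 q.1.1) = 0 :=
  crossMoment_center (κ := Kernel.prodMkRight (Vec nx) κ.1) hw hφ

theorem crossMoment_distLaw_fst {m n : ℕ} {φ : Info ny nu t × Vec nx → Vec m}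
    {ψ : Info ny nu t × Vec nx → Vec n}
    (hφ : MemLp φ 2 (μ : Measure (Info ny nu t × Vec nx)))
    (hψ : MemLp ψ 2 (μ : Measure (Info ny nu t × Vec nx))) :
    crossMoment (distLaw κ μ) (fun q => φ q.1) (fun q => ψ q.1) =
      crossMoment (μ : Measure (Info ny nu t × Vec nx)) φ ψ := by
  have h : (distLaw κ μ).map Prod.fst = (μ : Measure (Info ny nu t × Vec nx)) :=
    Measure.fst_compProd _ _
  rw [← crossMoment_map measurable_fst (h.symm ▸ hφ.1) (h.symm ▸ hψ.1), h]

theorem integral_distLaw_fst {φ : Info ny nu t × Vec nx → ℝ}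
    (hφ : AEStronglyMeasurable φ (μ : Measure (Info ny nu t × Vec nx))) :
    ∫ q, φ q.1 ∂(distLaw κ μ) = ∫ p, φ p ∂(μ : Measure (Info ny nu t × Vec nx)) := by
  have h : (distLaw κ μ).map Prod.fst = (μ : Measure (Info ny nu t × Vec nx)) :=
    Measure.fst_compProd _ _
  rw [← integral_map measurable_fst.aemeasurable (h.symm ▸ hφ), h]

include hx hw hu in
theorem memLp_predMean :
    MemLp (fun p => S.predMean f κ μ p.1) 2 (μ : Measure (Info ny nu t × Vec nx)) :=
  ((memLp_act (memLp_condMean hx) S.A).add (memLp_act hu S.B)).add (memLp_distMean hw)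

include hx hw in
theorem memLp_predErr : MemLp (S.predErr κ μ) 2 (distLaw κ μ) :=
  (memLp_act (memLp_distLaw_fst (memLp_err hx)) S.A).add (memLp_distErr hw)

include hx hw in
-- The filtering error is a function of (I_t, x_t), while the centred disturbance has mean zero
-- given (I_t, x_t); hence no cross term.
theorem crossMoment_predErr : crossMoment (distLaw κ μ) (S.predErr κ μ) (S.predErr κ μ) =
    S.A * errCov μ * S.Aᵀ + distCov κ μ := by
  have he := memLp_err hx
  have h1 := crossMoment_add_self (memLp_act (memLp_distLaw_fst (κ := κ) he) S.A)
    (memLp_distErr hw) (crossMoment_distErr hw (memLp_act he S.A))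
  rw [crossMoment_act_self (memLp_distLaw_fst (κ := κ) he), crossMoment_distLaw_fst he he] at h1
  exact h1

include hx hw in
theorem crossMoment_predMean_predErr {n : ℕ} {φ : Info ny nu t → Vec n} (hφm : Measurable φ)
    (hφ : MemLp (fun p => φ p.1) 2 (μ : Measure (Info ny nu t × Vec nx))) :
    crossMoment (distLaw κ μ) (fun q => φ q.1.1) (S.predErr κ μ) = 0 := by
  have he := memLp_err hx
  have h1 := crossMoment_add_right (memLp_distLaw_fst (κ := κ) hφ)
    (memLp_act (memLp_distLaw_fst (κ := κ) he) S.A) (memLp_distErr hw)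
  rw [crossMoment_act_right (memLp_distLaw_fst (κ := κ) hφ) (memLp_distLaw_fst (κ := κ) he),
    crossMoment_distLaw_fst hφ he, crossMoment_err hx hφm hφ, crossMoment_distErr hw hφ,
    Matrix.zero_mul, add_zero] at h1
  exact h1

include hx hw in
theorem integral_inner_predErr (r : Vec nx) :
    ∫ q, inner ℝ r (S.predErr κ μ q) ∂(distLaw κ μ) = 0 := by
  have h := S.crossMoment_predMean_predErr hx hw (κ := κ) (φ := fun _ => r) measurable_const
    (memLp_const r)
  have h2 := integral_inner_act (memLp_const (μ := distLaw κ μ) r) (S.memLp_predErr hx hw) 1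
  simp only [act_one] at h2
  rw [h2, ← crossMoment_transpose, h]
  simp

/-- The next state is square integrable. -/
theorem memLp_next (hx : MemLp (fun p => p.2) 2 (μ : Measure (Info ny nu t × Vec nx)))
    (hw : MemLp (fun q => q.2) 2 (distLaw κ μ))
    (hu : MemLp (fun p => f.1 p.1) 2 (μ : Measure (Info ny nu t × Vec nx))) :
    MemLp (fun q => S.predMean f κ μ q.1.1 + S.predErr κ μ q) 2 (distLaw κ μ) :=
  (memLp_distLaw_fst (S.memLp_predMean hx hw hu)).add (S.memLp_predErr hx hw)

/-- The output noise reaches only the information component, so it integrates out of the state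
marginal. -/
theorem map_stepLaw_snd : (S.stepLaw f κ μ : Measure (Info ny nu (t + 1) × Vec nx)).map Prod.snd =
    (distLaw κ μ).map fun q => S.predMean f κ μ q.1.1 + S.predErr κ μ q := by
  have hm : Measurable fun q : (Info ny nu t × Vec nx) × Vec nx =>
      S.predMean f κ μ q.1.1 + S.predErr κ μ q := by
    refine ((S.measurable_predMean f κ μ).comp (measurable_fst.comp measurable_fst)).add ?_
    refine ((measurable_act S.A).comp ?_).add ?_
    · exact (measurable_snd.comp measurable_fst).sub
        ((measurable_condMean μ).comp (measurable_fst.comp measurable_fst))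
    · exact measurable_snd.sub ((measurable_kernelMean κ.1).comp
        (measurable_fst.comp measurable_fst))
  have h : (fun q => (S.stepMap f q).2) =
      (fun q => S.predMean f κ μ q.1.1 + S.predErr κ μ q) ∘ Prod.fst (β := Vec ny) :=
    funext fun q => S.stepMap_snd f κ μ q
  rw [stepLaw_eq_map, Measure.map_map measurable_snd (S.measurable_stepMap f)]
  change Measure.map (fun q => (S.stepMap f q).2) _ = _
  rw [h, ← Measure.map_map hm measurable_fst, ← Measure.fst, Measure.fst_prod]

include hx hw hu in
theorem memLp_stepLaw : MemLp (fun p => p.2) 2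
    (S.stepLaw f κ μ : Measure (Info ny nu (t + 1) × Vec nx)) := by
  have h1 : MemLp id 2
      ((S.stepLaw f κ μ : Measure (Info ny nu (t + 1) × Vec nx)).map Prod.snd) := by
    rw [map_stepLaw_snd]
    have hn := S.memLp_next hx hw hu
    exact (memLp_map_measure_iff aestronglyMeasurable_id hn.1.aemeasurable).2 hn
  exact (memLp_map_measure_iff aestronglyMeasurable_id measurable_snd.aemeasurable).1 h1

theorem integral_stepLaw_snd (hx : MemLp (fun p => p.2) 2 (μ : Measure (Info ny nu t × Vec nx)))
    (hw : MemLp (fun q => q.2) 2 (distLaw κ μ))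
    (hu : MemLp (fun p => f.1 p.1) 2 (μ : Measure (Info ny nu t × Vec nx)))
    {F : Vec nx → ℝ} (hF : Continuous F) :
    ∫ p, F p.2 ∂(S.stepLaw f κ μ : Measure (Info ny nu (t + 1) × Vec nx)) =
      ∫ q, F (S.predMean f κ μ q.1.1 + S.predErr κ μ q) ∂(distLaw κ μ) := by
  have hn := S.memLp_next hx hw hu
  rw [← integral_map (φ := Prod.snd) measurable_snd.aemeasurable hF.aestronglyMeasurable,
    map_stepLaw_snd, integral_map hn.1.aemeasurable hF.aestronglyMeasurable]

theorem continuous_act {m n : ℕ} (A : Matrix (Fin m) (Fin n) ℝ) : Continuous (act A) :=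
  (act A).continuous_of_finiteDimensional

theorem continuous_quad {n : ℕ} (Q : Matrix (Fin n) (Fin n) ℝ) : Continuous (quad Q) :=
  continuous_id.inner (continuous_act Q)

include hx hw hu in
theorem integral_quad_stepLaw (Q : Matrix (Fin nx) (Fin nx) ℝ) :
    ∫ p, quad Q p.2 ∂(S.stepLaw f κ μ : Measure (Info ny nu (t + 1) × Vec nx)) =
      ∫ p, quad Q (S.predMean f κ μ p.1) ∂(μ : Measure (Info ny nu t × Vec nx)) +
        (Q * (S.A * errCov μ * S.Aᵀ + distCov κ μ)).trace := by
  have hp := S.memLp_predMean hx hw hu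
  have h := crossMoment_add_self (memLp_distLaw_fst (κ := κ) hp) (S.memLp_predErr hx hw)
    (S.crossMoment_predMean_predErr hx hw (S.measurable_predMean f κ μ) hp)
  rw [S.integral_stepLaw_snd hx hw hu (continuous_quad Q), integral_quad (S.memLp_next hx hw hu),
    h, S.crossMoment_predErr hx hw, crossMoment_distLaw_fst hp hp, Matrix.mul_add, trace_add,
    integral_quad hp]

include hx hw hu in
theorem integral_inner_stepLaw (r : Vec nx) :
    ∫ p, inner ℝ r p.2 ∂(S.stepLaw f κ μ : Measure (Info ny nu (t + 1) × Vec nx)) =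
      ∫ p, inner ℝ r (S.predMean f κ μ p.1) ∂(μ : Measure (Info ny nu t × Vec nx)) := by
  have hp := S.memLp_predMean hx hw hu
  have hi := integrable_inner_const_left hp r
  rw [S.integral_stepLaw_snd hx hw hu (F := fun x => inner ℝ r x) (by fun_prop)]
  simp only [inner_add_right]
  rw [integral_add (integrable_inner_const_left (memLp_distLaw_fst (κ := κ) hp) r)
    (integrable_inner_const_left (S.memLp_predErr hx hw) r), S.integral_inner_predErr hx hw,
    add_zero]
  exact integral_distLaw_fst hi.1

theorem memLp_noise : MemLp (fun v => v) 2 S.noise :=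
  IsGaussian.memLp_two_id (μ := multivariateGaussian 0 S.M)

theorem integral_noise_coord (j : Fin ny) : ∫ v, v j ∂S.noise = 0 := by
  have h : ∫ v, v j ∂S.noise = (∫ v, v ∂S.noise) j :=
    (EuclideanSpace.proj (𝕜 := ℝ) j).integral_comp_comm (S.memLp_noise.integrable one_le_two)
  rw [h, noise, integral_id_multivariateGaussian]
  rfl

theorem crossMoment_gaussian {n : ℕ} {M : Matrix (Fin n) (Fin n) ℝ} (hM : M.PosSemidef) :
    crossMoment (multivariateGaussian (0 : Vec n) M) (fun v => v) (fun v => v) = M := by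
  ext i j
  have h := covariance_eval_multivariateGaussian (μ := (0 : Vec n)) hM i j
  have h0 : ∀ j, ∫ v : Vec n, v j ∂(multivariateGaussian (0 : Vec n) M) = 0 := fun j => by
    have h : ∫ v, v j ∂(multivariateGaussian (0 : Vec n) M) =
        (∫ v, v ∂(multivariateGaussian (0 : Vec n) M)) j :=
      (EuclideanSpace.proj (𝕜 := ℝ) j).integral_comp_comm
        ((IsGaussian.memLp_two_id (μ := multivariateGaussian (0 : Vec n) M)).integrable one_le_two)
    rw [h, integral_id_multivariateGaussian]
    rfl
  rw [covariance, h0, h0] at h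
  simpa [crossMoment] using h

theorem crossMoment_prod_noise {m : ℕ} {φ : (Info ny nu t × Vec nx) × Vec nx → Vec m} :
    crossMoment ((distLaw κ μ).prod S.noise) (fun q => φ q.1) (fun q => q.2) = 0 := by
  ext i j
  simp only [crossMoment, of_apply, Matrix.zero_apply]
  rw [integral_prod_mul (fun q => φ q i) fun v : Vec ny => v j, integral_noise_coord, mul_zero]

include hx hw hu in
/-- The expected conditional covariance obeys the Kalman filter inequality. -/
theorem errCov_stepLaw_le (hM : S.M.PosDef) :
    errCov (S.stepLaw f κ μ) ≤ measUpd S.C S.M (S.A * errCov μ * S.Aᵀ + distCov κ μ) := by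
  have hXm : (S.A * errCov μ * S.Aᵀ + distCov κ μ).PosSemidef :=
    ((errCov_posSemidef hx).conj S.A).add (distCov_posSemidef hw)
  -- For each gain the corrected prediction `g` is a competitor of the conditional mean, and its
  -- error covariance is exactly the affine expression in the bound. Only second moments of the
  -- noise are used.
  refine le_measUpd_of_forall_gain hM hXm fun K => ?_
  -- Dropping the last output and control recovers I_t, so the competitor is a function of I_{t+1}
  -- alone.
  let prev : Info ny nu (t + 1) → Info ny nu t := fun I =>
    (Fin.init (α := fun _ => Vec ny) I.1, Fin.init (α := fun _ => Vec nu) I.2)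
  have hprev : Measurable prev := by
    refine Measurable.prodMk ?_ ?_
    · exact measurable_pi_iff.2 fun i => (measurable_pi_apply _).comp measurable_fst
    · exact measurable_pi_iff.2 fun i => (measurable_pi_apply _).comp measurable_snd
  let g : Info ny nu (t + 1) → Vec nx := fun I =>
    S.predMean f κ μ (prev I) + act K (I.1 (Fin.last _) - act S.C (S.predMean f κ μ (prev I)))
  have hgp : Measurable fun I => S.predMean f κ μ (prev I) :=
    (S.measurable_predMean f κ μ).comp hprev
  have hgm : Measurable g := hgp.add ((measurable_act K).comp
    (((measurable_pi_apply _).comp measurable_fst).sub ((measurable_act S.C).comp hgp)))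
  have hprev_step : ∀ q, prev (S.stepMap f q).1 = q.1.1.1 := by
    intro q
    simp [prev, stepMap, Info.extend, Fin.init_snoc]
  have hy_step : ∀ q, (S.stepMap f q).1.1 (Fin.last _) = act S.C (S.stepMap f q).2 + q.2 := by
    intro q
    simp [stepMap, Info.extend]
  have hg_step : ∀ q, g (S.stepMap f q).1 = S.predMean f κ μ q.1.1.1 +
      (act K (act S.C (S.predErr κ μ q.1)) + act K q.2) := by
    intro q
    simp only [g, hprev_step, hy_step]
    rw [S.stepMap_snd f κ μ, ← map_add (act K), map_add (act S.C)]
    congr 2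
    abel
  have herr_step : ∀ q, (S.stepMap f q).2 - g (S.stepMap f q).1 =
      act (1 - K * S.C) (S.predErr κ μ q.1) + act (-K) q.2 := by
    intro q
    rw [hg_step, S.stepMap_snd f κ μ, act_sub, act_one, act_mul, act_neg]
    abel
  have hfst : ∀ {n : ℕ} {φ : (Info ny nu t × Vec nx) × Vec nx → Vec n},
      MemLp φ 2 (distLaw κ μ) → MemLp (fun q => φ q.1) 2 ((distLaw κ μ).prod S.noise) :=
    fun hφ => hφ.comp_fst _
  have hsnd : MemLp (fun q => q.2) 2 ((distLaw κ μ).prod S.noise) :=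
    S.memLp_noise.comp_snd (distLaw κ μ)
  have hpe := S.memLp_predErr hx hw
  have hg : MemLp (fun p => g p.1) 2
      (S.stepLaw f κ μ : Measure (Info ny nu (t + 1) × Vec nx)) := by
    rw [stepLaw_eq_map]
    refine (memLp_map_measure_iff (f := S.stepMap f) (g := fun p => g p.1)
      (hgm.comp measurable_fst).aestronglyMeasurable (S.measurable_stepMap f).aemeasurable).2 ?_
    have h1 : ((fun p => g p.1) ∘ S.stepMap f) = fun q => S.predMean f κ μ q.1.1.1 +
      (act K (act S.C (S.predErr κ μ q.1)) + act K q.2) := funext hg_step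
    rw [h1]
    exact (hfst (memLp_distLaw_fst (S.memLp_predMean hx hw hu))).add
      ((memLp_act (memLp_act (hfst hpe) S.C) K).add (memLp_act hsnd K))
  refine (errCov_le (S.memLp_stepLaw hx hw hu) hgm hg).trans (le_of_eq ?_)
  rw [stepLaw_eq_map, crossMoment_map (S.measurable_stepMap f) (f := fun p => p.2 - g p.1)
    (g := fun p => p.2 - g p.1) (measurable_snd.sub (hgm.comp measurable_fst)).aestronglyMeasurable
    (measurable_snd.sub (hgm.comp measurable_fst)).aestronglyMeasurable]
  simp only [herr_step]
  have hz : crossMoment ((distLaw κ μ).prod S.noise)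
      (fun q => act (1 - K * S.C) (S.predErr κ μ q.1)) (fun q => act (-K) q.2) = 0 := by
    rw [crossMoment_act_right (memLp_act (hfst hpe) _) hsnd,
      S.crossMoment_prod_noise (φ := fun q => act (1 - K * S.C) (S.predErr κ μ q)),
      Matrix.zero_mul]
  rw [crossMoment_add_self (memLp_act (hfst hpe) _) (memLp_act hsnd _) hz,
    crossMoment_act_self (hfst hpe), crossMoment_act_self hsnd]
  have h1 : crossMoment ((distLaw κ μ).prod S.noise) (fun q => S.predErr κ μ q.1)
      (fun q => S.predErr κ μ q.1) = S.A * errCov μ * S.Aᵀ + distCov κ μ := by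
    have h : ((distLaw κ μ).prod S.noise).map Prod.fst = distLaw κ μ := Measure.fst_prod
    rw [← S.crossMoment_predErr hx hw, ← crossMoment_map measurable_fst (h.symm ▸ hpe.1)
      (h.symm ▸ hpe.1), h]
  have h2 : crossMoment ((distLaw κ μ).prod S.noise) (fun q => q.2) (fun q => q.2) = S.M := by
    have h : ((distLaw κ μ).prod S.noise).map Prod.snd = S.noise := Measure.snd_prod
    have h3 := crossMoment_map (ν := (distLaw κ μ).prod S.noise) measurable_snd
      (h.symm ▸ S.memLp_noise.1) (h.symm ▸ S.memLp_noise.1)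
    rw [h] at h3
    rw [← h3]
    exact crossMoment_gaussian hM.posSemidef
  rw [h1, h2]
  simp

end Step

end LQSystem

/-! ### Bookkeeping for sums of integrals. -/

section HasInt

variable {Ω Ω' : Type*} [MeasurableSpace Ω] [MeasurableSpace Ω'] {ν : Measure Ω} {f g : Ω → ℝ}
  {a b : ℝ}

/-- `f` is integrable with integral `a`. -/
def HasInt (ν : Measure Ω) (f : Ω → ℝ) (a : ℝ) : Prop := Integrable f ν ∧ ∫ ω, f ω ∂ν = a

theorem hasInt_of_integrable (hf : Integrable f ν) : HasInt ν f (∫ ω, f ω ∂ν) := ⟨hf, rfl⟩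

theorem HasInt.add (hf : HasInt ν f a) (hg : HasInt ν g b) :
    HasInt ν (fun ω => f ω + g ω) (a + b) :=
  ⟨hf.1.add hg.1, by rw [integral_add hf.1 hg.1, hf.2, hg.2]⟩

theorem HasInt.sub (hf : HasInt ν f a) (hg : HasInt ν g b) :
    HasInt ν (fun ω => f ω - g ω) (a - b) :=
  ⟨hf.1.sub hg.1, by rw [integral_sub hf.1 hg.1, hf.2, hg.2]⟩

theorem HasInt.const_mul (hf : HasInt ν f a) (c : ℝ) : HasInt ν (fun ω => c * f ω) (c * a) :=
  ⟨hf.1.const_mul c, by rw [integral_const_mul, hf.2]⟩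

theorem hasInt_const [IsProbabilityMeasure ν] (c : ℝ) : HasInt ν (fun _ => c) c :=
  ⟨integrable_const c, by simp⟩

theorem HasInt.mono (hf : HasInt ν f a) (hg : HasInt ν g b) (h : ∀ ω, f ω ≤ g ω) : a ≤ b := by
  rw [← hf.2, ← hg.2]
  exact integral_mono hf.1 hg.1 h

theorem HasInt.unique (hf : HasInt ν f a) (hg : HasInt ν g b) (h : ∀ ω, f ω = g ω) : a = b := by
  rw [← hf.2, ← hg.2]
  exact integral_congr_ae (Eventually.of_forall h)

theorem memLp_comp_of_map_eq {E : Type*} [NormedAddCommGroup E] {φ : Ω' → E} {p : ℝ≥0∞}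
    {T : Ω → Ω'} (hT : Measurable T) {μ : Measure Ω'} (h : ν.map T = μ) (hφ : MemLp φ p μ) :
    MemLp (fun ω => φ (T ω)) p ν := by
  subst h
  exact (memLp_map_measure_iff hφ.1 hT.aemeasurable).1 hφ

end HasInt

/-! ### Dual lower bounds for the Wasserstein distance. -/

section Wasserstein

variable {n : ℕ}

/-- Weighted Young inequality: the `Z`-form at a - Z⁻¹b is nonnegative. -/
theorem two_inner_le_quad_add_quad_inv {Z : Matrix (Fin n) (Fin n) ℝ} (hZ : Z.PosDef)
    (a b : Vec n) : 2 * inner ℝ a b ≤ quad Z a + quad Z⁻¹ b := by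
  have hu := (Matrix.isUnit_iff_isUnit_det _).1 hZ.isUnit
  have h := quad_nonneg hZ.posSemidef (a + -act Z⁻¹ b)
  rw [quad_add hZ.posSemidef.transpose_eq] at h
  have h1 : quad Z (-act Z⁻¹ b) = quad Z⁻¹ b := by
    rw [quad, map_neg, ← act_mul, mul_nonsing_inv _ hu, act_one, inner_neg_neg, quad,
      real_inner_comm]
  have h2 : inner ℝ (-act Z⁻¹ b) (act Z a) = -inner ℝ a b := by
    rw [inner_neg_left, inner_act, ← act_mul, hZ.posSemidef.transpose_eq, mul_nonsing_inv _ hu,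
      act_one, real_inner_comm]
  rw [h1, h2] at h
  linarith

theorem covMat_eq_crossMoment (p : Measure (Vec n)) :
    covMat p = crossMoment p (fun w => w - meanVec p) (fun w => w - meanVec p) := rfl

theorem integral_inner_sub_meanVec {p : Measure (Vec n)} [IsProbabilityMeasure p]
    (hp : MemLp id 2 p) (r : Vec n) : ∫ w, inner ℝ r (w - meanVec p) ∂p = 0 := by
  have hi : Integrable (fun w : Vec n => w) p := hp.integrable one_le_two
  have hi' : Integrable (fun w : Vec n => w - meanVec p) p := hi.sub (integrable_const _)
  rw [integral_inner (𝕜 := ℝ) hi', integral_sub hi (integrable_const _)]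
  simp [meanVec]

/-- A transport plan costs at least what the means and covariances prescribe. -/
theorem coupling_cost_ge {p q : Measure (Vec n)} [IsProbabilityMeasure p]
    [IsProbabilityMeasure q] (hp : MemLp id 2 p) (hq : MemLp id 2 q)
    {τ : Measure (Vec n × Vec n)} (h1 : τ.map Prod.fst = p) (h2 : τ.map Prod.snd = q)
    {Z : Matrix (Fin n) (Fin n) ℝ} (hZ : Z.PosDef) :
    ‖meanVec p - meanVec q‖ ^ 2 + ∫ w, quad (1 - Z) (w - meanVec p) ∂p + (covMat q).trace -
      (Z⁻¹ * covMat q).trace ≤ ∫ z, ‖z.1 - z.2‖ ^ 2 ∂τ := by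
  have hτ : IsProbabilityMeasure τ := by
    constructor
    rw [← Set.preimage_univ (f := Prod.fst), ← Measure.map_apply measurable_fst MeasurableSet.univ,
      h1, measure_univ]
  have hp' : MemLp (fun w => w - meanVec p) 2 p := hp.sub (memLp_const _)
  have hq' : MemLp (fun w => w - meanVec q) 2 q := hq.sub (memLp_const _)
  have ha : MemLp (fun z : Vec n × Vec n => z.1 - meanVec p) 2 τ :=
    memLp_comp_of_map_eq (φ := fun w => w - meanVec p) measurable_fst h1 hp'
  have hb : MemLp (fun z : Vec n × Vec n => z.2 - meanVec q) 2 τ :=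
    memLp_comp_of_map_eq (φ := fun w => w - meanVec q) measurable_snd h2 hq'
  have hd : MemLp (fun z : Vec n × Vec n => z.1 - z.2) 2 τ := by
    have := (ha.sub hb).add (memLp_const (meanVec p - meanVec q))
    refine this.ae_eq (Eventually.of_forall fun z => ?_)
    simp only [Pi.add_apply, Pi.sub_apply]
    abel
  set c := meanVec p - meanVec q with hc
  have hfst : ∀ F : Vec n → ℝ, Continuous F → ∫ z, F z.1 ∂τ = ∫ w, F w ∂p := fun F hF => by
    rw [← h1, integral_map measurable_fst.aemeasurable hF.aestronglyMeasurable]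
  have hsnd : ∀ F : Vec n → ℝ, Continuous F → ∫ z, F z.2 ∂τ = ∫ w, F w ∂q := fun F hF => by
    rw [← h2, integral_map measurable_snd.aemeasurable hF.aestronglyMeasurable]
  have hia := integrable_inner_const_left ha c
  have hib := integrable_inner_const_left hb c
  have hqa := integrable_quad ha (1 - Z)
  have hqb := integrable_quad hb (1 - Z⁻¹)
  have ea : ∫ z, inner ℝ c (z.1 - meanVec p) ∂τ = 0 := by
    rw [hfst (fun w => inner ℝ c (w - meanVec p)) (by fun_prop), integral_inner_sub_meanVec hp]
  have eb : ∫ z, inner ℝ c (z.2 - meanVec q) ∂τ = 0 := by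
    rw [hsnd (fun w => inner ℝ c (w - meanVec q)) (by fun_prop), integral_inner_sub_meanVec hq]
  have eqa : ∫ z, quad (1 - Z) (z.1 - meanVec p) ∂τ = ∫ w, quad (1 - Z) (w - meanVec p) ∂p :=
    hfst (fun w => quad (1 - Z) (w - meanVec p))
      ((LQSystem.continuous_quad _).comp (by fun_prop))
  have eqb : ∫ z, quad (1 - Z⁻¹) (z.2 - meanVec q) ∂τ =
      (covMat q).trace - (Z⁻¹ * covMat q).trace := by
    rw [hsnd (fun w => quad (1 - Z⁻¹) (w - meanVec q))
      ((LQSystem.continuous_quad _).comp (by fun_prop)), integral_quad hq', sub_mul, one_mul,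
      trace_sub]
    rfl
  -- The cost is expanded around the two means and the product of the centred parts is bounded with
  -- the weight `Z`. The bound separates the two marginals, and its linear terms integrate to zero.
  have hpt : ∀ z : Vec n × Vec n, ‖c‖ ^ 2 + 2 * inner ℝ c (z.1 - meanVec p) -
      2 * inner ℝ c (z.2 - meanVec q) + quad (1 - Z) (z.1 - meanVec p) +
      quad (1 - Z⁻¹) (z.2 - meanVec q) ≤ ‖z.1 - z.2‖ ^ 2 := by
    intro z
    have h := two_inner_le_quad_add_quad_inv hZ (z.1 - meanVec p) (z.2 - meanVec q)
    have he : z.1 - z.2 = c + ((z.1 - meanVec p) - (z.2 - meanVec q)) := by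
      rw [hc]
      abel
    have hs : ∀ (Y : Matrix (Fin n) (Fin n) ℝ) (x : Vec n), quad (1 - Y) x = ‖x‖ ^ 2 - quad Y x :=
      fun Y x => by
        rw [quad, act_sub, act_one, inner_sub_right, real_inner_self_eq_norm_sq, quad]
    rw [he, norm_add_sq_real, inner_sub_right c (z.1 - _) (z.2 - _),
      norm_sub_sq_real (z.1 - _) (z.2 - _), hs, hs]
    linarith
  have h := (((((hasInt_const (‖c‖ ^ 2)).add ((HasInt.const_mul ⟨hia, ea⟩ 2))).sub
    (HasInt.const_mul ⟨hib, eb⟩ 2)).add ⟨hqa, eqa⟩).add ⟨hqb, eqb⟩).mono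
    (hasInt_of_integrable (hd.integrable_norm_pow two_ne_zero)) hpt
  linarith

/-- Some plan has finite cost; under it the first coordinate is the square-integrable difference
plus the square-integrable second coordinate. -/
theorem memLp_of_wasserstein2_lt_top {p q : Measure (Vec n)} (hq : MemLp id 2 q)
    (h : wasserstein2 p q < ⊤) : MemLp id 2 p := by
  unfold wasserstein2 at h
  simp only [iInf_lt_iff] at h
  obtain ⟨τ, ⟨h1, h2⟩, hτ⟩ := h
  have hb : MemLp (fun z : Vec n × Vec n => z.2) 2 τ := by
    rw [← h2] at hq
    exact (memLp_map_measure_iff hq.1 measurable_snd.aemeasurable).1 hq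
  have hd : MemLp (fun z : Vec n × Vec n => z.1 - z.2) 2 τ := by
    refine ⟨by fun_prop, ?_⟩
    rw [eLpNorm_lt_top_iff_lintegral_rpow_enorm_lt_top two_ne_zero ENNReal.ofNat_ne_top]
    rw [ENNReal.rpow_lt_top_iff_of_pos (by norm_num)] at hτ
    simpa using hτ
  have ha : MemLp (fun z : Vec n × Vec n => z.1) 2 τ := by
    refine (hd.add hb).ae_eq (Eventually.of_forall fun z => ?_)
    simp
  rw [← h1]
  exact (memLp_map_measure_iff aestronglyMeasurable_id measurable_fst.aemeasurable).2 ha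

/-- The dual form of the Gelbrich bound on a Wasserstein ball. -/
theorem wasserstein2_ball_bound {p q : Measure (Vec n)} [IsProbabilityMeasure p]
    [IsProbabilityMeasure q] (hq : MemLp id 2 q) {θ : ℝ} (hθ : 0 ≤ θ)
    (h : wasserstein2 p q ≤ ENNReal.ofReal θ) {Z : Matrix (Fin n) (Fin n) ℝ} (hZ : Z.PosDef) :
    ‖meanVec p - meanVec q‖ ^ 2 + ∫ w, quad (1 - Z) (w - meanVec p) ∂p + (covMat q).trace -
      (Z⁻¹ * covMat q).trace ≤ θ ^ 2 := by
  have hp := memLp_of_wasserstein2_lt_top hq (h.trans_lt ENNReal.ofReal_lt_top)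
  set b := ‖meanVec p - meanVec q‖ ^ 2 + ∫ w, quad (1 - Z) (w - meanVec p) ∂p +
    (covMat q).trace - (Z⁻¹ * covMat q).trace with hb
  have hle : ENNReal.ofReal b ^ (1 / 2 : ℝ) ≤ wasserstein2 p q := by
    -- The bound holds for each plan, hence for the infimum; no optimal plan is needed.
    refine le_iInf₂ fun τ hτ => ?_
    refine ENNReal.rpow_le_rpow ?_ (by norm_num)
    have h1 := coupling_cost_ge hp hq hτ.1 hτ.2 hZ
    refine (ENNReal.ofReal_le_ofReal h1).trans ?_
    -- For a plan of infinite cost the Bochner integral defaults to 0, and the comparison is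
    -- trivial.
    by_cases hi : Integrable (fun z : Vec n × Vec n => ‖z.1 - z.2‖ ^ 2) τ
    · rw [ofReal_integral_eq_lintegral_ofReal hi (Eventually.of_forall fun z => by positivity)]
      refine le_of_eq (lintegral_congr fun z => ?_)
      rw [ENNReal.ofReal_pow (norm_nonneg _), ofReal_norm]
    · rw [integral_undef hi]
      simp
  have h2 := ENNReal.rpow_le_rpow (hle.trans h) (show (0 : ℝ) ≤ 2 by norm_num)
  rw [← ENNReal.rpow_mul, ENNReal.ofReal_rpow_of_nonneg hθ (by norm_num)] at h2
  norm_num at h2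
  exact (ENNReal.ofReal_le_ofReal_iff (by positivity)).1 h2

end Wasserstein

/-! ### The Bellman identity in expectation. -/

namespace LQSystem

variable {nx nu ny t : ℕ} (S : LQSystem nx nu ny)

/-- The expected value of the quadratic relative value function. -/
noncomputable def relValue (lam : ℝ) (P : Matrix (Fin nx) (Fin nx) ℝ)
    (μ : ProbabilityMeasure (Info ny nu t × Vec nx)) : ℝ :=
  ∫ p, quad P p.2 ∂(μ : Measure (Info ny nu t × Vec nx)) +
    2 * ∫ p, inner ℝ (S.rss lam P) p.2 ∂(μ : Measure (Info ny nu t × Vec nx))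

/-- The expected stage cost as a Bochner integral. -/
noncomputable def stageInt (f : CtrlAt ny nu t)
    (μ : ProbabilityMeasure (Info ny nu t × Vec nx)) : ℝ :=
  ∫ p, quad S.Q p.2 ∂(μ : Measure (Info ny nu t × Vec nx)) +
    ∫ p, quad S.R (f.1 p.1) ∂(μ : Measure (Info ny nu t × Vec nx))

variable {f : CtrlAt ny nu t} {κ : DistAt nx ny nu t}
  {μ : ProbabilityMeasure (Info ny nu t × Vec nx)}
  (hx : MemLp (fun p => p.2) 2 (μ : Measure (Info ny nu t × Vec nx)))
  (hw : MemLp (fun q => q.2) 2 (distLaw κ μ)) {lam : ℝ} {P : Matrix (Fin nx) (Fin nx) ℝ}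

include hx in
theorem memLp_ctrl (hf : ∀ I, f.1 I = S.ctrlAt lam P (condMean μ I)) :
    MemLp (fun p => f.1 p.1) 2 (μ : Measure (Info ny nu t × Vec nx)) := by
  simp only [hf]
  exact (memLp_act (memLp_condMean hx) _).add (memLp_const _)

include hx in
theorem memLp_distMeanAt :
    MemLp (fun p => S.distMeanAt lam P (condMean μ p.1)) 2
      (μ : Measure (Info ny nu t × Vec nx)) :=
  (memLp_act (memLp_condMean hx) _).add (memLp_const _)

include hx hw in
/-- The Bellman identity in expectation. -/
theorem bellman_identity (hQ : S.Q.PosSemidef) (hR : S.R.PosDef) (hlam : 0 < lam)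
    (hP : S.IsARESolution lam P) (hlamP : (lam • (1 : Matrix (Fin nx) (Fin nx) ℝ) - P).PosDef)
    (hPhi : (S.Phi lam).PosSemidef) (hobs : IsObservable S.A (CFC.sqrt S.Q))
    (hf : ∀ I, f.1 I = S.ctrlAt lam P (condMean μ I)) :
    S.stageInt f μ + S.relValue lam P (S.stepLaw f κ μ) - S.relValue lam P μ -
        lam * ∫ p, ‖kernelMean κ.1 p.1 - S.wHat‖ ^ 2 ∂(μ : Measure (Info ny nu t × Vec nx)) =
      S.meanValue lam P - ∫ p, quad (lam • 1 - P)
          (kernelMean κ.1 p.1 - S.distMeanAt lam P (condMean μ p.1))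
          ∂(μ : Measure (Info ny nu t × Vec nx)) +
        (S.Sss P * errCov μ).trace + (P * distCov κ μ).trace := by
  have hu := S.memLp_ctrl hx hf
  have hm := memLp_condMean hx
  have hp := S.memLp_predMean hx hw hu
  have hk := memLp_distMean hw
  have hkd : MemLp (fun p => kernelMean κ.1 p.1 - S.wHat) 2
    (μ : Measure (Info ny nu t × Vec nx)) := hk.sub (memLp_const _)
  have hke : MemLp (fun p => kernelMean κ.1 p.1 - S.distMeanAt lam P (condMean μ p.1)) 2
    (μ : Measure (Info ny nu t × Vec nx)) := hk.sub (S.memLp_distMeanAt hx)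
  -- The saddle identity at the conditional means of state and disturbance, integrated over the law
  -- of (I_t, x_t).
  have H := HasInt.unique
    ((((((hasInt_of_integrable (integrable_quad hm S.Q)).add
      (hasInt_of_integrable (integrable_quad hu S.R))).add
      ((hasInt_of_integrable (integrable_quad hp P)).add ((hasInt_of_integrable
        (integrable_inner_const_left hp (S.rss lam P))).const_mul 2)))).sub
      ((hasInt_of_integrable (integrable_quad hm P)).add ((hasInt_of_integrable
        (integrable_inner_const_left hm (S.rss lam P))).const_mul 2))).sub
      ((hasInt_of_integrable (hkd.integrable_norm_pow two_ne_zero)).const_mul lam))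
    ((hasInt_const (S.meanValue lam P)).sub
      (hasInt_of_integrable (integrable_quad hke (lam • 1 - P)))) (fun p => by
        have h := S.saddle_identity hQ hR hlam hP hlamP hPhi hobs (condMean μ p.1)
          (kernelMean κ.1 p.1)
        rw [← hf] at h
        exact h)
  rw [stageInt, relValue, relValue, integral_quad_state hx, integral_quad_state hx,
    integral_inner_state hx, S.integral_quad_stepLaw hx hw hu, S.integral_inner_stepLaw hx hw hu]
  -- The covariance parts of the stage cost, of the next value and of the present value collect into
  -- Q + AᵀPA - P.
  have hS : (S.Sss P * errCov μ).trace = (S.Q * errCov μ).trace +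
      (P * (S.A * errCov μ * S.Aᵀ)).trace - (P * errCov μ).trace := by
    rw [Sss, sub_mul, Matrix.add_mul, trace_sub, trace_add, Matrix.mul_assoc, Matrix.mul_assoc,
      trace_mul_comm S.Aᵀ, ← Matrix.mul_assoc, ← Matrix.mul_assoc, ← Matrix.mul_assoc]
  rw [hS, Matrix.mul_add, trace_add]
  linarith

end LQSystem

/-! ### Moment bounds uniform over the Wasserstein ball. -/

theorem posDef_half_one {n : ℕ} : ((1 / 2 : ℝ) • (1 : Matrix (Fin n) (Fin n) ℝ)).PosDef :=
  PosDef.one.smul (by norm_num)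

/-- Mean and variance bounds on a Wasserstein ball. -/
theorem wasserstein2_ball_moments {n : ℕ} {p q : Measure (Vec n)} [IsProbabilityMeasure p]
    [IsProbabilityMeasure q] (hq : MemLp id 2 q) {θ : ℝ} (hθ : 0 ≤ θ)
    (h : wasserstein2 p q ≤ ENNReal.ofReal θ) :
    ‖meanVec p - meanVec q‖ ^ 2 + 1 / 2 * ∫ w, ‖w - meanVec p‖ ^ 2 ∂p ≤
      θ ^ 2 + (covMat q).trace := by
  -- With Z = 1/2 half of the variance stays on the left with a positive sign, while Z⁻¹ = 2 costs
  -- one extra trace of the nominal covariance.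
  have hb := wasserstein2_ball_bound hq hθ h posDef_half_one
  have h1 : ((1 / 2 : ℝ) • (1 : Matrix (Fin n) (Fin n) ℝ))⁻¹ = (2 : ℝ) • 1 := by
    apply inv_eq_left_inv
    simp
  have h2 : (1 : Matrix (Fin n) (Fin n) ℝ) - (1 / 2 : ℝ) • 1 = (1 / 2 : ℝ) • 1 := by
    rw [sub_eq_iff_eq_add, ← add_smul]
    norm_num
  have h3 : ∀ w : Vec n, quad ((1 / 2 : ℝ) • (1 : Matrix (Fin n) (Fin n) ℝ)) w =
      1 / 2 * ‖w‖ ^ 2 := fun w => by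
    rw [quad, act_smul, act_one, inner_smul_right, real_inner_self_eq_norm_sq]
  rw [h1, h2] at hb
  simp only [h3] at hb
  rw [integral_const_mul, smul_mul_assoc, one_mul, trace_smul, smul_eq_mul] at hb
  linarith

namespace LQSystem

variable {nx nu ny t : ℕ} {κ : DistAt nx ny nu t} {q : Measure (Vec nx)} [IsProbabilityMeasure q]
  {θ : ℝ} (hq : MemLp id 2 q) (hθ : 0 ≤ θ)
  (hκ : ∀ I, wasserstein2 (κ.1 I) q ≤ ENNReal.ofReal θ)
  (μ : ProbabilityMeasure (Info ny nu t × Vec nx))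

include hq hθ hκ

theorem norm_kernelMean_sub_le (I : Info ny nu t) :
    ‖kernelMean κ.1 I - meanVec q‖ ^ 2 ≤ θ ^ 2 + (covMat q).trace := by
  have h := wasserstein2_ball_moments hq hθ (hκ I)
  have h2 : 0 ≤ ∫ w, ‖w - meanVec (κ.1 I)‖ ^ 2 ∂(κ.1 I) := by positivity
  have h3 : kernelMean κ.1 I = meanVec (κ.1 I) := rfl
  rw [h3]
  linarith

/-- Mean and variance of `κ I` are bounded uniformly in `I`, so the joint second moment is finite
whatever the law of the information vector. -/
theorem memLp_distLaw_of_ball : MemLp (fun q => q.2) 2 (distLaw κ μ) := by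
  set b := θ ^ 2 + (covMat q).trace with hb
  have hmm : Measurable fun z : (Info ny nu t × Vec nx) × Vec nx => kernelMean κ.1 z.1.1 :=
    (measurable_kernelMean κ.1).comp (measurable_fst.comp measurable_fst)
  have h1 : MemLp (fun z : (Info ny nu t × Vec nx) × Vec nx => kernelMean κ.1 z.1.1 - meanVec q)
      2 (distLaw κ μ) := by
    refine MemLp.of_bound (hmm.sub_const _).aestronglyMeasurable (Real.sqrt b)
      (Eventually.of_forall fun z => ?_)
    exact Real.le_sqrt_of_sq_le (norm_kernelMean_sub_le hq hθ hκ z.1.1)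
  have h2 : MemLp (fun z : (Info ny nu t × Vec nx) × Vec nx => z.2 - kernelMean κ.1 z.1.1)
      2 (distLaw κ μ) := by
    refine ⟨(measurable_snd.sub hmm).aestronglyMeasurable, ?_⟩
    rw [eLpNorm_lt_top_iff_lintegral_rpow_enorm_lt_top two_ne_zero ENNReal.ofNat_ne_top]
    have hme : Measurable fun z : (Info ny nu t × Vec nx) × Vec nx =>
        ‖z.2 - kernelMean κ.1 z.1.1‖ₑ ^ (2 : ℝ≥0∞).toReal :=
      (measurable_snd.sub hmm).enorm.pow_const _
    rw [distLaw, Measure.lintegral_compProd hme]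
    refine (lintegral_mono (g := fun _ => ENNReal.ofReal (2 * b)) fun a => ?_).trans_lt ?_
    · have hp := memLp_of_wasserstein2_lt_top hq ((hκ a.1).trans_lt ENNReal.ofReal_lt_top)
      have hp' : MemLp (fun w => w - meanVec (κ.1 a.1)) 2 (κ.1 a.1) := hp.sub (memLp_const _)
      have hi := hp'.integrable_norm_pow two_ne_zero
      have h := wasserstein2_ball_moments hq hθ (hκ a.1)
      have h4 : ∫ w, ‖w - meanVec (κ.1 a.1)‖ ^ 2 ∂(κ.1 a.1) ≤ 2 * b := by
        have := sq_nonneg ‖meanVec (κ.1 a.1) - meanVec q‖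
        linarith
      refine le_trans (le_of_eq ?_) (ENNReal.ofReal_le_ofReal h4)
      rw [ofReal_integral_eq_lintegral_ofReal hi (Eventually.of_forall fun z => by positivity)]
      refine lintegral_congr fun z => ?_
      rw [ENNReal.ofReal_pow (norm_nonneg _), ofReal_norm]
      simp [kernelMean, meanVec]
    · rw [lintegral_const, measure_univ, mul_one]
      exact ENNReal.ofReal_lt_top
  refine ((h2.add h1).add (memLp_const (meanVec q))).ae_eq (Eventually.of_forall fun z => ?_)
  simp

/-- The dual Gelbrich bound in expectation. -/
theorem integral_ball_bound {Z : Matrix (Fin nx) (Fin nx) ℝ} (hZ : Z.PosDef) :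
    ∫ p, ‖kernelMean κ.1 p.1 - meanVec q‖ ^ 2 ∂(μ : Measure (Info ny nu t × Vec nx)) +
      ((1 - Z) * distCov κ μ).trace + (covMat q).trace - (Z⁻¹ * covMat q).trace ≤ θ ^ 2 := by
  have hw := memLp_distLaw_of_ball hq hθ hκ μ
  have hd := memLp_distErr hw
  have hi := integrable_quad hd (1 - Z)
  have hm : MemLp (fun p => kernelMean κ.1 p.1 - meanVec q) 2
    (μ : Measure (Info ny nu t × Vec nx)) := (memLp_distMean hw).sub (memLp_const _)
  have hq2 := integral_quad hd (1 - Z)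
  rw [distLaw, Measure.integral_compProd hi] at hq2
  have H := (((((hasInt_of_integrable (hm.integrable_norm_pow two_ne_zero)).add
    ⟨Integrable.integral_compProd (a := ()) hi, hq2⟩).add (hasInt_const (covMat q).trace)).sub
    (hasInt_const (Z⁻¹ * covMat q).trace))).mono (hasInt_const (θ ^ 2))
    (fun p => wasserstein2_ball_bound hq hθ (hκ p.1) hZ)
  exact H

/-- The bound does not depend on `κ` or `μ`, hence is uniform in time along a trajectory when the
nominal covariance is constant: the input for the detectability estimate and for compactness of the
averages. -/
theorem trace_distCov_le : (distCov κ μ).trace ≤ 2 * (θ ^ 2 + (covMat q).trace) := by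
  have h := integral_ball_bound hq hθ hκ μ posDef_half_one
  have h1 : ((1 / 2 : ℝ) • (1 : Matrix (Fin nx) (Fin nx) ℝ))⁻¹ = (2 : ℝ) • 1 := by
    apply inv_eq_left_inv
    simp
  have h2 : (1 : Matrix (Fin nx) (Fin nx) ℝ) - (1 / 2 : ℝ) • 1 = (1 / 2 : ℝ) • 1 := by
    rw [sub_eq_iff_eq_add, ← add_smul]
    norm_num
  have h3 : 0 ≤ ∫ p, ‖kernelMean κ.1 p.1 - meanVec q‖ ^ 2
    ∂(μ : Measure (Info ny nu t × Vec nx)) := by positivity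
  rw [h1, h2] at h
  simp only [smul_mul_assoc, one_mul, trace_smul, smul_eq_mul] at h
  linarith

end LQSystem

/-! ### Time averages and the stationary covariance problem. -/

variable {n m : ℕ} {A : Matrix (Fin n) (Fin n) ℝ} {C : Matrix (Fin m) (Fin n) ℝ}
  {M : Matrix (Fin m) (Fin m) ℝ} {X D : ℕ → Matrix (Fin n) (Fin n) ℝ}

/-- The running average of a sequence of matrices. -/
noncomputable def runAvg (X : ℕ → Matrix (Fin n) (Fin n) ℝ) (T : ℕ) : Matrix (Fin n) (Fin n) ℝ :=
  (T : ℝ)⁻¹ • ∑ t ∈ Finset.range T, X t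

theorem runAvg_posSemidef (hX : ∀ k, (X k).PosSemidef) (T : ℕ) : (runAvg X T).PosSemidef :=
  (posSemidef_sum _ fun t _ => hX t).smul (by positivity)

theorem trace_mul_runAvg (W : Matrix (Fin n) (Fin n) ℝ) (T : ℕ) :
    (W * runAvg X T).trace = (T : ℝ)⁻¹ * ∑ t ∈ Finset.range T, (W * X t).trace := by
  rw [runAvg, mul_smul_comm, trace_smul, Finset.mul_sum, trace_sum, smul_eq_mul]

theorem tendsto_trace_mul {ι : Type*} {l : Filter ι} (W : Matrix (Fin n) (Fin n) ℝ)
    {f : ι → Matrix (Fin n) (Fin n) ℝ} {Y : Matrix (Fin n) (Fin n) ℝ}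
    (h : Tendsto f l (nhds Y)) :
    Tendsto (fun k => (W * f k).trace) l (nhds (W * Y).trace) := by
  have hc : Continuous fun Z : Matrix (Fin n) (Fin n) ℝ => (W * Z).trace := by fun_prop
  exact (hc.tendsto Y).comp h

theorem trace_runAvg_le {b : ℝ} (hb0 : 0 ≤ b) (hb : ∀ k, (X k).trace ≤ b) (T : ℕ) :
    (runAvg X T).trace ≤ b := by
  rcases Nat.eq_zero_or_pos T with rfl | hT
  · simpa [runAvg] using hb0
  have hT' : (0 : ℝ) < T := by exact_mod_cast hT
  have h := trace_mul_runAvg (X := X) 1 T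
  simp only [one_mul] at h
  rw [h, inv_mul_le_iff₀ hT']
  refine (Finset.sum_le_sum fun t _ => hb t).trans ?_
  simp

/-- Entries are bounded by the trace, so the sequence lives in a compact box. An ultrafilter makes
several sequences converge along the same times without successive subsequences. -/
theorem exists_ultrafilter_limit (hX : ∀ k, (X k).PosSemidef) {b : ℝ}
    (hb : ∀ k, (X k).trace ≤ b) (U : Ultrafilter ℕ) :
    ∃ Y, Y.PosSemidef ∧ Tendsto X U (nhds Y) := by
  have hcpt : IsCompact {Y : Matrix (Fin n) (Fin n) ℝ | ∀ i j, Y i j ∈ Set.Icc (-b) b} := by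
    have h1 : IsCompact (Set.univ.pi fun _ : Fin n => Set.univ.pi fun _ : Fin n =>
        Set.Icc (-b) b) := isCompact_univ_pi fun _ => isCompact_univ_pi fun _ => isCompact_Icc
    have h2 : {Y : Matrix (Fin n) (Fin n) ℝ | ∀ i j, Y i j ∈ Set.Icc (-b) b} =
        Set.univ.pi fun _ : Fin n => Set.univ.pi fun _ : Fin n => Set.Icc (-b) b := by
      ext Y
      exact ⟨fun h i _ j _ => h i j, fun h i j => h i trivial j trivial⟩
    rw [h2]
    exact h1
  obtain ⟨Y, -, hY⟩ := hcpt.ultrafilter_le_nhds (U.map X) (by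
    rw [le_principal_iff]
    refine Filter.mem_map.2 (Filter.univ_mem' fun k i j => ?_)
    exact abs_le.1 (((hX k).abs_entry_le_trace i j).trans (hb k)))
  exact ⟨Y, posSemidef_of_tendsto (l := (U : Filter ℕ)) hY hX, hY⟩

/-- The averages of a solution of the Riccati inequality almost satisfy the stationary one. -/
theorem runAvg_le_gain (hM : M.PosDef) (hX : ∀ k, (X k).PosSemidef) (hD : ∀ k, (D k).PosSemidef)
    (h : ∀ k, X (k + 1) ≤ measUpd C M (A * X k * Aᵀ + D k)) (K : Matrix (Fin n) (Fin m) ℝ) {T : ℕ}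
    (hT : 0 < T) :
    runAvg X T ≤ (T : ℝ)⁻¹ • X 0 +
      ((1 - K * C) * (A * runAvg X T * Aᵀ + runAvg D T) * (1 - K * C)ᵀ + K * M * Kᵀ) := by
  have hT' : (T : ℝ) ≠ 0 := by exact_mod_cast hT.ne'
  -- Shifting the sum by one index costs X 0 - X T, of which -X T may be dropped. The fixed gain `K`
  -- then makes the recursion affine, so it passes to averages.
  have h1 : ∑ t ∈ Finset.range T, X t ≤ X 0 + ∑ t ∈ Finset.range T, X (t + 1) := by
    rw [add_comm, ← Finset.sum_range_succ', Finset.sum_range_succ]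
    exact le_add_of_nonneg_right (hX T).nonneg
  have h2 : ∑ t ∈ Finset.range T, X (t + 1) ≤ ∑ t ∈ Finset.range T,
      ((1 - K * C) * (A * X t * Aᵀ + D t) * (1 - K * C)ᵀ + K * M * Kᵀ) :=
    Finset.sum_le_sum fun t _ => (h t).trans
      (measUpd_le_gain hM (((hX t).conj A).add (hD t)) K)
  have h3 : (T : ℝ)⁻¹ • ∑ t ∈ Finset.range T,
      ((1 - K * C) * (A * X t * Aᵀ + D t) * (1 - K * C)ᵀ + K * M * Kᵀ) =
      (1 - K * C) * (A * runAvg X T * Aᵀ + runAvg D T) * (1 - K * C)ᵀ + K * M * Kᵀ := by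
    rw [Finset.sum_add_distrib, Finset.sum_const, Finset.card_range, ← Finset.sum_mul,
      ← Finset.mul_sum, Finset.sum_add_distrib, ← Finset.sum_mul, ← Finset.mul_sum, runAvg, runAvg,
      smul_add, ← Nat.cast_smul_eq_nsmul ℝ, inv_smul_smul₀ hT']
    simp only [← smul_add, mul_smul_comm, smul_mul_assoc]
  have h4 := (h1.trans (add_le_add_right h2 (X 0)))
  have h5 : (T : ℝ)⁻¹ • ∑ t ∈ Finset.range T, X t ≤ (T : ℝ)⁻¹ • (X 0 + ∑ t ∈ Finset.range T,
      ((1 - K * C) * (A * X t * Aᵀ + D t) * (1 - K * C)ᵀ + K * M * Kᵀ)) := by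
    rw [Matrix.le_iff] at h4 ⊢
    rw [← smul_sub]
    exact h4.smul (by positivity)
  rw [smul_add, h3] at h5
  exact h5

/-- Averages of dissipated stage costs are asymptotically at most the stationary value. -/
theorem eventually_average_le (hdet : IsDetectable A C) (hM : M.PosDef)
    (hX : ∀ k, (X k).PosSemidef) (hD : ∀ k, (D k).PosSemidef) {d : ℝ}
    (hd : ∀ k, (D k).trace ≤ d) (h : ∀ k, X (k + 1) ≤ measUpd C M (A * X k * Aᵀ + D k))
    {W F Shat : Matrix (Fin n) (Fin n) ℝ} (hW : W.PosSemidef) (hShat : Shat.PosSemidef)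
    {lam : ℝ} (hlam : 0 < lam) {s V : ℕ → ℝ} {a b c : ℝ} (hV : ∀ t, -c ≤ V t)
    (hs : ∀ Z : Matrix (Fin n) (Fin n) ℝ, Z.PosDef → ∀ t, s t + V (t + 1) - V t ≤
      a + (W * X t).trace + ((F - lam • (1 - Z)) * D t).trace + lam * (Z⁻¹ * Shat).trace)
    (hopt : ∀ Y Sg : Matrix (Fin n) (Fin n) ℝ, Y.PosSemidef → Sg.PosSemidef →
      riccatiStep A C M Sg Y = Y → (W * Y + (F - lam • 1) * Sg +
        (2 * lam) • CFC.sqrt (CFC.sqrt Shat * Sg * CFC.sqrt Shat)).trace ≤ b)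
    {ε : ℝ} (hε : 0 < ε) :
    ∀ᶠ T : ℕ in atTop, (∑ t ∈ Finset.range T, s t) / T ≤ a + b + ε := by
  -- A violation recurring at arbitrarily large times supports an ultrafilter, along which the
  -- averages of `X` and `D` converge and the bound is contradicted.
  by_contra hcon
  rw [not_eventually] at hcon
  simp only [not_le] at hcon
  obtain ⟨bX, hbX⟩ := exists_trace_bound_of_detectable hdet hM hX hD hd h
  have hne : (atTop ⊓ 𝓟 {T : ℕ | a + b + ε < (∑ t ∈ Finset.range T, s t) / T}).NeBot :=
    frequently_mem_iff_neBot.1 hcon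
  set U := Ultrafilter.of (atTop ⊓ 𝓟 {T : ℕ | a + b + ε < (∑ t ∈ Finset.range T, s t) / T})
    with hU
  have hUle := Ultrafilter.of_le
    (atTop ⊓ 𝓟 {T : ℕ | a + b + ε < (∑ t ∈ Finset.range T, s t) / T})
  rw [← hU] at hUle
  have hUtop : (U : Filter ℕ) ≤ atTop := hUle.trans inf_le_left
  have hUbad : ∀ᶠ T : ℕ in U, a + b + ε < (∑ t ∈ Finset.range T, s t) / T :=
    (hUle.trans inf_le_right) (mem_principal_self _)
  have hinv : Tendsto (fun T : ℕ => (T : ℝ)⁻¹) U (nhds 0) :=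
    (tendsto_inv_atTop_nhds_zero_nat (𝕜 := ℝ)).mono_left hUtop
  obtain ⟨Xs, hXs, hXt⟩ := exists_ultrafilter_limit (runAvg_posSemidef hX)
    (trace_runAvg_le ((hX 0).trace_nonneg.trans (hbX 0)) hbX) U
  obtain ⟨Ds, hDs, hDt⟩ := exists_ultrafilter_limit (runAvg_posSemidef hD)
    (trace_runAvg_le ((hD 0).trace_nonneg.trans (hd 0)) hd) U
  have hXle : Xs ≤ riccatiStep A C M Ds Xs := by
    refine le_measUpd_of_forall_gain hM ((hXs.conj A).add hDs) fun K => ?_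
    have hg : Tendsto (fun T : ℕ => (T : ℝ)⁻¹ • X 0 +
      ((1 - K * C) * (A * runAvg X T * Aᵀ + runAvg D T) * (1 - K * C)ᵀ + K * M * Kᵀ)) U
      (nhds ((0 : ℝ) • X 0 +
      ((1 - K * C) * (A * Xs * Aᵀ + Ds) * (1 - K * C)ᵀ + K * M * Kᵀ))) := by
      have hc : Continuous fun z : ℝ × Matrix (Fin n) (Fin n) ℝ × Matrix (Fin n) (Fin n) ℝ =>
        z.1 • X 0 +
          ((1 - K * C) * (A * z.2.1 * Aᵀ + z.2.2) * (1 - K * C)ᵀ + K * M * Kᵀ) := by fun_prop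
      exact (hc.tendsto (0, Xs, Ds)).comp (hinv.prodMk_nhds (hXt.prodMk_nhds hDt))
    rw [zero_smul, zero_add] at hg
    refine le_of_tendsto_matrix hXt hg ?_
    filter_upwards [hUtop (eventually_gt_atTop 0)] with T hT
    exact runAvg_le_gain hM hX hD h K hT
  -- The limit is only a subsolution, hence perhaps not feasible. Since `W` is positive
  -- semidefinite, passing to the dominating solution with the same forcing `Ds` can only increase
  -- the objective.
  obtain ⟨Y, hY, hYf, hXY⟩ := exists_riccati_fixedPoint_ge hdet hM hDs hXs hXle
  have hb := hopt Y Ds hY hDs hYf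
  -- The certificate is chosen after the limit `Ds` is known, which is allowed because `hs` holds
  -- for all `Z`. After multiplication by `lam` the error is ε/2, leaving room for the
  -- contradiction.
  obtain ⟨Z, hZ, hZle⟩ := exists_posDef_fidelity_le hDs hShat
    (ε := ε / (2 * lam)) (by positivity)
  have hsum : ∀ T : ℕ, ∑ t ∈ Finset.range T, s t ≤ T * a + ∑ t ∈ Finset.range T, (W * X t).trace +
      ∑ t ∈ Finset.range T, ((F - lam • (1 - Z)) * D t).trace +
      T * (lam * (Z⁻¹ * Shat).trace) + (V 0 - V T) := by
    intro T
    induction T with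
    | zero => simp
    | succ T ih =>
      rw [Finset.sum_range_succ, Finset.sum_range_succ, Finset.sum_range_succ]
      have := hs Z hZ T
      push_cast
      linarith
  have havg : ∀ T : ℕ, 0 < T → (∑ t ∈ Finset.range T, s t) / T ≤ a + (W * runAvg X T).trace +
      ((F - lam • (1 - Z)) * runAvg D T).trace + lam * (Z⁻¹ * Shat).trace +
      (T : ℝ)⁻¹ * (V 0 + c) := by
    intro T hT
    have hT' : (0 : ℝ) < T := by exact_mod_cast hT
    rw [trace_mul_runAvg, trace_mul_runAvg, div_le_iff₀ hT']
    refine ((hsum T).trans ?_)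
    have hc := hV T
    have : (a + (T : ℝ)⁻¹ * ∑ t ∈ Finset.range T, (W * X t).trace +
      (T : ℝ)⁻¹ * ∑ t ∈ Finset.range T, ((F - lam • (1 - Z)) * D t).trace +
      lam * (Z⁻¹ * Shat).trace + (T : ℝ)⁻¹ * (V 0 + c)) * T = T * a +
      ∑ t ∈ Finset.range T, (W * X t).trace +
      ∑ t ∈ Finset.range T, ((F - lam • (1 - Z)) * D t).trace +
      T * (lam * (Z⁻¹ * Shat).trace) + (V 0 + c) := by
      field_simp
    rw [this]
    linarith
  have hlim : Tendsto (fun T : ℕ => a + (W * runAvg X T).trace +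
      ((F - lam • (1 - Z)) * runAvg D T).trace + lam * (Z⁻¹ * Shat).trace +
      (T : ℝ)⁻¹ * (V 0 + c)) U (nhds (a + (W * Xs).trace +
      ((F - lam • (1 - Z)) * Ds).trace + lam * (Z⁻¹ * Shat).trace + 0 * (V 0 + c))) :=
    (((tendsto_const_nhds.add (tendsto_trace_mul W hXt)).add
      (tendsto_trace_mul _ hDt)).add tendsto_const_nhds).add (hinv.mul_const _)
  have hfin : a + b + ε ≤ a + (W * Xs).trace + ((F - lam • (1 - Z)) * Ds).trace +
      lam * (Z⁻¹ * Shat).trace + 0 * (V 0 + c) := by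
    refine ge_of_tendsto hlim ?_
    filter_upwards [hUtop (eventually_gt_atTop 0), hUbad] with T hT hTbad
    exact hTbad.le.trans (havg T hT)
  have hWle := hW.trace_mul_le hXY
  have hF : ((F - lam • (1 - Z)) * Ds).trace = ((F - lam • 1) * Ds).trace +
      lam * (Ds * Z).trace := by
    rw [smul_sub, sub_sub_eq_add_sub, add_sub_right_comm, Matrix.add_mul, trace_add,
      smul_mul_assoc, trace_smul, smul_eq_mul, trace_mul_comm Z]
  rw [trace_add, trace_add, trace_smul, smul_eq_mul] at hb
  rw [hF, trace_mul_comm Z⁻¹] at hfin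
  have hZ2 := mul_le_mul_of_nonneg_left hZle hlam.le
  have he : lam * (ε / (2 * lam)) = ε / 2 := by field_simp
  rw [mul_add, mul_add, he] at hZ2
  linarith

theorem coe_sum_div_eq (s : ℕ → ℝ) (T : ℕ) :
    (∑ t ∈ Finset.range T, (s t : EReal)) / (T : EReal) =
      (((∑ t ∈ Finset.range T, s t) / T : ℝ) : EReal) := by
  have h : ∑ t ∈ Finset.range T, (s t : EReal) = ((∑ t ∈ Finset.range T, s t : ℝ) : EReal) := by
    induction T with
    | zero => simp
    | succ T ih => rw [Finset.sum_range_succ, Finset.sum_range_succ, ih, EReal.coe_add]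
  rw [h, EReal.coe_div, EReal.coe_natCast]

theorem limsup_coe_le {u : ℕ → ℝ} {b : ℝ} (h : ∀ ε > 0, ∀ᶠ T in atTop, u T ≤ b + ε) :
    limsup (fun T => (u T : EReal)) atTop ≤ (b : EReal) := by
  refine EReal.le_of_forall_lt_iff_le.1 fun z hz => ?_
  have hz' : b < z := EReal.coe_lt_coe_iff.1 hz
  refine limsup_le_of_le (by isBoundedDefault) ?_
  filter_upwards [h (z - b) (by linarith)] with T hT
  exact EReal.coe_le_coe_iff.2 (by linarith)

theorem le_limsup_coe {u : ℕ → ℝ} {b : ℝ} (h : ∀ ε > 0, ∀ᶠ T in atTop, b - ε ≤ u T) :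
    (b : EReal) ≤ limsup (fun T => (u T : EReal)) atTop := by
  refine EReal.ge_of_forall_gt_iff_ge.1 fun z hz => ?_
  have hz' : z < b := EReal.coe_lt_coe_iff.1 hz
  refine le_limsup_of_frequently_le (Eventually.frequently ?_) (by isBoundedDefault)
  filter_upwards [h (b - z) (by linarith)] with T hT
  exact EReal.coe_le_coe_iff.2 (by linarith)

theorem posSemidef_covMat {n : ℕ} {q : Measure (Vec n)} [IsProbabilityMeasure q]
    (hq : MemLp id 2 q) : (covMat q).PosSemidef := by
  rw [covMat_eq_crossMoment]
  exact crossMoment_self_posSemidef (hq.sub (memLp_const _))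

/-! ### The upper bound: guaranteed cost of the stationary controller. -/

namespace LQSystem

variable {nx nu ny : ℕ} (S : LQSystem nx nu ny)

theorem memLp_law0 (hinit : MemLp id 2 (S.initLaw : Measure (Vec nx))) :
    MemLp (fun p => p.2) 2 (S.law0 : Measure (Info ny nu 0 × Vec nx)) := by
  have h : MemLp (fun p : Vec nx × Vec ny => p.1) 2
      ((S.initLaw : Measure (Vec nx)).prod S.noise) := hinit.comp_fst _
  exact (memLp_map_measure_iff (f := S.initMap) (g := fun p => p.2)
    measurable_snd.aestronglyMeasurable S.measurable_initMap.aemeasurable).2 h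

variable {lam : ℝ} {P : Matrix (Fin nx) (Fin nx) ℝ} {γ : DistPolicy nx ny nu}

theorem memLp_ssCtrl {t : ℕ} {μ : ProbabilityMeasure (Info ny nu t × Vec nx)}
    (hx : MemLp (fun p => p.2) 2 (μ : Measure (Info ny nu t × Vec nx))) :
    MemLp (fun p => (S.ssCtrlAt lam P μ).1 p.1) 2 (μ : Measure (Info ny nu t × Vec nx)) :=
  S.memLp_ctrl (lam := lam) (P := P) hx fun _ => rfl

theorem memLp_ssLaw (hinit : MemLp id 2 (S.initLaw : Measure (Vec nx)))
    (hw : ∀ t, MemLp (fun p => p.2) 2 (S.ssLaw lam P γ t : Measure (Info ny nu t × Vec nx)) →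
      MemLp (fun q => q.2) 2 (distLaw (γ t) (S.ssLaw lam P γ t))) (t : ℕ) :
    MemLp (fun p => p.2) 2 (S.ssLaw lam P γ t : Measure (Info ny nu t × Vec nx)) := by
  induction t with
  | zero => exact S.memLp_law0 hinit
  | succ t ih => exact S.memLp_stepLaw ih (hw t ih) (S.memLp_ssCtrl ih)

theorem stageInt_nonneg {t : ℕ} {f : CtrlAt ny nu t}
    {μ : ProbabilityMeasure (Info ny nu t × Vec nx)} (hQ : S.Q.PosSemidef)
    (hR : S.R.PosSemidef) : 0 ≤ S.stageInt f μ :=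
  add_nonneg (integral_nonneg fun _ => quad_nonneg hQ _) (integral_nonneg fun _ => quad_nonneg hR _)

/-- Disintegration merges the iterated integral into one over the joint law, where nonnegativity and
square integrability make it a finite Bochner integral. -/
theorem stageCost_ssPolicy (hQ : S.Q.PosSemidef) (hR : S.R.PosSemidef) {t : ℕ}
    (hx : MemLp (fun p => p.2) 2 (S.ssLaw lam P γ t : Measure (Info ny nu t × Vec nx))) :
    S.stageCost (S.ssPolicy lam P γ) γ t =
      ENNReal.ofReal (S.stageInt (S.ssCtrlAt lam P (S.ssLaw lam P γ t)) (S.ssLaw lam P γ t)) := by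
  have hu := S.memLp_ssCtrl (lam := lam) (P := P) hx
  have hiQ := integrable_quad hx S.Q
  have hiR := integrable_quad hu S.R
  rw [stageCost, law_ssPolicy, ssPolicy]
  set μ := S.ssLaw lam P γ t
  set f := S.ssCtrlAt lam P μ
  have hm : Measurable fun p : Info ny nu t × Vec nx =>
      ENNReal.ofReal (quad S.Q p.2 + quad S.R (f.1 p.1)) :=
    (((continuous_quad S.Q).measurable.comp measurable_snd).add
      ((continuous_quad S.R).measurable.comp (f.2.comp measurable_fst))).ennreal_ofReal
  have h := ofReal_integral_eq_lintegral_ofReal (hiQ.add hiR) (Eventually.of_forall fun p =>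
    add_nonneg (quad_nonneg hQ _) (quad_nonneg hR _))
  rw [← Measure.lintegral_compProd hm, infoLaw_compProd_posterior, stageInt,
    ← integral_add hiQ hiR]
  exact h.symm

/-- Young's inequality with weight `P`, which is positive definite by observability where this is
applied. It keeps the telescoped end term -V_T from growing. -/
theorem relValue_ge (hP : P.PosDef) {t : ℕ} {μ : ProbabilityMeasure (Info ny nu t × Vec nx)}
    (hx : MemLp (fun p => p.2) 2 (μ : Measure (Info ny nu t × Vec nx))) :
    -quad P⁻¹ (-S.rss lam P) ≤ S.relValue lam P μ := by
  refine (hasInt_const (ν := (μ : Measure (Info ny nu t × Vec nx))) _).mono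
    ((hasInt_of_integrable (integrable_quad hx P)).add ((hasInt_of_integrable
      (integrable_inner_const_left hx (S.rss lam P))).const_mul 2)) fun p => ?_
  have h := two_inner_le_quad_add_quad_inv hP p.2 (-S.rss lam P)
  rw [inner_neg_right, real_inner_comm] at h
  linarith

/-- The stationary value of the penalized problem. -/
noncomputable def ssValue (lam : ℝ) (P X Sig : Matrix (Fin nx) (Fin nx) ℝ) : ℝ :=
  S.meanValue lam P - lam * S.SigHat.trace + S.covObjective lam P X Sig

/-- The stationary controller guarantees the cost `θ² λ + ssValue` on the Wasserstein ball. -/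
theorem avgCost_ssPolicy_le (hQ : S.Q.PosSemidef) (hR : S.R.PosDef) (hM : S.M.PosDef)
    (hinit : MemLp id 2 (S.initLaw : Measure (Vec nx)))
    (hnom : ∀ t, MemLp id 2 (S.nominal t : Measure (Vec nx)))
    (hmean : ∀ t, meanVec (S.nominal t : Measure (Vec nx)) = S.wHat)
    (hcov : ∀ t, covMat (S.nominal t : Measure (Vec nx)) = S.SigHat)
    {θ : ℝ} (hlam : 0 < lam) (hθ : 0 < θ) (hP : S.IsARESolution lam P)
    (hlamP : (lam • (1 : Matrix (Fin nx) (Fin nx) ℝ) - P).PosDef)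
    (hPhi : (S.Phi lam).PosSemidef) (hobs : IsObservable S.A (CFC.sqrt S.Q))
    {X Xm Sig : Matrix (Fin nx) (Fin nx) ℝ} (hopt : S.IsCovOptimal lam P X Xm Sig)
    (hdet : IsDetectable S.A S.C) (hγ : γ ∈ S.ambiguityPolicies θ) :
    S.avgCost (S.ssPolicy lam P γ) γ ≤ ((θ ^ 2 * lam + S.ssValue lam P X Sig : ℝ) : EReal) := by
  have hx := S.memLp_ssLaw (lam := lam) (P := P) (γ := γ) hinit
    fun t _ => memLp_distLaw_of_ball (hnom t) hθ.le (hγ t) _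
  have hw := fun t => memLp_distLaw_of_ball (hnom t) hθ.le (hγ t) (S.ssLaw lam P γ t)
  have hPd := S.posDef_of_isARESolution hQ hP hPhi hobs
  set s : ℕ → ℝ := fun t =>
    S.stageInt (S.ssCtrlAt lam P (S.ssLaw lam P γ t)) (S.ssLaw lam P γ t) with hs
  have hcost : ∀ t, (S.stageCost (S.ssPolicy lam P γ) γ t : EReal) = (s t : EReal) := fun t => by
    rw [S.stageCost_ssPolicy hQ hR.posSemidef (hx t), EReal.coe_ennreal_ofReal,
      max_eq_left (S.stageInt_nonneg hQ hR.posSemidef)]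
  rw [avgCost]
  simp only [hcost, coe_sum_div_eq]
  refine limsup_coe_le fun ε hε => ?_
  -- The constant `a` collects the mean value and the part λ(θ² - Tr Σ̂) of the ball bound that does
  -- not depend on the certificate.
  have hb := eventually_average_le (A := S.A) (C := S.C) (M := S.M) hdet hM
    (X := fun t => errCov (S.ssLaw lam P γ t)) (D := fun t => distCov (γ t) (S.ssLaw lam P γ t))
    (fun t => errCov_posSemidef (hx t)) (fun t => distCov_posSemidef (hw t))
    (d := 2 * (θ ^ 2 + S.SigHat.trace))
    (fun t => hcov t ▸ trace_distCov_le (hnom t) hθ.le (hγ t) _)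
    (fun t => S.errCov_stepLaw_le (hx t) (hw t) (S.memLp_ssCtrl (hx t)) hM)
    (S.posSemidef_Sss hP hPhi) (hcov 0 ▸ posSemidef_covMat (hnom 0)) hlam (s := s)
    (V := fun t => S.relValue lam P (S.ssLaw lam P γ t))
    (a := S.meanValue lam P + lam * (θ ^ 2 - S.SigHat.trace)) (b := S.covObjective lam P X Sig)
    (F := P) (fun t => S.relValue_ge hPd (hx t)) ?_ ?_ hε
  · filter_upwards [hb] with T hT
    refine hT.trans (le_of_eq ?_)
    rw [ssValue]
    ring
  · intro Z hZ t
    have h1 := S.bellman_identity (hx t) (hw t) hQ hR hlam hP hlamP hPhi hobs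
      (f := S.ssCtrlAt lam P (S.ssLaw lam P γ t)) fun _ => rfl
    have h2 := integral_ball_bound (hnom t) hθ.le (hγ t) (S.ssLaw lam P γ t) hZ
    rw [hmean t, hcov t] at h2
    -- Any deviation from the worst-case mean only lowers the penalized cost.
    have h3 : 0 ≤ ∫ p, quad (lam • 1 - P) (kernelMean (γ t).1 p.1 -
        S.distMeanAt lam P (condMean (S.ssLaw lam P γ t) p.1))
        ∂(S.ssLaw lam P γ t : Measure (Info ny nu t × Vec nx)) :=
      integral_nonneg fun _ => quad_nonneg hlamP.posSemidef _
    have h4 := mul_le_mul_of_nonneg_left h2 hlam.le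
    simp only [hs]
    rw [Matrix.sub_mul, trace_sub, smul_mul_assoc, trace_smul, smul_eq_mul]
    change _ + S.relValue lam P (S.stepLaw _ _ _) - _ ≤ _
    linarith
  · intro Y Sg hY hSg hYf
    exact hopt.2 Y (S.A * Y * S.Aᵀ + Sg) Sg
      ⟨hY, (hY.conj S.A).add hSg, hSg, rfl, hYf.symm⟩

end LQSystem

/-! ### Gaussian vectors and Gaussian conditioning. -/

section Gaussian

variable {m n : ℕ}

theorem charFun_gaussian {X : Matrix (Fin n) (Fin n) ℝ} (hX : X.PosSemidef) (x : Vec n) :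
    charFun (multivariateGaussian (0 : Vec n) X) x = Complex.exp (-(quad X x : ℂ) / 2) := by
  rw [charFun_multivariateGaussian hX, inner_zero_right, quad_eq_dotProduct]
  congr 1
  simp
  ring

/-- The characteristic functions of linear images of independent Gaussian vectors. -/
theorem integral_cexp_gaussian_prod {X : Matrix (Fin n) (Fin n) ℝ} {Y : Matrix (Fin m) (Fin m) ℝ}
    (hX : X.PosSemidef) (hY : Y.PosSemidef) (a : Vec n) (b : Vec m) :
    ∫ q : Vec n × Vec m, Complex.exp (((inner ℝ q.1 a + inner ℝ q.2 b : ℝ) : ℂ) * Complex.I)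
      ∂((multivariateGaussian (0 : Vec n) X).prod (multivariateGaussian (0 : Vec m) Y)) =
      Complex.exp (-((quad X a + quad Y b : ℝ) : ℂ) / 2) := by
  have h : ∀ q : Vec n × Vec m,
      Complex.exp (((inner ℝ q.1 a + inner ℝ q.2 b : ℝ) : ℂ) * Complex.I) =
      Complex.exp ((inner ℝ q.1 a : ℝ) * Complex.I) *
        Complex.exp ((inner ℝ q.2 b : ℝ) * Complex.I) := fun q => by
    rw [← Complex.exp_add]
    push_cast
    ring_nf
  simp only [h]
  rw [integral_prod_mul (fun q : Vec n => Complex.exp ((inner ℝ q a : ℝ) * Complex.I))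
    fun q : Vec m => Complex.exp ((inner ℝ q b : ℝ) * Complex.I), ← charFun_apply, ← charFun_apply,
    charFun_gaussian hX, charFun_gaussian hY, ← Complex.exp_add]
  congr 1
  push_cast
  ring

theorem inner_act_left {k : ℕ} (A : Matrix (Fin k) (Fin n) ℝ) (x : Vec n) (y : Vec k) :
    inner ℝ (act A x) y = inner ℝ x (act Aᵀ y) := by
  rw [inner_act, transpose_transpose]

theorem quad_act {k : ℕ} (Q : Matrix (Fin k) (Fin k) ℝ) (A : Matrix (Fin n) (Fin k) ℝ)
    (x : Vec n) : quad Q (act Aᵀ x) = quad (A * Q * Aᵀ) x := by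
  rw [quad, quad, inner_act_left, transpose_transpose, act_mul, act_mul]

/-- The law of `A e + ε` for independent Gaussian vectors. -/
theorem map_act_add_gaussian {X Y : Matrix (Fin n) (Fin n) ℝ}
    (hX : X.PosSemidef) (hY : Y.PosSemidef) (A : Matrix (Fin n) (Fin n) ℝ) :
    ((multivariateGaussian (0 : Vec n) X).prod (multivariateGaussian (0 : Vec n) Y)).map
      (fun q => act A q.1 + q.2) = multivariateGaussian 0 (A * X * Aᵀ + Y) := by
  have hm : Measurable fun q : Vec n × Vec n => act A q.1 + q.2 :=
    ((measurable_act A).comp measurable_fst).add measurable_snd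
  have : IsProbabilityMeasure (((multivariateGaussian (0 : Vec n) X).prod
    (multivariateGaussian (0 : Vec n) Y)).map (fun q => act A q.1 + q.2)) :=
    Measure.isProbabilityMeasure_map hm.aemeasurable
  refine Measure.ext_of_charFun (funext fun t => ?_)
  rw [charFun_gaussian ((hX.conj A).add hY), charFun_apply, integral_map hm.aemeasurable
    (by fun_prop)]
  simp only [inner_add_left, inner_act_left]
  rw [integral_cexp_gaussian_prod hX hY, quad_act]
  simp only [quad, act_add, inner_add_right]

/-- Gaussian conditioning: the filtered error is independent of the innovation. -/
theorem map_filter_gaussian {C : Matrix (Fin m) (Fin n) ℝ} {M : Matrix (Fin m) (Fin m) ℝ}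
    {X : Matrix (Fin n) (Fin n) ℝ} (hM : M.PosDef) (hX : X.PosSemidef) :
    ∃ K : Matrix (Fin n) (Fin m) ℝ,
      ((multivariateGaussian (0 : Vec n) X).prod (multivariateGaussian (0 : Vec m) M)).map
        (fun q => (act C q.1 + q.2, act (1 - K * C) q.1 + act (-K) q.2)) =
      (multivariateGaussian (0 : Vec m) (C * X * Cᵀ + M)).prod
        (multivariateGaussian (0 : Vec n) (measUpd C M X)) := by
  have hN := posDef_innovation (C := C) hM hX
  have hu := (Matrix.isUnit_iff_isUnit_det _).1 hN.isUnit
  set K := X * Cᵀ * (C * X * Cᵀ + M)⁻¹ with hK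
  -- With the Kalman gain the innovation and the filtered error are uncorrelated. Below this removes
  -- the mixed term of the joint characteristic function, which therefore factorizes and gives
  -- independence.
  have hcross : (1 - K * C) * X * Cᵀ = K * M := by
    have h1 : K * (C * X * Cᵀ + M) = X * Cᵀ := by
      rw [hK, nonsing_inv_mul_cancel_right _ _ hu]
    rw [Matrix.mul_add] at h1
    rw [Matrix.sub_mul, Matrix.sub_mul, Matrix.one_mul, ← h1]
    simp only [Matrix.mul_assoc]
    abel
  have hgain : (1 - K * C) * X * (1 - K * C)ᵀ + K * M * Kᵀ = measUpd C M X := by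
    rw [transpose_sub, transpose_one, Matrix.mul_sub, Matrix.mul_one, transpose_mul,
      ← Matrix.mul_assoc _ Cᵀ, hcross, sub_add_cancel, measUpd, hK, Matrix.sub_mul, Matrix.one_mul]
  refine ⟨K, ?_⟩
  have hm : Measurable fun q : Vec n × Vec m =>
      (act C q.1 + q.2, act (1 - K * C) q.1 + act (-K) q.2) :=
    (((measurable_act _).comp measurable_fst).add measurable_snd).prodMk
      (((measurable_act _).comp measurable_fst).add ((measurable_act _).comp measurable_snd))
  have : IsProbabilityMeasure (((multivariateGaussian (0 : Vec n) X).prod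
    (multivariateGaussian (0 : Vec m) M)).map
      fun q => (act C q.1 + q.2, act (1 - K * C) q.1 + act (-K) q.2)) :=
    Measure.isProbabilityMeasure_map hm.aemeasurable
  refine charFun_eq_prod_iff.1 fun t => ?_
  rw [charFun_gaussian hN.posSemidef, charFun_gaussian (measUpd_posSemidef hM hX),
    Measure.map_map (by fun_prop) hm, charFun_apply,
    integral_map ((by fun_prop : Measurable (WithLp.toLp 2)).comp hm).aemeasurable (by fun_prop)]
  set t1 := (WithLp.ofLp t).1
  set t2 := (WithLp.ofLp t).2
  have hin : ∀ q : Vec n × Vec m, inner ℝ ((WithLp.toLp 2 ∘ fun q : Vec n × Vec m =>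
      (act C q.1 + q.2, act (1 - K * C) q.1 + act (-K) q.2)) q) t =
      inner ℝ q.1 (act Cᵀ t1 + act (1 - K * C)ᵀ t2) + inner ℝ q.2 (t1 + act (-K)ᵀ t2) := fun q => by
    rw [WithLp.prod_inner_apply]
    simp only [Function.comp_apply]
    simp only [inner_add_left, inner_add_right, inner_act_left]
    ring
  simp only [hin]
  rw [integral_cexp_gaussian_prod hX hM.posSemidef, ← Complex.exp_add, ← hgain]
  congr 1
  have hz : inner ℝ (act (1 - K * C)ᵀ t2) (act X (act Cᵀ t1)) +
      inner ℝ (act (-K)ᵀ t2) (act M t1) = 0 := by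
    rw [inner_act_left, inner_act_left, transpose_transpose, transpose_transpose, ← act_mul,
      ← act_mul, ← act_mul, ← inner_add_right, Matrix.mul_assoc, ← Matrix.mul_assoc, hcross,
      Matrix.neg_mul, act_neg, add_neg_cancel, inner_zero_right]
  have hq : quad X (act Cᵀ t1 + act (1 - K * C)ᵀ t2) + quad M (t1 + act (-K)ᵀ t2) =
      quad (C * X * Cᵀ + M) t1 +
        quad ((1 - K * C) * X * (1 - K * C)ᵀ + K * M * Kᵀ) t2 := by
    rw [quad_add hX.transpose_eq, quad_add hM.posSemidef.transpose_eq, quad_act, quad_act, quad_act]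
    have h1 : -K * M * (-K)ᵀ = K * M * Kᵀ := by simp
    rw [h1]
    have h2 : ∀ (k : ℕ) (Y Z : Matrix (Fin k) (Fin k) ℝ) x, quad (Y + Z) x = quad Y x + quad Z x :=
      fun k Y Z x => by simp only [quad, act_add, inner_add_right]
    rw [h2, h2]
    linarith
  rw [hq]
  push_cast
  ring

end Gaussian

theorem multivariateGaussian_zero {n : ℕ} :
    multivariateGaussian (0 : Vec n) 0 = Measure.dirac 0 := by
  simp [multivariateGaussian]

/-! ### An invisible Gaussian component of the state. -/

namespace LQSystem

variable {nx nu ny t : ℕ} (S : LQSystem nx nu ny)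

/-- The state contains an independent centred Gaussian component of covariance `X`, invisible to
the information vector. -/
def HasGaussianPart (μ : ProbabilityMeasure (Info ny nu t × Vec nx))
    (X : Matrix (Fin nx) (Fin nx) ℝ) : Prop :=
  ∃ ν : Measure (Info ny nu t × Vec nx), IsProbabilityMeasure ν ∧
    (μ : Measure (Info ny nu t × Vec nx)) =
      (ν.prod (multivariateGaussian 0 X)).map fun q => (q.1.1, q.1.2 + q.2)

/-- The starting point of the induction: the initial law is arbitrary, so at time 0 only a
degenerate component is available. -/
theorem hasGaussianPart_zero (μ : ProbabilityMeasure (Info ny nu t × Vec nx)) :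
    HasGaussianPart μ 0 := by
  refine ⟨μ, inferInstance, ?_⟩
  rw [multivariateGaussian_zero, Measure.prod_dirac, Measure.map_map (by fun_prop) (by fun_prop)]
  have h : ((fun q : (Info ny nu t × Vec nx) × Vec nx => (q.1.1, q.1.2 + q.2)) ∘
      fun x : Info ny nu t × Vec nx => (x, (0 : Vec nx))) = id := by
    ext1 p
    simp
  rw [h, Measure.map_id]

theorem HasGaussianPart.lintegral {μ : ProbabilityMeasure (Info ny nu t × Vec nx)}
    {X : Matrix (Fin nx) (Fin nx) ℝ} {ν : Measure (Info ny nu t × Vec nx)}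
    (h : (μ : Measure (Info ny nu t × Vec nx)) =
      (ν.prod (multivariateGaussian 0 X)).map fun q => (q.1.1, q.1.2 + q.2))
    {F : Info ny nu t × Vec nx → ℝ≥0∞} (hF : Measurable F) :
    ∫⁻ p, F p ∂(μ : Measure (Info ny nu t × Vec nx)) =
      ∫⁻ p, ∫⁻ e, F (p.1, p.2 + e) ∂(multivariateGaussian 0 X) ∂ν := by
  rw [h, lintegral_map hF (by fun_prop), lintegral_prod _ (by fun_prop)]

/-- An independent Gaussian component bounds the estimation error from below. -/
theorem HasGaussianPart.le_errCov {μ : ProbabilityMeasure (Info ny nu t × Vec nx)}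
    {X : Matrix (Fin nx) (Fin nx) ℝ} (h : HasGaussianPart μ X) (hX : X.PosSemidef)
    (hx : MemLp (fun p => p.2) 2 (μ : Measure (Info ny nu t × Vec nx))) : X ≤ errCov μ := by
  obtain ⟨ν, hν, h⟩ := h
  have hmap : Measurable fun q : (Info ny nu t × Vec nx) × Vec nx => (q.1.1, q.1.2 + q.2) := by
    fun_prop
  have herr := memLp_err hx
  have hm : Measurable fun p : Info ny nu t × Vec nx => p.2 - condMean μ p.1 :=
    measurable_snd.sub ((measurable_condMean μ).comp measurable_fst)
  rw [errCov]
  have h1 : MemLp (fun q : (Info ny nu t × Vec nx) × Vec nx =>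
      q.1.2 + q.2 - condMean μ q.1.1) 2 (ν.prod (multivariateGaussian 0 X)) := by
    rw [h] at herr
    exact (memLp_map_measure_iff hm.aestronglyMeasurable hmap.aemeasurable).1 herr
  have h2 : MemLp (fun q : (Info ny nu t × Vec nx) × Vec nx => q.2) 2
      (ν.prod (multivariateGaussian 0 X)) :=
    MemLp.comp_snd (IsGaussian.memLp_two_id (μ := multivariateGaussian (0 : Vec nx) X)) ν
  have h3 : MemLp (fun q : (Info ny nu t × Vec nx) × Vec nx =>
      q.1.2 - condMean μ q.1.1) 2 (ν.prod (multivariateGaussian 0 X)) := by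
    refine (h1.sub h2).ae_eq (Eventually.of_forall fun q => ?_)
    simp only [Pi.sub_apply]
    abel
  -- The estimation error splits into a remainder and the hidden component; the latter is centred
  -- and independent of the former, so covariances add.
  have hcm : crossMoment (μ : Measure (Info ny nu t × Vec nx)) (fun p => p.2 - condMean μ p.1)
      (fun p => p.2 - condMean μ p.1) = crossMoment (ν.prod (multivariateGaussian 0 X))
      (fun q => (q.1.2 - condMean μ q.1.1) + q.2) (fun q => (q.1.2 - condMean μ q.1.1) + q.2) := by
    have he : ∀ q : (Info ny nu t × Vec nx) × Vec nx, q.1.2 - condMean μ q.1.1 + q.2 =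
        q.1.2 + q.2 - condMean μ q.1.1 := fun q => by abel
    simp only [he]
    conv_lhs => rw [h]
    exact crossMoment_map hmap hm.aestronglyMeasurable hm.aestronglyMeasurable
  have hz : crossMoment (ν.prod (multivariateGaussian 0 X))
      (fun q => q.1.2 - condMean μ q.1.1) (fun q => q.2) = 0 := by
    ext i j
    simp only [crossMoment, of_apply, Matrix.zero_apply]
    rw [integral_prod_mul (fun q : Info ny nu t × Vec nx => (q.2 - condMean μ q.1) i)
      fun v : Vec nx => v j]
    have h0 : ∫ v : Vec nx, v j ∂(multivariateGaussian (0 : Vec nx) X) = 0 := by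
      have h : ∫ v, v j ∂(multivariateGaussian (0 : Vec nx) X) =
          (∫ v, v ∂(multivariateGaussian (0 : Vec nx) X)) j :=
        (EuclideanSpace.proj (𝕜 := ℝ) j).integral_comp_comm
          ((IsGaussian.memLp_two_id
            (μ := multivariateGaussian (0 : Vec nx) X)).integrable one_le_two)
      rw [h, integral_id_multivariateGaussian]
      rfl
    rw [h0, mul_zero]
  have h4 : crossMoment (ν.prod (multivariateGaussian 0 X)) (fun q => q.2) (fun q => q.2) = X := by
    have hs : (ν.prod (multivariateGaussian 0 X)).map Prod.snd = multivariateGaussian 0 X :=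
      Measure.snd_prod
    have h3 := crossMoment_map (ν := ν.prod (multivariateGaussian (0 : Vec nx) X)) measurable_snd
      (f := fun v => v) (g := fun v => v) (by fun_prop) (by fun_prop)
    rw [hs] at h3
    rw [← h3]
    exact crossMoment_gaussian hX
  rw [hcm, crossMoment_add_self h3 h2 hz, h4]
  exact le_add_of_nonneg_left (crossMoment_self_posSemidef h3).nonneg

/-- The Gaussian component is propagated by the Kalman filter Riccati map when the disturbance is
Gaussian around a function of the information vector. -/
theorem HasGaussianPart.stepLaw {μ : ProbabilityMeasure (Info ny nu t × Vec nx)}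
    {X : Matrix (Fin nx) (Fin nx) ℝ} (h : HasGaussianPart μ X) (hX : X.PosSemidef)
    (hM : S.M.PosDef) {Sig : Matrix (Fin nx) (Fin nx) ℝ} (hSig : Sig.PosSemidef)
    (f : CtrlAt ny nu t) {κ : DistAt nx ny nu t} {m : Info ny nu t → Vec nx} (hm : Measurable m)
    (hκ : ∀ I, κ.1 I = (multivariateGaussian (0 : Vec nx) Sig).map fun e => m I + e) :
    HasGaussianPart (S.stepLaw f κ μ) (riccatiStep S.A S.C S.M Sig X) := by
  obtain ⟨ν, hν, h⟩ := h
  have hXm : (S.A * X * S.Aᵀ + Sig).PosSemidef := (hX.conj S.A).add hSig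
  obtain ⟨K, hK⟩ := map_filter_gaussian (C := S.C) hM hXm
  set N := S.C * (S.A * X * S.Aᵀ + Sig) * S.Cᵀ + S.M with hN
  set c : Info ny nu t × Vec nx → Vec nx := fun p => act S.A p.2 + act S.B (f.1 p.1) + m p.1
    with hc
  have hcm : Measurable c := (((measurable_act S.A).comp measurable_snd).add
    ((measurable_act S.B).comp (f.2.comp measurable_fst))).add (hm.comp measurable_fst)
  -- The new remainder, with the innovation `s` as second argument. The new output depends on the
  -- Gaussian variables only through `s`, and `K s` is the part of the prediction error that it
  -- reveals.
  set Θ : (Info ny nu t × Vec nx) × Vec ny → Info ny nu (t + 1) × Vec nx := fun q =>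
    (q.1.1.extend (act S.C (c q.1) + q.2) (f.1 q.1.1), c q.1 + act K q.2) with hΘ
  have hΘm : Measurable Θ := by
    refine Measurable.prodMk (measurable_extend.comp ((measurable_fst.comp measurable_fst).prodMk
      ((((measurable_act S.C).comp (hcm.comp measurable_fst)).add measurable_snd).prodMk
        (f.2.comp (measurable_fst.comp measurable_fst))))) ?_
    exact (hcm.comp measurable_fst).add ((measurable_act K).comp measurable_snd)
  refine ⟨(ν.prod (multivariateGaussian 0 N)).map Θ,
    Measure.isProbabilityMeasure_map hΘm.aemeasurable, ?_⟩
  refine Measure.ext_of_lintegral _ fun F hF => ?_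
  have hstep := S.measurable_stepMap f
  have hFs : Measurable fun q => F (S.stepMap f q) := hF.comp hstep
  have hR : ∫⁻ p, F p ∂(((ν.prod (multivariateGaussian 0 N)).map Θ).prod (multivariateGaussian 0
      (riccatiStep S.A S.C S.M Sig X))).map (fun q => (q.1.1, q.1.2 + q.2)) =
      ∫⁻ p, ∫⁻ s, ∫⁻ e, F ((Θ (p, s)).1, (Θ (p, s)).2 + e)
        ∂(multivariateGaussian 0 (riccatiStep S.A S.C S.M Sig X))
        ∂(multivariateGaussian 0 N) ∂ν := by
    have hF1 : Measurable fun q : (Info ny nu (t + 1) × Vec nx) × Vec nx =>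
      F (q.1.1, q.1.2 + q.2) := hF.comp (by fun_prop)
    rw [lintegral_map hF (by fun_prop), lintegral_prod _ hF1.aemeasurable,
      lintegral_map hF1.lintegral_prod_right' hΘm]
    exact lintegral_prod _ (hF1.lintegral_prod_right'.comp hΘm).aemeasurable
  have hL : ∫⁻ p, F p ∂(S.stepLaw f κ μ : Measure (Info ny nu (t + 1) × Vec nx)) =
      ∫⁻ p, ∫⁻ e, ∫⁻ w, ∫⁻ v, F (S.stepMap f (((p.1, p.2 + e), m p.1 + w), v))
        ∂S.noise ∂(multivariateGaussian 0 Sig) ∂(multivariateGaussian 0 X) ∂ν := by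
    have h1 : Measurable fun q : (Info ny nu t × Vec nx) × Vec nx =>
        ∫⁻ v, F (S.stepMap f (q, v)) ∂S.noise := hFs.lintegral_prod_right'
    have h2 : Measurable fun p : Info ny nu t × Vec nx =>
        ∫⁻ w, ∫⁻ v, F (S.stepMap f ((p, w), v)) ∂S.noise ∂(Kernel.prodMkRight (Vec nx) κ.1 p) :=
      h1.lintegral_kernel_prod_right'
    rw [stepLaw_eq_map, lintegral_map hF hstep, lintegral_prod _ hFs.aemeasurable, distLaw,
      Measure.lintegral_compProd h1, HasGaussianPart.lintegral h h2]
    refine lintegral_congr fun p => lintegral_congr fun e => ?_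
    rw [Kernel.prodMkRight_apply, hκ]
    exact lintegral_map (h1.comp measurable_prodMk_left) (measurable_const_add _)
  rw [hR, hL]
  refine lintegral_congr fun p => ?_
  -- For fixed `p` the hidden component and the new disturbance enter only through A e + w, again
  -- Gaussian, with the predicted covariance. The control and the disturbance mean depend on I_t
  -- only, so they do not see `e`.
  set Ψ : Vec nx × Vec ny → Info ny nu (t + 1) × Vec nx := fun q =>
    (p.1.extend (act S.C (c p + q.1) + q.2) (f.1 p.1), c p + q.1) with hΨ
  have hΨm : Measurable Ψ := by
    refine Measurable.prodMk (measurable_extend.comp (measurable_const.prodMk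
      ((((measurable_act S.C).comp (measurable_fst.const_add _)).add measurable_snd).prodMk
        measurable_const))) (measurable_fst.const_add _)
  have hFΨ : Measurable fun q => F (Ψ q) := hF.comp hΨm
  have h1 : ∀ e w v, S.stepMap f (((p.1, p.2 + e), m p.1 + w), v) = Ψ (act S.A e + w, v) := by
    intro e w v
    have : act S.A (p.2 + e) + act S.B (f.1 p.1) + (m p.1 + w) = c p + (act S.A e + w) := by
      have hcp : c p = act S.A p.2 + act S.B (f.1 p.1) + m p.1 := rfl
      rw [map_add, hcp]
      generalize act S.A p.2 = a1, act S.A e = a2, act S.B (f.1 p.1) = a3, m p.1 = a4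
      abel
    simp only [stepMap, hΨ, this]
  simp only [h1]
  have hg := map_act_add_gaussian hX hSig S.A
  have hgm : Measurable fun q : Vec nx × Vec nx => act S.A q.1 + q.2 :=
    ((measurable_act S.A).comp measurable_fst).add measurable_snd
  have hG : Measurable fun g : Vec nx => ∫⁻ v, F (Ψ (g, v)) ∂S.noise :=
    hFΨ.lintegral_prod_right'
  rw [← lintegral_prod (f := fun q : Vec nx × Vec nx =>
    ∫⁻ v, F (Ψ (act S.A q.1 + q.2, v)) ∂S.noise) (hG.comp hgm).aemeasurable,
    ← lintegral_map hG hgm, hg, ← lintegral_prod _ hFΨ.aemeasurable]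
  have hT : Measurable fun q : Vec nx × Vec ny =>
      (act S.C q.1 + q.2, act (1 - K * S.C) q.1 + act (-K) q.2) :=
    (((measurable_act _).comp measurable_fst).add measurable_snd).prodMk
      (((measurable_act _).comp measurable_fst).add ((measurable_act _).comp measurable_snd))
  have hH : Measurable fun z : Vec ny × Vec nx => F ((Θ (p, z.1)).1, (Θ (p, z.1)).2 + z.2) := by
    have h2 : Measurable fun z : Vec ny × Vec nx => Θ (p, z.1) :=
      hΘm.comp (measurable_const.prodMk measurable_fst)
    exact hF.comp ((measurable_fst.comp h2).prodMk ((measurable_snd.comp h2).add measurable_snd))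
  have h2 : ∀ q : Vec nx × Vec ny, F (Ψ q) = (fun z : Vec ny × Vec nx =>
      F ((Θ (p, z.1)).1, (Θ (p, z.1)).2 + z.2))
        (act S.C q.1 + q.2, act (1 - K * S.C) q.1 + act (-K) q.2) := by
    intro q
    simp only [hΨ, hΘ, map_add, act_sub, act_one, act_mul, act_neg]
    congr 2
    · congr 1
      abel
    · abel
  simp only [h2]
  -- Change of variables from (prediction error, noise) to the independent pair (innovation,
  -- filtered error).
  rw [noise, ← lintegral_map hH hT, hK, lintegral_prod _ hH.aemeasurable]
  rfl

end LQSystem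

/-! ### Gaussian disturbance kernels: moments and Gelbrich distance. -/

namespace LQSystem

variable {nx nu ny t : ℕ}

section GaussianDisturbance

variable {κ : DistAt nx ny nu t} {m : Info ny nu t → Vec nx} (hm : Measurable m)
  {Sig : Matrix (Fin nx) (Fin nx) ℝ} (hSig : Sig.PosSemidef)
  (hκ : ∀ I, κ.1 I = (multivariateGaussian (0 : Vec nx) Sig).map fun e => m I + e)
  (μ : ProbabilityMeasure (Info ny nu t × Vec nx))

theorem memLp_gaussian (Sig : Matrix (Fin nx) (Fin nx) ℝ) :
    MemLp (fun v => v) 2 (multivariateGaussian (0 : Vec nx) Sig) :=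
  IsGaussian.memLp_two_id (μ := multivariateGaussian (0 : Vec nx) Sig)

include hκ in
theorem kernelMean_gaussian (I : Info ny nu t) : kernelMean κ.1 I = m I := by
  rw [kernelMean, hκ, integral_map (by fun_prop) (by fun_prop),
    integral_add (integrable_const _) ((memLp_gaussian Sig).integrable one_le_two),
    integral_id_multivariateGaussian]
  simp

include hκ in
theorem memLp_id_gaussian (I : Info ny nu t) : MemLp id 2 (κ.1 I) := by
  rw [hκ]
  refine (memLp_map_measure_iff aestronglyMeasurable_id (by fun_prop)).2 ?_
  exact (memLp_const (m I)).add (memLp_gaussian Sig)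

include hκ hSig in
theorem covMat_gaussian (I : Info ny nu t) : covMat (κ.1 I) = Sig := by
  have h : meanVec (κ.1 I) = m I := kernelMean_gaussian hκ I
  rw [covMat_eq_crossMoment, h, hκ, crossMoment_map (by fun_prop) (by fun_prop) (by fun_prop)]
  simp only [add_sub_cancel_left]
  exact crossMoment_gaussian hSig

include hm hκ in
theorem distLaw_gaussian : distLaw κ μ =
    ((μ : Measure (Info ny nu t × Vec nx)).prod (multivariateGaussian 0 Sig)).map
      fun q => (q.1, m q.1.1 + q.2) := by
  have hT : Measurable fun q : (Info ny nu t × Vec nx) × Vec nx => (q.1, m q.1.1 + q.2) :=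
    measurable_fst.prodMk ((hm.comp (measurable_fst.comp measurable_fst)).add measurable_snd)
  refine Measure.ext_of_lintegral _ fun F hF => ?_
  have hFT : Measurable fun q : (Info ny nu t × Vec nx) × Vec nx => F (q.1, m q.1.1 + q.2) :=
    hF.comp hT
  rw [lintegral_map hF hT, lintegral_prod _ hFT.aemeasurable, distLaw,
    Measure.lintegral_compProd hF]
  refine lintegral_congr fun p => ?_
  rw [Kernel.prodMkRight_apply, hκ]
  exact lintegral_map (hF.comp measurable_prodMk_left) (measurable_const_add _)

include hm hκ in
theorem memLp_distLaw_gaussian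
    (hmL : MemLp (fun p => m p.1) 2 (μ : Measure (Info ny nu t × Vec nx))) :
    MemLp (fun q => q.2) 2 (distLaw κ μ) := by
  have hT : Measurable fun q : (Info ny nu t × Vec nx) × Vec nx => (q.1, m q.1.1 + q.2) :=
    measurable_fst.prodMk ((hm.comp (measurable_fst.comp measurable_fst)).add measurable_snd)
  rw [distLaw_gaussian hm hκ]
  refine (memLp_map_measure_iff (by fun_prop) hT.aemeasurable).2 ?_
  exact (hmL.comp_fst _).add ((memLp_gaussian Sig).comp_snd _)

include hm hκ hSig in
theorem distCov_gaussian : distCov κ μ = Sig := by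
  have hT : Measurable fun q : (Info ny nu t × Vec nx) × Vec nx => (q.1, m q.1.1 + q.2) :=
    measurable_fst.prodMk ((hm.comp (measurable_fst.comp measurable_fst)).add measurable_snd)
  have hd : Measurable fun q : (Info ny nu t × Vec nx) × Vec nx => q.2 - m q.1.1 :=
    measurable_snd.sub (hm.comp (measurable_fst.comp measurable_fst))
  rw [distCov]
  simp only [kernelMean_gaussian hκ]
  rw [distLaw_gaussian hm hκ, crossMoment_map hT hd.aestronglyMeasurable hd.aestronglyMeasurable]
  simp only [add_sub_cancel_left]
  have hs : ((μ : Measure (Info ny nu t × Vec nx)).prod (multivariateGaussian 0 Sig)).map Prod.snd =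
      multivariateGaussian 0 Sig := Measure.snd_prod
  have h3 := crossMoment_map (ν := (μ : Measure (Info ny nu t × Vec nx)).prod
    (multivariateGaussian (0 : Vec nx) Sig)) measurable_snd
    (f := fun v => v) (g := fun v => v) (by fun_prop) (by fun_prop)
  rw [hs] at h3
  rw [← h3]
  exact crossMoment_gaussian hSig

include hκ hSig in
theorem gelbrichSq_gaussian {q : Measure (Vec nx)} (hq : MemLp id 2 q) (I : Info ny nu t) :
    gelbrichSq (κ.1 I) q =
      ENNReal.ofReal (‖m I - meanVec q‖ ^ 2 + buresSq Sig (covMat q)) := by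
  rw [gelbrichSq, if_pos ⟨memLp_id_gaussian hκ I, hq⟩, covMat_gaussian hSig hκ]
  have h : meanVec (κ.1 I) = m I := kernelMean_gaussian hκ I
  rw [h]

end GaussianDisturbance

end LQSystem

/-! ### Quadratic and scalar inequalities for Lyapunov recursions. -/

section Quad

variable {n : ℕ}

theorem quad_le_quad {X Y : Matrix (Fin n) (Fin n) ℝ} (h : X ≤ Y) (x : Vec n) :
    quad X x ≤ quad Y x := by
  have h1 := quad_nonneg (Matrix.le_iff.1 h) x
  rw [quad, act_sub, inner_sub_right] at h1
  rw [quad, quad]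
  linarith

/-- The form is nonnegative at η a - g; dividing by η bounds the cross term. -/
theorem quad_add_le {W : Matrix (Fin n) (Fin n) ℝ} (hW : W.PosSemidef) {η : ℝ} (hη : 0 < η)
    (a g : Vec n) : quad W (a + g) ≤ (1 + η) * quad W a + (1 + η⁻¹) * quad W g := by
  have h := quad_nonneg hW (η • a + -g)
  rw [quad_add hW.transpose_eq] at h ⊢
  have h1 : quad W (η • a) = η * (η * quad W a) := by
    rw [quad, quad, map_smul, inner_smul_left, inner_smul_right]
    rfl
  have h2 : quad W (-g) = quad W g := by rw [quad, quad, map_neg, inner_neg_neg]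
  rw [h1, h2, inner_neg_left, map_smul, inner_smul_right] at h
  have h3 := mul_nonneg (inv_nonneg.2 hη.le) h
  have h4 : η⁻¹ * (η * (η * quad W a) + 2 * -(η * inner ℝ g (act W a)) + quad W g) =
      η * quad W a - 2 * inner ℝ g (act W a) + η⁻¹ * quad W g := by
    field_simp
    ring
  rw [h4] at h3
  linarith

theorem bounded_of_contraction {v : ℕ → ℝ} {q k : ℝ} (hq0 : 0 ≤ q) (hq : q < 1)
    (h : ∀ t, v (t + 1) ≤ q * v t + k) : ∃ b, ∀ t, v t ≤ b := by
  have h1 : 0 < 1 - q := by linarith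
  refine ⟨|v 0| + |k| / (1 - q), fun t => ?_⟩
  induction t with
  | zero => exact (le_abs_self _).trans (le_add_of_nonneg_right (by positivity))
  | succ t ih =>
    have h2 := mul_le_mul_of_nonneg_left ih hq0
    have h3 : |k| / (1 - q) * (1 - q) = |k| := div_mul_cancel₀ _ h1.ne'
    have h4 := le_abs_self k
    have h5 : q * |v 0| ≤ |v 0| := mul_le_of_le_one_left (abs_nonneg _) hq.le
    have h6 := h t
    linarith

end Quad

/-! ### The lower bound: value of the stationary pair. -/

namespace LQSystem

variable {nx nu ny t : ℕ} (S : LQSystem nx nu ny) {lam : ℝ}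
  {P Sig : Matrix (Fin nx) (Fin nx) ℝ}

theorem measurable_distMeanAt_condMean (μ : ProbabilityMeasure (Info ny nu t × Vec nx)) :
    Measurable fun I => S.distMeanAt lam P (condMean μ I) :=
  ((measurable_act _).comp (measurable_condMean μ)).add_const _

theorem ssDistAt_apply (μ : ProbabilityMeasure (Info ny nu t × Vec nx)) (I : Info ny nu t) :
    (S.ssDistAt lam P Sig μ).1 I = (multivariateGaussian (0 : Vec nx) Sig).map
      fun e => S.distMeanAt lam P (condMean μ I) + e := by
  have hm : Measurable fun p : Vec nx × Vec nx => p.1 + p.2 := measurable_fst.add measurable_snd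
  change Kernel.map _ _ I = _
  rw [Kernel.map_apply _ hm, Kernel.prod_apply, Kernel.deterministic_apply, Kernel.const_apply,
    Measure.dirac_prod, Measure.map_map hm (by fun_prop)]
  rfl

theorem memLp_ssDistAt {μ : ProbabilityMeasure (Info ny nu t × Vec nx)}
    (hx : MemLp (fun p => p.2) 2 (μ : Measure (Info ny nu t × Vec nx))) :
    MemLp (fun q => q.2) 2 (distLaw (S.ssDistAt lam P Sig μ) μ) :=
  memLp_distLaw_gaussian (S.measurable_distMeanAt_condMean μ) (S.ssDistAt_apply μ) μ
    (S.memLp_distMeanAt hx)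

theorem memLp_ssPairLaw (hinit : MemLp id 2 (S.initLaw : Measure (Vec nx))) (t : ℕ) :
    MemLp (fun p => p.2) 2 (S.ssPairLaw lam P Sig t : Measure (Info ny nu t × Vec nx)) := by
  induction t with
  | zero => exact S.memLp_law0 hinit
  | succ t ih => exact S.memLp_stepLaw ih (S.memLp_ssDistAt ih) (S.memLp_ssCtrl ih)

theorem hasGaussianPart_ssPairLaw (hM : S.M.PosDef) (hSig : Sig.PosSemidef) (t : ℕ) :
    HasGaussianPart (S.ssPairLaw lam P Sig t) ((riccatiStep S.A S.C S.M Sig)^[t] 0) := by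
  induction t with
  | zero => exact hasGaussianPart_zero _
  | succ t ih =>
    rw [Function.iterate_succ_apply']
    exact HasGaussianPart.stepLaw S ih
      (riccati_iterate_posSemidef (A := S.A) (C := S.C) hM hSig PosSemidef.zero t) hM hSig _
      (S.measurable_distMeanAt_condMean _) (S.ssDistAt_apply _)

theorem ssLaw_ssDist (t : ℕ) :
    S.ssLaw lam P (S.ssDist lam P Sig) t = S.ssPairLaw lam P Sig t := by
  rw [← law_ssPolicy, law_ssPair]

/-- The expected squared distance of the stationary disturbance mean from the nominal one. -/
noncomputable def meanShift (lam : ℝ) (P : Matrix (Fin nx) (Fin nx) ℝ)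
    (μ : ProbabilityMeasure (Info ny nu t × Vec nx)) : ℝ :=
  ∫ p, ‖S.distMeanAt lam P (condMean μ p.1) - S.wHat‖ ^ 2 ∂(μ : Measure (Info ny nu t × Vec nx))

/-- The disturbance covariance is constant in `I`, so only the mean part is averaged. Nonnegativity
of the Bures term ensures that `ENNReal.ofReal` truncates nothing. -/
theorem stageGelbrich_ssPair (hnom : ∀ t, MemLp id 2 (S.nominal t : Measure (Vec nx)))
    (hmean : ∀ t, meanVec (S.nominal t : Measure (Vec nx)) = S.wHat)
    (hcov : ∀ t, covMat (S.nominal t : Measure (Vec nx)) = S.SigHat)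
    (hinit : MemLp id 2 (S.initLaw : Measure (Vec nx))) (hSig : Sig.PosSemidef) (t : ℕ) :
    S.stageGelbrich (S.ssPolicy lam P (S.ssDist lam P Sig)) (S.ssDist lam P Sig) t =
      ENNReal.ofReal (S.meanShift lam P (S.ssPairLaw lam P Sig t) + buresSq Sig S.SigHat) := by
  rw [stageGelbrich, law_ssPair, ssDist]
  have hx := S.memLp_ssPairLaw (lam := lam) (P := P) (Sig := Sig) hinit t
  set μ := S.ssPairLaw lam P Sig t
  simp only [gelbrichSq_gaussian hSig (S.ssDistAt_apply μ) (hnom t), hmean, hcov]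
  have hmd : MemLp (fun p => S.distMeanAt lam P (condMean μ p.1) - S.wHat) 2
    (μ : Measure (Info ny nu t × Vec nx)) := (S.memLp_distMeanAt hx).sub (memLp_const _)
  have hi := hmd.integrable_norm_pow two_ne_zero
  have hm : Measurable fun I : Info ny nu t => ENNReal.ofReal
      (‖S.distMeanAt lam P (condMean μ I) - S.wHat‖ ^ 2 + buresSq Sig S.SigHat) :=
    ((((S.measurable_distMeanAt_condMean μ).sub_const _).norm.pow_const 2).add_const
      _).ennreal_ofReal
  have hb := buresSq_nonneg hSig (hcov 0 ▸ posSemidef_covMat (hnom 0))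
  rw [infoLaw, Measure.fst, lintegral_map hm measurable_fst]
  have h := ofReal_integral_eq_lintegral_ofReal (hi.add (integrable_const (buresSq Sig S.SigHat)))
    (Eventually.of_forall fun p => add_nonneg (by positivity) hb)
  refine h.symm.trans ?_
  congr 1
  refine (integral_add hi (integrable_const _)).trans ?_
  simp [meanShift]

/-- The second moment of the state stays bounded under the stationary pair of policies. -/
theorem exists_bound_integral_norm_sq (hQ : S.Q.PosSemidef) (hM : S.M.PosDef)
    (hinit : MemLp id 2 (S.initLaw : Measure (Vec nx))) (hlam : 0 < lam)
    (hP : S.IsARESolution lam P) (hlamP : (lam • (1 : Matrix (Fin nx) (Fin nx) ℝ) - P).PosDef)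
    (hPhi : (S.Phi lam).PosSemidef) (hobs : IsObservable S.A (CFC.sqrt S.Q))
    (hdet : IsDetectable S.A S.C) (hSig : Sig.PosSemidef) :
    ∃ b, ∀ t, ∫ p, ‖p.2‖ ^ 2 ∂(S.ssPairLaw lam P Sig t : Measure (Info ny nu t × Vec nx)) ≤ b := by
  have hx := S.memLp_ssPairLaw (lam := lam) (P := P) (Sig := Sig) hinit
  have hw := fun t => S.memLp_ssDistAt (lam := lam) (P := P) (Sig := Sig) (hx t)
  have hX := fun t => errCov_posSemidef (hx t)
  have hD : ∀ t, distCov (S.ssDistAt lam P Sig (S.ssPairLaw lam P Sig t))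
      (S.ssPairLaw lam P Sig t) = Sig := fun t =>
    distCov_gaussian (S.measurable_distMeanAt_condMean _) hSig (S.ssDistAt_apply _) _
  obtain ⟨bX, hbX⟩ := exists_trace_bound_of_detectable (Sg := fun _ => Sig) hdet hM hX
    (fun _ => hSig) (fun _ => le_rfl) (fun t => by
      have h := S.errCov_stepLaw_le (hx t) (hw t) (S.memLp_ssCtrl (lam := lam) (P := P) (hx t)) hM
      rwa [hD] at h)
  obtain ⟨g, hg⟩ := S.exists_closed_loop hlam hP hlamP hPhi
  obtain ⟨W, c, hW, hW1, hc0, hc1, hWc⟩ :=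
    (S.isSchurStable_closedA hQ hP hPhi hobs).exists_lyapunov
  -- Chosen so that (1 + η)c = (1 + c)/2: the affine term uses up half of the gap between `c` and 1.
  set η := (1 - c) / (2 * c) with hη
  have hη0 : 0 < η := div_pos (by linarith) (by linarith)
  have hηc : (1 + η) * c = (1 + c) / 2 := by
    rw [hη]
    field_simp
    ring
  obtain ⟨bT, hbT⟩ : ∃ b, ∀ t, (W * (S.A * errCov (S.ssPairLaw lam P Sig t) * S.Aᵀ)).trace ≤ b := by
    have hB : (S.Aᵀ * W * S.A).PosSemidef := hW.posSemidef.conj' S.A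
    refine ⟨(∑ i, ∑ j, |(S.Aᵀ * W * S.A) i j|) * bX, fun t => ?_⟩
    have h1 : (W * (S.A * errCov (S.ssPairLaw lam P Sig t) * S.Aᵀ)).trace =
        (S.Aᵀ * W * S.A * errCov (S.ssPairLaw lam P Sig t)).trace := by
      rw [← Matrix.mul_assoc, trace_mul_comm, ← Matrix.mul_assoc, ← Matrix.mul_assoc]
    rw [h1]
    have h2 := (hX t).trace_mul_le (le_sum_abs_smul_one hB.transpose_eq)
    rw [trace_mul_comm, mul_smul_comm, Matrix.mul_one, trace_smul, smul_eq_mul] at h2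
    exact h2.trans (mul_le_mul_of_nonneg_left (hbX t)
      (Finset.sum_nonneg fun i _ => Finset.sum_nonneg fun j _ => abs_nonneg _))
  set v : ℕ → ℝ := fun t =>
    ∫ p, quad W p.2 ∂(S.ssPairLaw lam P Sig t : Measure (Info ny nu t × Vec nx)) with hv
  -- The conditional mean follows the stable closed loop with the constant drift `g`, while the
  -- error and disturbance covariances contribute a bounded amount.
  have hrec : ∀ t, v (t + 1) ≤ (1 + c) / 2 * v t +
      ((1 + η⁻¹) * quad W g + (bT + (W * Sig).trace)) := by
    intro t
    have hu := S.memLp_ssCtrl (lam := lam) (P := P) (hx t)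
    have h1 := S.integral_quad_stepLaw (hx t) (hw t) hu W
    rw [hD, Matrix.mul_add, trace_add] at h1
    have h2 := hbT t
    have hm := memLp_condMean (hx t)
    have h3 : ∀ p : Info ny nu t × Vec nx, quad W (S.predMean
        (S.ssCtrlAt lam P (S.ssPairLaw lam P Sig t)) (S.ssDistAt lam P Sig (S.ssPairLaw lam P Sig t))
        (S.ssPairLaw lam P Sig t) p.1) ≤
        (1 + c) / 2 * quad W (condMean (S.ssPairLaw lam P Sig t) p.1) +
          (1 + η⁻¹) * quad W g := by
      intro p
      have h4 : S.predMean
        (S.ssCtrlAt lam P (S.ssPairLaw lam P Sig t)) (S.ssDistAt lam P Sig (S.ssPairLaw lam P Sig t))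
        (S.ssPairLaw lam P Sig t) p.1 =
          act (S.closedA lam P) (condMean (S.ssPairLaw lam P Sig t) p.1) + g := by
        rw [← hg, predMean, kernelMean_gaussian (S.ssDistAt_apply _)]
        rfl
      rw [h4]
      refine (quad_add_le hW.posSemidef hη0 _ _).trans ?_
      have h5 := quad_le_quad hWc (condMean (S.ssPairLaw lam P Sig t) p.1)
      have h6 := quad_act W (S.closedA lam P)ᵀ (condMean (S.ssPairLaw lam P Sig t) p.1)
      rw [transpose_transpose] at h6
      rw [← h6] at h5
      have h7 : quad (c • W) (condMean (S.ssPairLaw lam P Sig t) p.1) =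
          c * quad W (condMean (S.ssPairLaw lam P Sig t) p.1) := by
        rw [quad, act_smul, inner_smul_right, quad]
      rw [h7] at h5
      rw [← hηc]
      have h8 := mul_le_mul_of_nonneg_left h5 (by linarith : 0 ≤ 1 + η)
      linarith
    have h9 := (hasInt_of_integrable (integrable_quad (S.memLp_predMean (hx t) (hw t) hu) W)).mono
      (((hasInt_of_integrable (integrable_quad hm W)).const_mul ((1 + c) / 2)).add
        (hasInt_const _)) h3
    have h10 := integral_quad_state (hx t) W
    have h11 := hW.posSemidef.trace_mul_nonneg (hX t)
    have h12 : ∫ p, quad W (condMean (S.ssPairLaw lam P Sig t) p.1)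
        ∂(S.ssPairLaw lam P Sig t : Measure (Info ny nu t × Vec nx)) ≤ v t := by
      simp only [hv]
      linarith
    have h13 := mul_le_mul_of_nonneg_left h12 (by linarith : 0 ≤ (1 + c) / 2)
    have h14 : v (t + 1) = _ := h1
    linarith
  obtain ⟨b, hb⟩ := bounded_of_contraction (by linarith) (by linarith) hrec
  refine ⟨b, fun t => le_trans ?_ (hb t)⟩
  refine integral_mono ((hx t).integrable_norm_pow two_ne_zero) (integrable_quad (hx t) W)
    fun p => ?_
  have h := quad_le_quad hW1 p.2
  rwa [quad_one] at h

/-- From P ≤ λI and 2⟨r, x⟩ ≤ ‖r‖² + ‖x‖². With bounded second moments it bounds V_T above, so V_0 -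
V_T cannot spoil the lower estimate. -/
theorem relValue_le
    (hlamP : (lam • (1 : Matrix (Fin nx) (Fin nx) ℝ) - P).PosDef)
    {μ : ProbabilityMeasure (Info ny nu t × Vec nx)}
    (hx : MemLp (fun p => p.2) 2 (μ : Measure (Info ny nu t × Vec nx))) :
    S.relValue lam P μ ≤ (lam + 1) * ∫ p, ‖p.2‖ ^ 2 ∂(μ : Measure (Info ny nu t × Vec nx)) +
      ‖S.rss lam P‖ ^ 2 := by
  refine ((hasInt_of_integrable (integrable_quad hx P)).add ((hasInt_of_integrable
    (integrable_inner_const_left hx (S.rss lam P))).const_mul 2)).mono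
    (((hasInt_of_integrable (hx.integrable_norm_pow two_ne_zero)).const_mul (lam + 1)).add
      (hasInt_const _)) fun p => ?_
  have h1 := quad_le_quad (Matrix.le_iff.2 hlamP.posSemidef) p.2
  rw [quad, quad, act_smul, act_one, inner_smul_right, real_inner_self_eq_norm_sq] at h1
  have h2 := real_inner_le_norm (S.rss lam P) p.2
  have h3 := sq_nonneg (‖S.rss lam P‖ - ‖p.2‖)
  rw [quad]
  nlinarith

/-- The stationary pair of policies attains at least the stationary value. -/
theorem ssValue_le_rho (hQ : S.Q.PosSemidef) (hR : S.R.PosDef) (hM : S.M.PosDef)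
    (hinit : MemLp id 2 (S.initLaw : Measure (Vec nx)))
    (hnom : ∀ t, MemLp id 2 (S.nominal t : Measure (Vec nx)))
    (hmean : ∀ t, meanVec (S.nominal t : Measure (Vec nx)) = S.wHat)
    (hcov : ∀ t, covMat (S.nominal t : Measure (Vec nx)) = S.SigHat)
    (hlam : 0 < lam) (hP : S.IsARESolution lam P)
    (hlamP : (lam • (1 : Matrix (Fin nx) (Fin nx) ℝ) - P).PosDef)
    (hPhi : (S.Phi lam).PosSemidef) (hobs : IsObservable S.A (CFC.sqrt S.Q))
    {X Xm : Matrix (Fin nx) (Fin nx) ℝ} (hfeas : S.IsCovFeasible X Xm Sig)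
    (hdet : IsDetectable S.A S.C) (hstabSig : IsStabilizable S.A (CFC.sqrt Sig)) :
    (S.ssValue lam P X Sig : EReal) ≤ S.rho lam P Sig := by
  have hSig := hfeas.posSig
  have hx := S.memLp_ssPairLaw (lam := lam) (P := P) (Sig := Sig) hinit
  have hw := fun t => S.memLp_ssDistAt (lam := lam) (P := P) (Sig := Sig) (hx t)
  have hSs := S.posSemidef_Sss hP hPhi
  have hb0 := buresSq_nonneg hSig (hcov 0 ▸ posSemidef_covMat (hnom 0) : S.SigHat.PosSemidef)
  set μ := fun t => S.ssPairLaw lam P Sig t with hμ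
  set s : ℕ → ℝ := fun t => S.stageInt (S.ssCtrlAt lam P (μ t)) (μ t) with hs
  set G : ℕ → ℝ := fun t => S.meanShift lam P (μ t) + buresSq Sig S.SigHat with hG
  set V : ℕ → ℝ := fun t => S.relValue lam P (μ t) with hV
  set Y : ℕ → Matrix (Fin nx) (Fin nx) ℝ := fun t => (riccatiStep S.A S.C S.M Sig)^[t] 0 with hY
  set c0 := S.meanValue lam P + (P * Sig).trace - lam * buresSq Sig S.SigHat with hc0
  -- Both terms are finite, so the `EReal` difference is an ordinary real one.
  have hterm : ∀ t, (S.stageCost (S.ssPolicy lam P (S.ssDist lam P Sig)) (S.ssDist lam P Sig) t :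
      EReal) - (lam : EReal) *
      (S.stageGelbrich (S.ssPolicy lam P (S.ssDist lam P Sig)) (S.ssDist lam P Sig) t : EReal) =
      ((s t - lam * G t : ℝ) : EReal) := by
    intro t
    have h1 := S.stageCost_ssPolicy (lam := lam) (P := P) (γ := S.ssDist lam P Sig) hQ
      hR.posSemidef (t := t) (by rw [ssLaw_ssDist]; exact hx t)
    rw [ssLaw_ssDist] at h1
    have h2 : 0 ≤ G t := add_nonneg (integral_nonneg fun _ => by positivity) hb0
    rw [h1, S.stageGelbrich_ssPair hnom hmean hcov hinit hSig, EReal.coe_ennreal_ofReal,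
      EReal.coe_ennreal_ofReal, max_eq_left (S.stageInt_nonneg hQ hR.posSemidef), max_eq_left h2,
      ← EReal.coe_mul, ← EReal.coe_sub]
  -- Here the disturbance mean is exactly the saddle point and its covariance is `Sig`, so the
  -- Bellman identity has no deviation term. The only loss is replacing the error covariance by the
  -- smaller Riccati iterate.
  have hbell : ∀ t, c0 + (S.Sss P * Y t).trace ≤ s t - lam * G t + V (t + 1) - V t := by
    intro t
    have h1 := S.bellman_identity (hx t) (hw t) hQ hR hlam hP hlamP hPhi hobs
      (f := S.ssCtrlAt lam P (μ t)) fun _ => rfl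
    rw [distCov_gaussian (S.measurable_distMeanAt_condMean _) hSig (S.ssDistAt_apply _)] at h1
    simp only [kernelMean_gaussian (S.ssDistAt_apply _), sub_self] at h1
    have h2 : quad (lam • 1 - P) (0 : Vec nx) = 0 := by rw [quad, inner_zero_left]
    simp only [h2, integral_zero, sub_zero] at h1
    have h3 := hSs.trace_mul_le ((S.hasGaussianPart_ssPairLaw (lam := lam) (P := P) hM hSig
      t).le_errCov (riccati_iterate_posSemidef (A := S.A) (C := S.C) hM hSig PosSemidef.zero t)
      (hx t))
    have h4 : V (t + 1) = S.relValue lam P (S.stepLaw (S.ssCtrlAt lam P (μ t))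
      (S.ssDistAt lam P Sig (μ t)) (μ t)) := rfl
    rw [h4]
    simp only [hG, hs, hV, hc0, hY, meanShift, hμ] at h1 h3 ⊢
    linarith
  -- Feasibility says precisely that `X` is a fixed point of the Riccati step with forcing `Sig`.
  have hYlim : Tendsto (fun t => (S.Sss P * Y t).trace) atTop (nhds (S.Sss P * X).trace) :=
    tendsto_trace_mul _ (tendsto_riccati_zero hM hSig hstabSig hfeas.posX (by
      rw [riccatiStep, ← hfeas.pred]
      exact hfeas.upd.symm))
  obtain ⟨b, hb⟩ := S.exists_bound_integral_norm_sq (Sig := Sig) hQ hM hinit hlam hP hlamP hPhi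
    hobs hdet hSig
  have hVb : ∀ t, V t ≤ (lam + 1) * b + ‖S.rss lam P‖ ^ 2 := fun t =>
    (S.relValue_le hlamP (hx t)).trans (add_le_add_left
      (mul_le_mul_of_nonneg_left (hb t) (by linarith)) _)
  set k := V 0 - ((lam + 1) * b + ‖S.rss lam P‖ ^ 2) with hk
  have hsum : ∀ T : ℕ, T * c0 + ∑ t ∈ Finset.range T, (S.Sss P * Y t).trace + (V 0 - V T) ≤
      ∑ t ∈ Finset.range T, (s t - lam * G t) := by
    intro T
    induction T with
    | zero => simp
    | succ T ih =>
      rw [Finset.sum_range_succ, Finset.sum_range_succ]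
      have := hbell T
      push_cast
      linarith
  -- The traces of `Sig` and of the nominal covariance inside -λ times the Bures term regroup into
  -- the covariance objective. The final 0 matches the limit of k / T.
  have hval : S.ssValue lam P X Sig = c0 + (S.Sss P * X).trace + 0 := by
    simp only [ssValue, covObjective, hc0, buresSq, trace_add, trace_sub, trace_smul, smul_eq_mul,
      Matrix.sub_mul, smul_mul_assoc, Matrix.one_mul]
    ring
  have hlim : Tendsto (fun T : ℕ => c0 + (T : ℝ)⁻¹ * ∑ t ∈ Finset.range T, (S.Sss P * Y t).trace +
      k / T) atTop (nhds (c0 + (S.Sss P * X).trace + 0)) :=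
    (tendsto_const_nhds.add hYlim.cesaro).add (tendsto_const_div_atTop_nhds_zero_nat k)
  rw [rho, penAvgCost]
  simp only [hterm]
  simp only [coe_sum_div_eq (fun t => s t - lam * G t)]
  refine le_limsup_coe fun ε hε => ?_
  rw [hval]
  filter_upwards [hlim.eventually (eventually_gt_nhds (sub_lt_self _ hε)),
    eventually_gt_atTop 0] with T hT hT0
  have hT' : (0 : ℝ) < T := by exact_mod_cast hT0
  refine hT.le.trans ?_
  rw [le_div_iff₀ hT']
  refine le_trans (le_of_eq ?_) ((add_le_add_right (show k ≤ V 0 - V T by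
    have := hVb T; linarith) (T * c0 + ∑ t ∈ Finset.range T, (S.Sss P * Y t).trace)).trans
      (hsum T))
  field_simp

end LQSystem

end WDRC

/-! ### The guaranteed cost theorem. -/

theorem mainTheorem9 {nx nu ny : ℕ} (S : WDRC.LQSystem nx nu ny)
    (hQ : S.Q.PosSemidef) (hR : S.R.PosDef) (hM : S.M.PosDef)
    (hinit : MemLp id 2 (S.initLaw : Measure (WDRC.Vec nx)))
    (hnom : ∀ t, MemLp id 2 (S.nominal t : Measure (WDRC.Vec nx)))
    (hmean : ∀ t, WDRC.meanVec (S.nominal t : Measure (WDRC.Vec nx)) = S.wHat)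
    (hcov : ∀ t, WDRC.covMat (S.nominal t : Measure (WDRC.Vec nx)) = S.SigHat)
    (lam θ : ℝ) (hlam : 0 < lam) (hθ : 0 < θ)
    (P : Matrix (Fin nx) (Fin nx) ℝ) (hP : S.IsARESolution lam P)
    (hlamP : (lam • (1 : Matrix (Fin nx) (Fin nx) ℝ) - P).PosDef)
    (hPhi : (S.Phi lam).PosSemidef)
    (hstab : WDRC.IsStabilizable S.A (CFC.sqrt (S.Phi lam)))
    (hobs : WDRC.IsObservable S.A (CFC.sqrt S.Q))
    (X Xm Sig : Matrix (Fin nx) (Fin nx) ℝ) (hopt : S.IsCovOptimal lam P X Xm Sig)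
    (hdet : WDRC.IsDetectable S.A S.C)
    (hstabSig : WDRC.IsStabilizable S.A (CFC.sqrt Sig))
    (Γ : Set (WDRC.DistPolicy nx ny nu)) (hΓ : Γ ⊆ S.ambiguityPolicies θ)
    (hbias : ∀ γ ∈ Γ, S.BiasVanishes lam P X γ) :
    (⨆ γ ∈ Γ, S.avgCost (S.ssPolicy lam P γ) γ) ≤
      ((θ ^ 2 * lam : ℝ) : EReal) + S.rho lam P Sig := by
  refine iSup₂_le fun γ hγ => ?_
  refine (S.avgCost_ssPolicy_le hQ hR hM hinit hnom hmean hcov hlam hθ hP hlamP hPhi hobs hopt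
    hdet (hΓ hγ)).trans ?_
  rw [EReal.coe_add]
  gcongr
  exact S.ssValue_le_rho hQ hR hM hinit hnom hmean hcov hlam hP hlamP hPhi hobs hopt.1 hdet hstabSig
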